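/- Let $n>1$ be an integer, $s\ge 0$ and $1\le p<\infty$ real numbers, and write $s=k+\sigma$ with $k\in\mathbb{N}_0$, $\sigma\in[0,1)$. For a function $f$ on $\mathbb{R}^m$ with values in $\mathbb{R}^d$ put $$\|f\|_{W^{s,p}}=\sum_{j=0}^k\|D^jf\|_{L^p(\mathbb{R}^m)}+[D^kf]_{\sigma,p},\qquad [g]_{\sigma,p}=\left(\iint_{\mathbb{R}^m\times\mathbb{R}^m}\frac{|g(x)-g(y)|^p}{|x-y|^{m+\sigma p}}\,dx\,dy\right)^{1/p},$$ where $D^j$ denotes the $j$-th (weak) differential and the term $[D^kf]_{\sigma,p}$ is omitted if $\sigma=0$. For an open set $\Omega\subseteq\mathbb{R}^m$ let $W^{s,p}_0(\Omega;\mathbb{R}^d)$ be the closure of $C_c^\infty(\Omega;\mathbb{R}^d)$ (functions extended by zero) in $W^{s,p}(\mathbb{R}^m;\mathbb{R}^d)$, with the norm $\|\cdot\|_{W^{s,p}}$ on all of $\mathbb{R}^m$; we omit $\mathbb{R}^d$ if $d=1$. Let $B_1(\mathbb{R}^n)$ be the open unit ball. (1) The operator $Tf(x)=f(|x|)$ maps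 $C_c^\infty((0,1))$ into $C_c^\infty(B_1(\mathbb{R}^n))$, and there is a constant $C=C(s,p,n)>0$ such that $\|Tf\|_{W^{s,p}}\le C\|f\|_{W^{s,p}}$ for all $f\in C_c^\infty((0,1))$. Moreover $f\mapsto f(|x|)$ is a bounded operator $T:W^{s,p}_0(0,1)\to W^{s,p}_0(B_1(\mathbb{R}^n))$, with the same bound. (2) The operator $\tilde Tf(x)=f(|x|)\frac{x}{|x|}$ maps $C_c^\infty((0,1))$ into $C_c^\infty(B_1(\mathbb{R}^n);\mathbb{R}^n)$, and there is a constant $C=C(s,p,n)>0$ such that $\|\tilde Tf\|_{W^{s,p}}\le C\|f\|_{W^{s,p}}$ for all $f\in C_c^\infty((0,1))$. Moreover $f\mapsto f(|x|)\frac{x}{|x|}$ is a bounded operator $\tilde T:W^{s,p}_0(0,1)\to W^{s,p}_0(B_1(\mathbb{R}^n);\mathbb{R}^n)$, with the same bound. -/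

import Mathlib

open MeasureTheory Set TopologicalSpace
open scoped ENNReal NNReal Distributions

noncomputable section

namespace RadialSobolev

section General

variable {E F : Type*} [NormedAddCommGroup E] [NormedSpace ℝ E] [MeasureSpace E]
  [NormedAddCommGroup F] [NormedSpace ℝ F]

/-- The Gagliardo seminorm
`(∬ |g x - g y| ^ p / |x - y| ^ (dim E + σ * p) dx dy) ^ (1 / p)`, over the whole of `E × E`. -/
def gagliardoSeminorm (σ p : ℝ) (g : E → F) : ℝ≥0∞ :=
  (∫⁻ x, ∫⁻ y, ‖g x - g y‖ₑ ^ p / ‖x - y‖ₑ ^ ((Module.finrank ℝ E : ℝ) + σ * p)) ^ (1 / p)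

/-- The `W^{s,p}(E)`-norm computed from given derivatives `G 0, …, G k` of orders `0, …, k`,
where `s = k + σ` with `k` a natural number and `σ ∈ [0,1)`: the sum of the `L^p`-norms of all
of them, plus, for non-integer `s`, the `(σ,p)`-Gagliardo seminorm of the top one. -/
def normOfDerivs (s p : ℝ) (G : (j : ℕ) → E → E [×j]→L[ℝ] F) : ℝ≥0∞ :=
  (∑ j ∈ Finset.range (⌊s⌋₊ + 1), eLpNorm (G j) (ENNReal.ofReal p) volume) +
    if Int.fract s = 0 then 0 else gagliardoSeminorm (Int.fract s) p (G ⌊s⌋₊)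

/-- The `W^{s,p}(E)`-norm of a smooth function, computed from its classical differentials. -/
def smoothNorm (s p : ℝ) (f : E → F) : ℝ≥0∞ :=
  normOfDerivs s p (fun j => iteratedFDeriv ℝ j f)

/-- `g` is the `j`-th weak differential of `f` on `E`. -/
structure IsWeakDeriv (j : ℕ) (f : E → F) (g : E → E [×j]→L[ℝ] F) : Prop where
  locallyIntegrable : LocallyIntegrable f volume
  locallyIntegrable_deriv : LocallyIntegrable g volume
  integral_eq : ∀ (φ : 𝓓((⊤ : Opens E), ℝ)) (v : Fin j → E),
    ∫ x, iteratedFDeriv ℝ j φ x v • f x = (-1 : ℝ) ^ j • ∫ x, φ x • g x v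

/-- The `W^{s,p}(E)`-norm of an arbitrary function. Weak differentials are unique up to null sets,
so the infimum runs over equal values; it is `∞` if some weak differential
of order at most `⌊s⌋` fails to exist. -/
def sobolevNorm (s p : ℝ) (f : E → F) : ℝ≥0∞ :=
  ⨅ (G : (j : ℕ) → E → E [×j]→L[ℝ] F) (_ : ∀ j ≤ ⌊s⌋₊, IsWeakDeriv j f (G j)),
    normOfDerivs s p G

/-- Membership in `W^{s,p}_0(Ω)`, the closure of `C_c^∞(Ω)` in `W^{s,p}(E)`; its elements
are regarded as functions on `E` vanishing almost everywhere outside `Ω`, and its norm is the one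
of `W^{s,p}(E)`. -/
def MemSobolevZero (s p : ℝ) (Ω : Opens E) (f : E → F) : Prop :=
  sobolevNorm s p f < ∞ ∧
    ∀ ε : ℝ≥0∞, 0 < ε → ∃ φ : 𝓓(Ω, F), sobolevNorm s p (fun x => f x - φ x) < ε

end General

/-- The open interval `(0,1)`. -/
def interval01 : Opens ℝ := ⟨Ioo 0 1, isOpen_Ioo⟩

/-- The open unit ball of `ℝⁿ`. -/
def unitBall (n : ℕ) : Opens (EuclideanSpace ℝ (Fin n)) := ⟨Metric.ball 0 1, Metric.isOpen_ball⟩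

/-- The operator `T f (x) = f (|x|)`. -/
def radialFunction (n : ℕ) (f : ℝ → ℝ) (x : EuclideanSpace ℝ (Fin n)) : ℝ := f ‖x‖

/-- The operator `T̃ f (x) = f (|x|) x / |x|`. -/
def radialField (n : ℕ) (f : ℝ → ℝ) (x : EuclideanSpace ℝ (Fin n)) : EuclideanSpace ℝ (Fin n) :=
  f ‖x‖ • (‖x‖⁻¹ • x)

end RadialSobolev

end

open MeasureTheory Set TopologicalSpace
open scoped ENNReal NNReal Distributions

/-! Call a map angular if it is smooth off the origin and homogeneous of degree 0. Both operators
have the form f ↦ f(|x|) P(x) with P angular: P = 1 for T and P = x/|x| for T̃. The k-th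
differential of f(|x|) P(x) is a sum over i ≤ k of terms f^(i)(|x|) |x|^(-(k-i)) Q_i(x) with Q_i
angular and independent of f (`iteratedFDeriv_radial_smul`). The negative powers are harmless: f
vanishes near 0, so Taylor's formula at 0 writes f^(i)(r) r^(-(k-i)), for i < k, as an average of
F(tr) over t in (0,1] with bounded weight, where F = f^(k). Every term is thus an average of dilates
of G(x) = F(|x|) Q(x) (`exists_dilation_representation`).

By Jensen and a change of variables on a ball, averaging dilates costs the weight |x|^(1-n), because
the integral of t^(-n) over t > a is at most a^(1-n) when n ≥ 2 (`lintegral_ball_dilation_le`). This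
weight is the inverse of the polar Jacobian, so the L^p-norm reduces to that of F on the line.

For the Gagliardo seminorm the same device on ℝⁿ × ℝⁿ handles bounded pairs and produces the weight
max(|x|,|y|)^(1-n); the remaining pairs have |x - y| > 1 or contribute nothing, and are controlled
by the L^p-norm. In the weighted integral, G(x) - G(y) = (F(|x|) - F(|y|)) Q(x) + F(|y|) (Q(x) -
Q(y)). For the first summand, a ball meets a sphere about 0 in a cap of controlled size, so the
n-dimensional kernel is dominated by the one-dimensional one (`lintegral_radial_kernel_le`). For the
second, |Q(x) - Q(y)| is at most a constant times min(1, |x - y|/|y|), which leaves the integral of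
|F(r)|^p r^(-σp), and this is bounded by a Hardy inequality (`lintegral_hardy_le`).

The bound passes to the closure by approximation: images of a fast approximating sequence are
Cauchy, their limits are the weak differentials of the image, and Fatou preserves the constant
(`sobolevNorm_radial_le`). -/

namespace RadialSobolev


/-! ### Polar coordinates and the size of spherical caps -/

section Polar

variable {n : ℕ}

/-- The surface measure of the unit sphere of `ℝⁿ`. -/
noncomputable abbrev sphereMeasure (n : ℕ) :
    Measure (Metric.sphere (0 : EuclideanSpace ℝ (Fin n)) 1) :=
  (volume : Measure (EuclideanSpace ℝ (Fin n))).toSphere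

theorem ofReal_pow_sub_one (hn : 1 ≤ n) {r : ℝ} (hr : 0 < r) :
    ENNReal.ofReal (r ^ (n - 1)) = ‖r‖ₑ ^ ((n : ℝ) - 1) := by
  rw [ENNReal.ofReal_pow hr.le, Real.enorm_eq_ofReal hr.le, ← ENNReal.rpow_natCast]
  push_cast [hn]; rfl

theorem lintegral_polar (hn : 1 ≤ n) {f : EuclideanSpace ℝ (Fin n) → ℝ≥0∞} (hf : Measurable f) :
    ∫⁻ x, f x = ∫⁻ r in Ioi (0 : ℝ), ‖r‖ₑ ^ ((n : ℝ) - 1) *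
      ∫⁻ ω, f (r • (ω : EuclideanSpace ℝ (Fin n))) ∂(sphereMeasure n) := by
  have hne : Nontrivial (EuclideanSpace ℝ (Fin n)) := by
    apply Module.nontrivial_of_finrank_pos (R := ℝ); simp; omega
  have hmp := (volume : Measure (EuclideanSpace ℝ (Fin n))).measurePreserving_homeomorphUnitSphereProd
  have hm : Measurable fun z : Metric.sphere (0 : EuclideanSpace ℝ (Fin n)) 1 × Ioi (0 : ℝ) =>
      f ((z.2 : ℝ) • (z.1 : EuclideanSpace ℝ (Fin n))) := by fun_prop
  calc ∫⁻ x, f x = ∫⁻ x in ({0}ᶜ : Set (EuclideanSpace ℝ (Fin n))), f x := by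
        rw [restrict_compl_singleton]
    _ = ∫⁻ x : ({0}ᶜ : Set (EuclideanSpace ℝ (Fin n))), f x ∂(Measure.comap Subtype.val volume) := by
        rw [lintegral_subtype_comap (by measurability)]
    _ = ∫⁻ z, f ((z.2 : ℝ) • (z.1 : EuclideanSpace ℝ (Fin n)))
          ∂((sphereMeasure n).prod (Measure.volumeIoiPow (n - 1))) := by
        have := hmp.lintegral_comp_emb (Homeomorph.measurableEmbedding _)
          (fun z => f ((z.2 : ℝ) • (z.1 : EuclideanSpace ℝ (Fin n))))
        simp only [finrank_euclideanSpace_fin] at this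
        rw [← this]
        refine lintegral_congr fun x => ?_
        congr 1
        rw [← homeomorphUnitSphereProd_symm_apply_coe, Homeomorph.symm_apply_apply]
    _ = ∫⁻ r, ∫⁻ ω, f ((r : ℝ) • (ω : EuclideanSpace ℝ (Fin n))) ∂(sphereMeasure n)
          ∂(Measure.volumeIoiPow (n - 1)) := by
        rw [lintegral_prod_symm' _ hm]
    _ = _ := by
        have hm2 : Measurable fun r : ℝ => ∫⁻ ω, f (r • (ω : EuclideanSpace ℝ (Fin n)))
            ∂(sphereMeasure n) := by
          apply Measurable.lintegral_prod_right'
            (f := fun z : ℝ × Metric.sphere (0 : EuclideanSpace ℝ (Fin n)) 1 =>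
              f (z.1 • (z.2 : EuclideanSpace ℝ (Fin n))))
          fun_prop
        rw [Measure.volumeIoiPow, lintegral_withDensity_eq_lintegral_mul _ (by fun_prop) (by fun_prop)]
        simp only [Pi.mul_apply]
        rw [lintegral_subtype_comap measurableSet_Ioi (fun r : ℝ => ENNReal.ofReal (r ^ (n - 1)) *
          ∫⁻ ω, f (r • (ω : EuclideanSpace ℝ (Fin n))) ∂(sphereMeasure n))]
        refine setLIntegral_congr_fun measurableSet_Ioi fun r hr => ?_
        rw [ofReal_pow_sub_one hn hr]

theorem lintegral_fun_norm (hn : 1 ≤ n) {h : ℝ → ℝ≥0∞} (hh : Measurable h) :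
    ∫⁻ x : EuclideanSpace ℝ (Fin n), h ‖x‖ =
      sphereMeasure n univ * ∫⁻ r in Ioi (0 : ℝ), ‖r‖ₑ ^ ((n : ℝ) - 1) * h r := by
  rw [lintegral_polar hn (by fun_prop), ← lintegral_const_mul _ (by fun_prop)]
  refine setLIntegral_congr_fun measurableSet_Ioi fun r (hr : 0 < r) => ?_
  simp only [norm_smul, Real.norm_of_nonneg hr.le, norm_eq_of_mem_sphere, mul_one,
    lintegral_const]
  ring

/-- Transfers almost everywhere convergence on the line to almost everywhere convergence of the
associated radial functions. -/
theorem quasiMeasurePreserving_norm (hn : 1 ≤ n) :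
    Measure.QuasiMeasurePreserving (fun x : EuclideanSpace ℝ (Fin n) => ‖x‖) volume volume := by
  refine ⟨measurable_norm, Measure.AbsolutelyContinuous.mk fun s hs h0 => ?_⟩
  rw [Measure.map_apply measurable_norm hs, ← lintegral_indicator_one (measurable_norm hs)]
  have := lintegral_fun_norm hn (h := s.indicator 1) (measurable_one.indicator hs)
  rw [show (fun x : EuclideanSpace ℝ (Fin n) => s.indicator (1 : ℝ → ℝ≥0∞) ‖x‖) =
    ((fun x : EuclideanSpace ℝ (Fin n) => ‖x‖) ⁻¹' s).indicator 1 from rfl] at this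
  rw [this]
  have hz : (fun r => ‖r‖ₑ ^ ((n : ℝ) - 1) * s.indicator (1 : ℝ → ℝ≥0∞) r) =ᵐ[volume] 0 := by
    have : ∀ᵐ r : ℝ, r ∉ s := measure_eq_zero_iff_ae_notMem.1 h0
    filter_upwards [this] with r hr
    simp [hr]
  rw [lintegral_congr_ae (ae_restrict_of_ae hz)]
  simp

/-- In an orthonormal basis extending θ the set lies in a box with one side 2 and n - 1 sides 2ε. -/
theorem volume_box_le (hn : 1 ≤ n) {θ : EuclideanSpace ℝ (Fin n)} (hθ : ‖θ‖ = 1) {ε : ℝ}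
    (hε : 0 < ε) :
    volume {y : EuclideanSpace ℝ (Fin n) | ‖y‖ ≤ 1 ∧ ∀ e, inner ℝ e θ = 0 → ‖e‖ = 1 →
      |inner ℝ e y| ≤ ε} ≤ 2 ^ n * ‖ε‖ₑ ^ ((n : ℝ) - 1) := by
  set i0 : Fin n := ⟨0, hn⟩
  obtain ⟨b, hb⟩ := Orthonormal.exists_orthonormalBasis_extension_of_card_eq
    (𝕜 := ℝ) (E := EuclideanSpace ℝ (Fin n)) (ι := Fin n) (by simp) (v := fun _ => θ) (s := {i0})
    (by
      constructor
      · intro i; simpa using hθ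
      · intro i j hij
        exact absurd (Subtype.ext (i.2.trans j.2.symm)) hij)
  have hb0 : b i0 = θ := hb i0 rfl
  let B : Set (Fin n → ℝ) := Icc (fun i => if i = i0 then -1 else -ε) (fun i => if i = i0 then 1 else ε)
  have hmp := (EuclideanSpace.volume_preserving_symm_measurableEquiv_toLp (Fin n)).comp
    b.measurePreserving_repr
  have hsub : {y : EuclideanSpace ℝ (Fin n) | ‖y‖ ≤ 1 ∧ ∀ e, inner ℝ e θ = 0 → ‖e‖ = 1 →
      |inner ℝ e y| ≤ ε} ⊆ ((MeasurableEquiv.toLp 2 (Fin n → ℝ)).symm ∘ b.repr) ⁻¹' B := by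
    rintro y ⟨h1, h2⟩
    have key : ∀ i, |(b.repr y) i| ≤ if i = i0 then 1 else ε := by
      intro i
      rw [b.repr_apply_apply]
      split_ifs with hi
      · calc _ ≤ ‖b i‖ * ‖y‖ := abs_real_inner_le_norm _ _
          _ ≤ 1 := by simpa using h1
      · refine h2 _ ?_ (by simp)
        rw [← hb0]
        exact b.orthonormal.2 hi
    simp only [mem_preimage, B, mem_Icc, Pi.le_def]
    constructor <;> intro i <;> have := abs_le.1 (key i) <;>
      simp only [Function.comp_apply, MeasurableEquiv.coe_toLp_symm] <;>
      split_ifs at this ⊢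
    · exact this.1
    · exact this.1
    · exact this.2
    · exact this.2
  refine (measure_mono hsub).trans ?_
  rw [hmp.measure_preimage measurableSet_Icc.nullMeasurableSet, Real.volume_Icc_pi]
  have : ∀ i : Fin n, ENNReal.ofReal ((if i = i0 then (1 : ℝ) else ε) - (if i = i0 then -1 else -ε))
      = 2 * if i = i0 then 1 else ‖ε‖ₑ := by
    intro i
    split_ifs
    · norm_num
    · rw [Real.enorm_eq_ofReal hε.le, sub_neg_eq_add, ← two_mul, ENNReal.ofReal_mul (by norm_num)]
      simp
  simp_rw [this]
  rw [Finset.prod_mul_distrib, ← ofReal_pow_sub_one hn hε, Finset.prod_ite]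
  simp only [Finset.prod_const, Finset.card_univ, Fintype.card_fin, one_mul, one_pow]
  rw [Finset.filter_ne' , Finset.card_erase_of_mem (Finset.mem_univ _)]
  simp [ENNReal.ofReal_pow hε.le, Real.enorm_eq_ofReal hε.le]

/-- The sphere measure of a cap is n times the volume of the cone over it. For e orthogonal to θ,
the component of ω along e equals minus that of θ - ω, so the cone fits in the box of
`volume_box_le`. No smallness of ε is required. -/
theorem sphereMeasure_cap_le (hn : 1 ≤ n) {θ : EuclideanSpace ℝ (Fin n)} (hθ : ‖θ‖ = 1) {ε : ℝ}
    (hε : 0 < ε) :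
    sphereMeasure n {ω | ‖θ - (ω : EuclideanSpace ℝ (Fin n))‖ < ε} ≤
      n * 2 ^ n * ‖ε‖ₑ ^ ((n : ℝ) - 1) := by
  rw [Measure.toSphere_apply' _ (measurableSet_lt (by fun_prop) measurable_const), mul_assoc]
  simp only [finrank_euclideanSpace_fin]
  gcongr
  refine (measure_mono ?_).trans (volume_box_le hn hθ hε)
  rintro _ ⟨t, ht, _, ⟨ω, hω, rfl⟩, rfl⟩
  simp only [mem_ofPred_eq] at hω
  have hω1 : ‖(ω : EuclideanSpace ℝ (Fin n))‖ = 1 := by simp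
  simp only [mem_ofPred_eq, norm_smul, hω1, Real.norm_of_nonneg ht.1.le, mul_one]
  refine ⟨ht.2.le, fun e he he1 => ?_⟩
  rw [inner_smul_right, abs_mul, abs_of_pos ht.1]
  have h1 : inner ℝ e (ω : EuclideanSpace ℝ (Fin n)) = - inner ℝ e (θ - ω) := by
    rw [inner_sub_right, he]; ring
  rw [h1, abs_neg]
  have h2 : |inner ℝ e (θ - (ω : EuclideanSpace ℝ (Fin n)))| ≤ ε := by
    refine (abs_real_inner_le_norm _ _).trans ?_
    rw [he1, one_mul]; exact hω.le
  calc t * _ ≤ 1 * ε := mul_le_mul ht.2.le h2 (abs_nonneg _) zero_le_one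
    _ = ε := one_mul _

/-- The sphere of radius ρ about 0 meets the ball only if ρ is within τ of |x|, and then inside a
cap of radius 2τ/ρ about the direction of x. The Jacobian ρ^(n-1) cancels the ρ in the cap bound and
leaves τ^(n-1). -/
theorem lintegral_ball_fun_norm_le (hn : 1 ≤ n) (x : EuclideanSpace ℝ (Fin n)) {τ : ℝ} (hτ : 0 < τ)
    {h : ℝ → ℝ≥0∞} (hh : Measurable h) :
    ∫⁻ y in Metric.ball x τ, h ‖y‖ ≤ n * 2 ^ n * 2 ^ ((n : ℝ) - 1) * ‖τ‖ₑ ^ ((n : ℝ) - 1) *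
      ∫⁻ ρ in Ioi (0 : ℝ), (Metric.ball ‖x‖ τ).indicator h ρ := by
  have hn' : (0 : ℝ) ≤ (n : ℝ) - 1 := by
    have : (1 : ℝ) ≤ n := by exact_mod_cast hn
    linarith
  have hne : Nontrivial (EuclideanSpace ℝ (Fin n)) := by
    apply Module.nontrivial_of_finrank_pos (R := ℝ); simp; omega
  -- At x = 0 any unit vector serves as direction.
  obtain ⟨θ, hθ, hx⟩ : ∃ θ : EuclideanSpace ℝ (Fin n), ‖θ‖ = 1 ∧ x = ‖x‖ • θ := by
    by_cases hx : x = 0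
    · obtain ⟨θ, hθ⟩ := NormedSpace.sphere_nonempty (E := EuclideanSpace ℝ (Fin n))
        (x := 0) (r := 1) |>.2 zero_le_one
      exact ⟨θ, by simpa using hθ, by simp [hx]⟩
    · exact ⟨‖x‖⁻¹ • x, by simp [norm_smul, hx], by simp [smul_smul, hx]⟩
  rw [← lintegral_indicator measurableSet_ball,
    lintegral_polar hn ((by fun_prop : Measurable fun y : EuclideanSpace ℝ (Fin n) =>
      h ‖y‖).indicator measurableSet_ball),
    ← lintegral_const_mul _ (hh.indicator measurableSet_ball)]
  refine setLIntegral_mono ((hh.indicator measurableSet_ball).const_mul _) fun ρ (hρ : 0 < ρ) => ?_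
  have hsub : ∀ ω : Metric.sphere (0 : EuclideanSpace ℝ (Fin n)) 1,
      (Metric.ball x τ).indicator (fun y => h ‖y‖) (ρ • (ω : EuclideanSpace ℝ (Fin n))) ≤
      {ω : Metric.sphere (0 : EuclideanSpace ℝ (Fin n)) 1 |
        ‖θ - (ω : EuclideanSpace ℝ (Fin n))‖ < 2 * τ / ρ}.indicator
        (fun _ => (Metric.ball ‖x‖ τ).indicator h ρ) ω := by
    intro ω
    by_cases hm : ρ • (ω : EuclideanSpace ℝ (Fin n)) ∈ Metric.ball x τ
    swap
    · rw [indicator_of_notMem hm]; exact zero_le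
    rw [indicator_of_mem hm]
    have hω1 : ‖(ω : EuclideanSpace ℝ (Fin n))‖ = 1 := by simp
    have hnorm : ‖ρ • (ω : EuclideanSpace ℝ (Fin n))‖ = ρ := by
      rw [norm_smul, hω1, mul_one, Real.norm_of_nonneg hρ.le]
    rw [Metric.mem_ball, dist_eq_norm] at hm
    have h1 : |ρ - ‖x‖| < τ := by
      have := abs_norm_sub_norm_le (ρ • (ω : EuclideanSpace ℝ (Fin n))) x
      rw [hnorm] at this
      exact this.trans_lt hm
    have h2 : ‖θ - (ω : EuclideanSpace ℝ (Fin n))‖ < 2 * τ / ρ := by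
      rw [lt_div_iff₀ hρ, mul_comm]
      calc ρ * ‖θ - (ω : EuclideanSpace ℝ (Fin n))‖
          = ‖(ρ - ‖x‖) • θ - (ρ • (ω : EuclideanSpace ℝ (Fin n)) - x)‖ := by
            rw [sub_smul, ← hx, sub_sub_sub_cancel_right, ← smul_sub, norm_smul,
              Real.norm_of_nonneg hρ.le]
        _ ≤ ‖(ρ - ‖x‖) • θ‖ + ‖ρ • (ω : EuclideanSpace ℝ (Fin n)) - x‖ := norm_sub_le _ _
        _ < τ + τ := by
            refine add_lt_add ?_ hm
            rwa [norm_smul, hθ, mul_one]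
        _ = 2 * τ := by ring
    rw [indicator_of_mem (by exact h2), indicator_of_mem (by
      rw [Metric.mem_ball, Real.dist_eq]; exact h1), hnorm]
  calc ‖ρ‖ₑ ^ ((n : ℝ) - 1) * _ ≤ ‖ρ‖ₑ ^ ((n : ℝ) - 1) *
        (n * 2 ^ n * ‖2 * τ / ρ‖ₑ ^ ((n : ℝ) - 1) * (Metric.ball ‖x‖ τ).indicator h ρ) := by
        gcongr
        refine (lintegral_mono hsub).trans ?_
        rw [lintegral_indicator (measurableSet_lt (by fun_prop) measurable_const)]
        rw [lintegral_const, Measure.restrict_apply MeasurableSet.univ, univ_inter, mul_comm]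
        gcongr
        exact sphereMeasure_cap_le hn hθ (by positivity)
    _ = _ := by
        have : ‖ρ‖ₑ ^ ((n : ℝ) - 1) * ‖2 * τ / ρ‖ₑ ^ ((n : ℝ) - 1) =
            2 ^ ((n : ℝ) - 1) * ‖τ‖ₑ ^ ((n : ℝ) - 1) := by
          rw [← ENNReal.mul_rpow_of_nonneg _ _ hn', ← ENNReal.mul_rpow_of_nonneg _ _ hn', ← enorm_mul]
          congr 1
          rw [mul_div_cancel₀ _ hρ.ne', enorm_mul]
          congr 1
          simp [Real.enorm_eq_ofReal]
        calc _ = n * 2 ^ n * (‖ρ‖ₑ ^ ((n : ℝ) - 1) * ‖2 * τ / ρ‖ₑ ^ ((n : ℝ) - 1)) *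
              (Metric.ball ‖x‖ τ).indicator h ρ := by ring
          _ = _ := by rw [this]; ring

end Polar


/-! ### One-dimensional power integrals -/

section PowerIntegrals

theorem lintegral_Ioi_enorm_rpow {a β : ℝ} (ha : 0 < a) (hβ : 0 < β) :
    ∫⁻ t in Ioi a, ‖t‖ₑ ^ (-β - 1) = ‖a‖ₑ ^ (-β) / ENNReal.ofReal β := by
  have h1 : ∀ t ∈ Ioi a, ‖t‖ₑ ^ (-β - 1) = ENNReal.ofReal (t ^ (-β - 1)) := fun t ht => by
    have : 0 < t := ha.trans ht
    rw [Real.enorm_eq_ofReal this.le, ENNReal.ofReal_rpow_of_pos this]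
  rw [setLIntegral_congr_fun measurableSet_Ioi h1,
    ← ofReal_integral_eq_lintegral_ofReal (integrableOn_Ioi_rpow_of_lt (by linarith) ha),
    integral_Ioi_rpow_of_lt (by linarith) ha, Real.enorm_eq_ofReal ha.le,
    ENNReal.ofReal_rpow_of_pos ha, ← ENNReal.ofReal_div_of_pos hβ]
  · congr 1
    rw [sub_add_cancel, neg_div_neg_eq]
  · filter_upwards [ae_restrict_mem measurableSet_Ioi] with t ht
    exact Real.rpow_nonneg (ha.trans ht).le _

theorem lintegral_Ioc_enorm_rpow {a β : ℝ} (ha : 0 < a) (hβ : 0 < β) :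
    ∫⁻ t in Ioc 0 a, ‖t‖ₑ ^ (β - 1) = ‖a‖ₑ ^ β / ENNReal.ofReal β := by
  have h1 : ∀ t ∈ Ioc 0 a, ‖t‖ₑ ^ (β - 1) = ENNReal.ofReal (t ^ (β - 1)) := fun t ht => by
    rw [Real.enorm_eq_ofReal ht.1.le, ENNReal.ofReal_rpow_of_pos ht.1]
  have hi := intervalIntegral.intervalIntegrable_rpow' (a := 0) (b := a) (r := β - 1) (by linarith)
  rw [setLIntegral_congr_fun measurableSet_Ioc h1,
    ← ofReal_integral_eq_lintegral_ofReal hi.1,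
    ← intervalIntegral.integral_of_le ha.le, integral_rpow (Or.inl (by linarith)),
    Real.enorm_eq_ofReal ha.le,
    ENNReal.ofReal_rpow_of_pos ha, ← ENNReal.ofReal_div_of_pos hβ]
  · congr 1
    rw [sub_add_cancel, Real.zero_rpow hβ.ne', sub_zero]
  · filter_upwards [ae_restrict_mem measurableSet_Ioc] with t ht
    exact Real.rpow_nonneg ht.1.le _

end PowerIntegrals

/-! ### Reduction of weighted Gagliardo integrals to the line -/

section Kernel

variable {n : ℕ}

/-- Layer-cake: the kernel is a superposition of indicators of balls about x.
`lintegral_ball_fun_norm_le` turns each ball into an interval about |x| at the price τ^(n-1), and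
summing the layers again gives the kernel of dimension 1. -/
theorem lintegral_radial_kernel_le (hn : 1 ≤ n) {α : ℝ} (hα : 0 < α) :
    ∃ C : ℝ≥0∞, C ≠ ∞ ∧ ∀ (x : EuclideanSpace ℝ (Fin n)) (h : ℝ → ℝ≥0∞), Measurable h →
      ∫⁻ y : EuclideanSpace ℝ (Fin n), h ‖y‖ * ‖x - y‖ₑ ^ (-((n : ℝ) + α)) ≤
        C * ∫⁻ ρ, h ρ * ‖‖x‖ - ρ‖ₑ ^ (-(1 + α)) := by
  have hne : Nontrivial (EuclideanSpace ℝ (Fin n)) := by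
    apply Module.nontrivial_of_finrank_pos (R := ℝ); simp; omega
  set β : ℝ := n + α with hβ
  have hβ0 : 0 < β := by positivity
  set c : ℝ≥0∞ := n * 2 ^ n * 2 ^ ((n : ℝ) - 1)
  have hc : c ≠ ∞ := by
    have : (2 : ℝ≥0∞) ^ ((n : ℝ) - 1) ≠ ∞ := by simp
    finiteness
  -- Here β comes from the layer-cake formula, c from the ball estimate, and 1/(α + 1) from
  -- integrating the layers back.
  refine ⟨ENNReal.ofReal β * (c / ENNReal.ofReal (α + 1)), ?_, fun x h hh => ?_⟩
  · have : ENNReal.ofReal (α + 1) ≠ 0 := by simp; linarith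
    finiteness
  have hball : ∀ {X : Type} [PseudoMetricSpace X] [MeasurableSpace X] [OpensMeasurableSpace X]
      [SecondCountableTopology X] (a : X),
      MeasurableSet {z : X × ℝ | z.1 ∈ Metric.ball a z.2} := fun a =>
    measurableSet_lt (f := fun z => dist z.1 a) (by fun_prop) measurable_snd
  have layer : ∀ u : ℝ, 0 < u → ‖u‖ₑ ^ (-β) =
      ENNReal.ofReal β * ∫⁻ τ in Ioi (0 : ℝ), (Ioi u).indicator (fun τ => ‖τ‖ₑ ^ (-β - 1)) τ := by
    intro u hu
    rw [lintegral_indicator measurableSet_Ioi, Measure.restrict_restrict measurableSet_Ioi,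
      inter_eq_self_of_subset_left (Ioi_subset_Ioi hu.le), lintegral_Ioi_enorm_rpow hu hβ0,
      ENNReal.mul_div_cancel (by simpa using hβ0) (by simp)]
  have hind : ∀ {X : Type} [PseudoMetricSpace X] (a y : X) (τ : ℝ) (g : X → ℝ≥0∞),
      g y * (Ioi (dist y a)).indicator (fun τ => ‖τ‖ₑ ^ (-β - 1)) τ =
        ‖τ‖ₑ ^ (-β - 1) * (Metric.ball a τ).indicator g y := by
    intro X _ a y τ g
    by_cases hd : dist y a < τ
    · rw [indicator_of_mem (by exact hd), indicator_of_mem (by exact hd), mul_comm]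
    · rw [indicator_of_notMem (by exact hd), indicator_of_notMem (by exact hd)]; simp
  have hmeas : Measurable fun z : EuclideanSpace ℝ (Fin n) × ℝ =>
      ‖z.2‖ₑ ^ (-β - 1) * (Metric.ball x z.2).indicator (fun y => h ‖y‖) z.1 := by
    refine Measurable.mul (by fun_prop) ?_
    exact (((by fun_prop : Measurable fun z : EuclideanSpace ℝ (Fin n) × ℝ => h ‖z.1‖)).indicator
      (hball x))
  have hmeas' : Measurable fun z : ℝ × ℝ =>
      ‖z.2‖ₑ ^ (-β - 1) * (‖z.2‖ₑ ^ ((n : ℝ) - 1) * (Metric.ball ‖x‖ z.2).indicator h z.1) := by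
    refine Measurable.mul (by fun_prop) (Measurable.mul (by fun_prop) ?_)
    exact (((by fun_prop : Measurable fun z : ℝ × ℝ => h z.1)).indicator (hball ‖x‖))
  calc ∫⁻ y : EuclideanSpace ℝ (Fin n), h ‖y‖ * ‖x - y‖ₑ ^ (-β)
      = ENNReal.ofReal β * ∫⁻ y : EuclideanSpace ℝ (Fin n), ∫⁻ τ in Ioi (0 : ℝ),
          ‖τ‖ₑ ^ (-β - 1) * (Metric.ball x τ).indicator (fun y => h ‖y‖) y := by
        rw [← lintegral_const_mul' _ _ (by simp)]
        have hx : ∀ᵐ y : EuclideanSpace ℝ (Fin n), y ≠ x :=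
          compl_mem_ae_iff.2 (measure_singleton x)
        refine lintegral_congr_ae ?_
        filter_upwards [hx] with y hy
        have h1 : ‖x - y‖ₑ = ‖dist y x‖ₑ := by
          rw [dist_eq_norm, enorm_norm, ← neg_sub, enorm_neg]
        rw [h1, layer _ (dist_pos.2 hy), mul_left_comm, ← lintegral_const_mul]
        · simp_rw [← hind x y _ (fun y => h ‖y‖)]
        · exact Measurable.indicator (by fun_prop) measurableSet_Ioi
    _ = ENNReal.ofReal β * ∫⁻ τ in Ioi (0 : ℝ), ‖τ‖ₑ ^ (-β - 1) *
          ∫⁻ y in Metric.ball x τ, h ‖y‖ := by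
        rw [lintegral_lintegral_swap (hmeas.aemeasurable)]
        congr 1
        refine lintegral_congr fun τ => ?_
        rw [lintegral_const_mul _ (Measurable.indicator (by fun_prop) measurableSet_ball),
          lintegral_indicator measurableSet_ball]
    _ ≤ ENNReal.ofReal β * ∫⁻ τ in Ioi (0 : ℝ), ‖τ‖ₑ ^ (-β - 1) * (c * ‖τ‖ₑ ^ ((n : ℝ) - 1) *
          ∫⁻ ρ in Ioi (0 : ℝ), (Metric.ball ‖x‖ τ).indicator h ρ) := by
        gcongr ENNReal.ofReal β * ?_
        refine setLIntegral_mono' measurableSet_Ioi fun τ hτ => ?_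
        gcongr
        exact lintegral_ball_fun_norm_le hn x hτ hh
    _ = ENNReal.ofReal β * (c * ∫⁻ τ in Ioi (0 : ℝ), ∫⁻ ρ in Ioi (0 : ℝ), ‖τ‖ₑ ^ (-β - 1) *
          (‖τ‖ₑ ^ ((n : ℝ) - 1) * (Metric.ball ‖x‖ τ).indicator h ρ)) := by
        rw [← lintegral_const_mul' _ _ hc]
        congr 1
        refine lintegral_congr fun τ => ?_
        rw [lintegral_const_mul _ (((hh.indicator measurableSet_ball)).const_mul _),
          lintegral_const_mul _ (hh.indicator measurableSet_ball)]
        ring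
    _ = ENNReal.ofReal β * (c * ∫⁻ ρ in Ioi (0 : ℝ), ∫⁻ τ in Ioi (0 : ℝ), ‖τ‖ₑ ^ (-β - 1) *
          (‖τ‖ₑ ^ ((n : ℝ) - 1) * (Metric.ball ‖x‖ τ).indicator h ρ)) := by
        rw [lintegral_lintegral_swap]
        exact (hmeas'.comp measurable_swap).aemeasurable
    _ ≤ ENNReal.ofReal β * (c * ∫⁻ ρ in Ioi (0 : ℝ),
          h ρ * (‖‖x‖ - ρ‖ₑ ^ (-(1 + α)) / ENNReal.ofReal (α + 1))) := by
        gcongr ENNReal.ofReal β * (c * ?_)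
        have hx : ∀ᵐ ρ : ℝ, ρ ≠ ‖x‖ := compl_mem_ae_iff.2 (measure_singleton _)
        refine lintegral_mono_ae ?_
        filter_upwards [ae_restrict_of_ae hx] with ρ hρ
        have hd : 0 < |‖x‖ - ρ| := abs_pos.2 (sub_ne_zero.2 hρ.symm)
        have h2 : ∀ τ ∈ Ioi (0 : ℝ), ‖τ‖ₑ ^ (-β - 1) *
            (‖τ‖ₑ ^ ((n : ℝ) - 1) * (Metric.ball ‖x‖ τ).indicator h ρ) =
            h ρ * (Ioi |‖x‖ - ρ|).indicator (fun τ => ‖τ‖ₑ ^ (-(α + 1) - 1)) τ := by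
          intro τ hτ
          have hτ' : ‖τ‖ₑ ≠ 0 := by simpa using (ne_of_gt hτ)
          by_cases hm : |‖x‖ - ρ| < τ
          · rw [indicator_of_mem (by rwa [Metric.mem_ball, Real.dist_eq, abs_sub_comm]),
              indicator_of_mem (by exact hm), ← mul_assoc,
              ← ENNReal.rpow_add _ _ hτ' (by simp), mul_comm]
            congr 2
            rw [hβ]; ring
          · rw [indicator_of_notMem (by rwa [Metric.mem_ball, Real.dist_eq, abs_sub_comm]),
              indicator_of_notMem (by exact hm)]; simp
        rw [setLIntegral_congr_fun measurableSet_Ioi h2,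
          lintegral_const_mul _ (Measurable.indicator (by fun_prop) measurableSet_Ioi),
          lintegral_indicator measurableSet_Ioi, Measure.restrict_restrict measurableSet_Ioi,
          inter_eq_self_of_subset_left (Ioi_subset_Ioi hd.le),
          lintegral_Ioi_enorm_rpow hd (by linarith), add_comm α 1, Real.enorm_abs]
    _ = ENNReal.ofReal β * (c / ENNReal.ofReal (α + 1)) * ∫⁻ ρ in Ioi (0 : ℝ),
          h ρ * ‖‖x‖ - ρ‖ₑ ^ (-(1 + α)) := by
        have : ∀ ρ, h ρ * (‖‖x‖ - ρ‖ₑ ^ (-(1 + α)) / ENNReal.ofReal (α + 1)) =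
            (ENNReal.ofReal (α + 1))⁻¹ * (h ρ * ‖‖x‖ - ρ‖ₑ ^ (-(1 + α))) := fun ρ => by
          rw [div_eq_mul_inv]; ring
        simp_rw [this]
        rw [lintegral_const_mul _ (by fun_prop)]
        rw [div_eq_mul_inv]; ring
    _ ≤ _ := by
        gcongr
        exact Measure.restrict_le_self

/-- The weight |x|^(1-n) is there to cancel the polar Jacobian of the outer variable. -/
theorem lintegral_lintegral_radial_kernel_le (hn : 1 ≤ n) {α : ℝ} (hα : 0 < α) :
    ∃ C : ℝ≥0∞, C ≠ ∞ ∧ ∀ K : ℝ → ℝ → ℝ≥0∞, Measurable (Function.uncurry K) →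
      ∫⁻ x : EuclideanSpace ℝ (Fin n), ∫⁻ y : EuclideanSpace ℝ (Fin n),
        K ‖x‖ ‖y‖ * ‖x - y‖ₑ ^ (-((n : ℝ) + α)) * ‖x‖ₑ ^ (1 - (n : ℝ)) ≤
        C * ∫⁻ r, ∫⁻ ρ, K r ρ * ‖r - ρ‖ₑ ^ (-(1 + α)) := by
  obtain ⟨C, hC, h⟩ := lintegral_radial_kernel_le hn hα
  refine ⟨C * sphereMeasure n univ, by finiteness, fun K hK => ?_⟩
  have hK' : ∀ r, Measurable (K r) := fun r => hK.comp measurable_prodMk_left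
  have hK2 : Measurable fun z : EuclideanSpace ℝ (Fin n) × EuclideanSpace ℝ (Fin n) =>
      K ‖z.1‖ ‖z.2‖ := hK.comp (by fun_prop : Measurable fun z :
        EuclideanSpace ℝ (Fin n) × EuclideanSpace ℝ (Fin n) => (‖z.1‖, ‖z.2‖))
  have hΦ : Measurable fun r : ℝ => ∫⁻ ρ, K r ρ * ‖r - ρ‖ₑ ^ (-(1 + α)) := by
    apply Measurable.lintegral_prod_right' (f := fun z : ℝ × ℝ => K z.1 z.2 * ‖z.1 - z.2‖ₑ ^ (-(1 + α)))
    exact hK.mul (by fun_prop)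
  calc _ ≤ ∫⁻ x : EuclideanSpace ℝ (Fin n), C * (‖‖x‖‖ₑ ^ (1 - (n : ℝ)) *
        ∫⁻ ρ, K ‖x‖ ρ * ‖‖x‖ - ρ‖ₑ ^ (-(1 + α))) := by
        refine lintegral_mono fun x => ?_
        have hKx : Measurable fun y : EuclideanSpace ℝ (Fin n) => K ‖x‖ ‖y‖ :=
          (hK' _).comp measurable_norm
        rw [lintegral_mul_const _ (by fun_prop), enorm_norm]
        calc _ ≤ (C * ∫⁻ ρ, K ‖x‖ ρ * ‖‖x‖ - ρ‖ₑ ^ (-(1 + α))) * ‖x‖ₑ ^ (1 - (n : ℝ)) := by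
              gcongr; exact h x _ (hK' _)
          _ = _ := by ring
    _ = C * (sphereMeasure n univ * ∫⁻ r in Ioi (0 : ℝ), ‖r‖ₑ ^ ((n : ℝ) - 1) *
          (‖r‖ₑ ^ (1 - (n : ℝ)) * ∫⁻ ρ, K r ρ * ‖r - ρ‖ₑ ^ (-(1 + α)))) := by
        rw [lintegral_const_mul' _ _ hC, lintegral_fun_norm hn (h := fun r => ‖r‖ₑ ^ (1 - (n : ℝ)) *
          ∫⁻ ρ, K r ρ * ‖r - ρ‖ₑ ^ (-(1 + α)))]
        exact Measurable.mul (by fun_prop) hΦ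
    _ = C * (sphereMeasure n univ * ∫⁻ r in Ioi (0 : ℝ),
          ∫⁻ ρ, K r ρ * ‖r - ρ‖ₑ ^ (-(1 + α))) := by
        congr 2
        refine setLIntegral_congr_fun measurableSet_Ioi fun r (hr : 0 < r) => ?_
        rw [← mul_assoc, ← ENNReal.rpow_add _ _ (by simpa using hr.ne') (by simp)]
        simp
    _ ≤ _ := by
        rw [mul_assoc]
        gcongr
        exact Measure.restrict_le_self

/-- With z = x - y, split at |z| = |y|. The inner part converges because σ < 1, the outer because σ
> 0, and both scale like |y|^(-σp). -/
theorem lintegral_min_kernel_le (hn : 1 ≤ n) {p σ : ℝ} (hp : 1 ≤ p) (hσ : 0 < σ) (hσ1 : σ < 1) :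
    ∃ C : ℝ≥0∞, C ≠ ∞ ∧ ∀ y : EuclideanSpace ℝ (Fin n), y ≠ 0 →
      ∫⁻ x : EuclideanSpace ℝ (Fin n), (min 1 (‖x - y‖ₑ / ‖y‖ₑ)) ^ p *
        ‖x - y‖ₑ ^ (-((n : ℝ) + σ * p)) ≤ C * ‖y‖ₑ ^ (-(σ * p)) := by
  have hp0 : 0 < p := by linarith
  have ha : 0 < σ * p := by positivity
  have hb : 0 < (1 - σ) * p := mul_pos (by linarith) hp0
  refine ⟨sphereMeasure n univ * (1 / ENNReal.ofReal ((1 - σ) * p) + 1 / ENNReal.ofReal (σ * p)),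
    ?_, fun y hy => ?_⟩
  · have h1 : ENNReal.ofReal ((1 - σ) * p) ≠ 0 := by simpa using hb
    have h2 : ENNReal.ofReal (σ * p) ≠ 0 := by simpa using ha
    finiteness
  have hy0 : 0 < ‖y‖ := norm_pos_iff.2 hy
  have hye : ‖y‖ₑ ≠ 0 := by simpa using hy
  have e1 : ∫⁻ x : EuclideanSpace ℝ (Fin n), (min 1 (‖x - y‖ₑ / ‖y‖ₑ)) ^ p *
        ‖x - y‖ₑ ^ (-((n : ℝ) + σ * p)) =
      ∫⁻ x : EuclideanSpace ℝ (Fin n), (min 1 (‖‖x‖‖ₑ / ‖y‖ₑ)) ^ p *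
        ‖‖x‖‖ₑ ^ (-((n : ℝ) + σ * p)) := by
    rw [lintegral_sub_right_eq_self (fun x : EuclideanSpace ℝ (Fin n) => (min 1 (‖x‖ₑ / ‖y‖ₑ)) ^ p *
        ‖x‖ₑ ^ (-((n : ℝ) + σ * p)))]
    simp_rw [enorm_norm]
  have hm : Measurable fun r : ℝ => (min 1 (‖r‖ₑ / ‖y‖ₑ)) ^ p * ‖r‖ₑ ^ (-((n : ℝ) + σ * p)) := by
    fun_prop
  rw [e1, lintegral_fun_norm hn (h := fun r => (min 1 (‖r‖ₑ / ‖y‖ₑ)) ^ p *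
        ‖r‖ₑ ^ (-((n : ℝ) + σ * p))) hm, mul_assoc]
  gcongr
  rw [← Ioc_union_Ioi_eq_Ioi hy0.le]
  refine (lintegral_union_le _ _ _).trans ?_
  rw [add_mul]
  refine add_le_add ?_ ?_
  · calc _ ≤ ∫⁻ r in Ioc 0 ‖y‖, ‖y‖ₑ ^ (-p) * ‖r‖ₑ ^ ((1 - σ) * p - 1) := by
          refine setLIntegral_mono' measurableSet_Ioc fun r hr => ?_
          have hr0 : ‖r‖ₑ ≠ 0 := by simpa using hr.1.ne'
          calc _ ≤ ‖r‖ₑ ^ ((n : ℝ) - 1) * ((‖r‖ₑ / ‖y‖ₑ) ^ p * ‖r‖ₑ ^ (-((n : ℝ) + σ * p))) := by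
                gcongr; exact min_le_right _ _
            _ = ‖y‖ₑ ^ (-p) * (‖r‖ₑ ^ ((n : ℝ) - 1) * ‖r‖ₑ ^ p * ‖r‖ₑ ^ (-((n : ℝ) + σ * p))) := by
                rw [ENNReal.div_rpow_of_nonneg _ _ hp0.le, ENNReal.rpow_neg ‖y‖ₑ, div_eq_mul_inv]; ring
            _ = _ := by
                rw [← ENNReal.rpow_add _ _ hr0 (by simp), ← ENNReal.rpow_add _ _ hr0 (by simp)]
                congr 2; ring
      _ = ‖y‖ₑ ^ (-p) * (‖y‖ₑ ^ ((1 - σ) * p) / ENNReal.ofReal ((1 - σ) * p)) := by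
          rw [lintegral_const_mul _ (by fun_prop), lintegral_Ioc_enorm_rpow hy0 hb, enorm_norm]
      _ = _ := by
          rw [div_eq_mul_inv, ← mul_assoc, ← ENNReal.rpow_add _ _ hye (by simp), mul_comm, one_div]
          congr 2; ring
      _ ≤ _ := le_rfl
  · calc _ ≤ ∫⁻ r in Ioi ‖y‖, ‖r‖ₑ ^ (-(σ * p) - 1) := by
          refine setLIntegral_mono' measurableSet_Ioi fun r hr => ?_
          have hr0 : ‖r‖ₑ ≠ 0 := by simpa using (hy0.trans hr).ne'
          calc _ ≤ ‖r‖ₑ ^ ((n : ℝ) - 1) * (1 ^ p * ‖r‖ₑ ^ (-((n : ℝ) + σ * p))) := by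
                gcongr; exact min_le_left _ _
            _ = _ := by
                rw [ENNReal.one_rpow, one_mul, ← ENNReal.rpow_add _ _ hr0 (by simp)]
                congr 1; ring
      _ = _ := by
          rw [lintegral_Ioi_enorm_rpow hy0 ha, enorm_norm, div_eq_mul_inv, mul_comm, one_div]
      _ ≤ _ := le_rfl

/-- Fractional Hardy inequality. The seminorm is taken over the whole line and F vanishes at ρ < 0,
so these ρ alone contribute |F(r)|^p r^(-σp) / (σp). Hence no exceptional value of σp occurs. -/
theorem lintegral_hardy_le {p σ : ℝ} (hp : 1 ≤ p) (hσ : 0 < σ) {F : ℝ → ℝ}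
    (hF0 : ∀ r ≤ 0, F r = 0) :
    ∫⁻ r in Ioi (0 : ℝ), ‖F r‖ₑ ^ p * ‖r‖ₑ ^ (-(σ * p)) ≤
      ENNReal.ofReal (σ * p) * ∫⁻ r, ∫⁻ ρ, ‖F r - F ρ‖ₑ ^ p * ‖r - ρ‖ₑ ^ (-(1 + σ * p)) := by
  have ha : 0 < σ * p := by positivity
  rw [← lintegral_const_mul' _ _ (by simp)]
  refine le_trans ?_ (setLIntegral_le_lintegral (Ioi 0) _)
  refine setLIntegral_mono' measurableSet_Ioi fun r (hr : 0 < r) => ?_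
  have h1 : ∫⁻ ρ in Iio (0 : ℝ), ‖r - ρ‖ₑ ^ (-(1 + σ * p)) = ∫⁻ t in Ioi r, ‖t‖ₑ ^ (-(σ * p) - 1) := by
    rw [← lintegral_indicator measurableSet_Iio, ← lintegral_indicator measurableSet_Ioi,
      ← lintegral_sub_left_eq_self ((Ioi r).indicator _) r]
    refine lintegral_congr fun ρ => ?_
    rw [neg_add_rev, ← sub_eq_add_neg]
    by_cases hρ : ρ < 0
    · rw [indicator_of_mem (by exact hρ), indicator_of_mem (by rw [mem_Ioi]; linarith)]
    · rw [indicator_of_notMem (by exact hρ), indicator_of_notMem (by rw [mem_Ioi]; linarith)]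
  calc ‖F r‖ₑ ^ p * ‖r‖ₑ ^ (-(σ * p))
      = ENNReal.ofReal (σ * p) * ∫⁻ ρ in Iio (0 : ℝ), ‖F r‖ₑ ^ p * ‖r - ρ‖ₑ ^ (-(1 + σ * p)) := by
        rw [lintegral_const_mul _ (by fun_prop), h1, lintegral_Ioi_enorm_rpow hr ha, mul_left_comm,
          ENNReal.mul_div_cancel (by simpa using ha) (by simp)]
    _ = ENNReal.ofReal (σ * p) * ∫⁻ ρ in Iio (0 : ℝ),
          ‖F r - F ρ‖ₑ ^ p * ‖r - ρ‖ₑ ^ (-(1 + σ * p)) := by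
        congr 1
        refine setLIntegral_congr_fun measurableSet_Iio fun ρ (hρ : ρ < 0) => ?_
        rw [hF0 ρ hρ.le, sub_zero]
    _ ≤ _ := by
        gcongr
        exact Measure.restrict_le_self

theorem rpow_max_le {a b : ℝ≥0∞} {z : ℝ} (hz : z ≤ 0) : max a b ^ z ≤ a ^ z := by
  rw [← neg_neg z, ENNReal.rpow_neg, ENNReal.rpow_neg a]
  exact ENNReal.inv_le_inv.2 (ENNReal.rpow_le_rpow (le_max_left _ _) (by linarith))

/-- Uses au - bv = (a - b)u + b(u - v). As 1 - n ≤ 0, the symmetric weight is below both |x|^(1-n)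
and |y|^(1-n), so each summand receives the weight in the variable that suits it. -/
theorem enorm_smul_sub_smul_rpow_le {p : ℝ} (hp : 1 ≤ p) (hn : 1 ≤ n)
    {V : Type*} [NormedAddCommGroup V] [NormedSpace ℝ V] {u v : V} {L : ℝ≥0∞}
    {x y : EuclideanSpace ℝ (Fin n)} (h1 : ‖u‖ₑ ≤ L)
    (h2 : ‖u - v‖ₑ ≤ L * min 1 (‖x - y‖ₑ / ‖y‖ₑ)) (a b : ℝ) (k : ℝ≥0∞) :
    ‖a • u - b • v‖ₑ ^ p * k * max ‖x‖ₑ ‖y‖ₑ ^ (1 - (n : ℝ)) ≤ 2 ^ (p - 1) * L ^ p *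
      (‖a - b‖ₑ ^ p * k * ‖x‖ₑ ^ (1 - (n : ℝ)) +
        ‖b‖ₑ ^ p * ‖y‖ₑ ^ (1 - (n : ℝ)) * ((min 1 (‖x - y‖ₑ / ‖y‖ₑ)) ^ p * k)) := by
  have hp0 : 0 < p := by linarith
  have hn' : 1 - (n : ℝ) ≤ 0 := by
    have : (1 : ℝ) ≤ n := by exact_mod_cast hn
    linarith
  have e1 : ‖a • u - b • v‖ₑ ≤ L * ‖a - b‖ₑ +
      L * (‖b‖ₑ * min 1 (‖x - y‖ₑ / ‖y‖ₑ)) := by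
    have : a • u - b • v = (a - b) • u + b • (u - v) := by
      rw [sub_smul, smul_sub]; abel
    rw [this]
    refine (enorm_add_le _ _).trans ?_
    rw [enorm_smul, enorm_smul]
    refine add_le_add ?_ ?_
    · rw [mul_comm]; gcongr
    · rw [mul_left_comm]; gcongr
  have e2 : ‖a • u - b • v‖ₑ ^ p ≤ 2 ^ (p - 1) * L ^ p *
      (‖a - b‖ₑ ^ p + ‖b‖ₑ ^ p * (min 1 (‖x - y‖ₑ / ‖y‖ₑ)) ^ p) := by
    calc _ ≤ (L * ‖a - b‖ₑ + L * (‖b‖ₑ * min 1 (‖x - y‖ₑ / ‖y‖ₑ))) ^ p := by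
          gcongr
      _ ≤ _ := ENNReal.rpow_add_le_mul_rpow_add_rpow _ _ hp
      _ = _ := by
          rw [ENNReal.mul_rpow_of_nonneg _ _ hp0.le, ENNReal.mul_rpow_of_nonneg _ _ hp0.le,
            ENNReal.mul_rpow_of_nonneg _ _ hp0.le]
          ring
  have m1 : max ‖x‖ₑ ‖y‖ₑ ^ (1 - (n : ℝ)) ≤ ‖x‖ₑ ^ (1 - (n : ℝ)) :=
    rpow_max_le hn'
  have m2 : max ‖x‖ₑ ‖y‖ₑ ^ (1 - (n : ℝ)) ≤ ‖y‖ₑ ^ (1 - (n : ℝ)) :=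
    by rw [max_comm]; exact rpow_max_le hn'
  set M := max ‖x‖ₑ ‖y‖ₑ ^ (1 - (n : ℝ))
  calc _ ≤ 2 ^ (p - 1) * L ^ p * (‖a - b‖ₑ ^ p +
          ‖b‖ₑ ^ p * (min 1 (‖x - y‖ₑ / ‖y‖ₑ)) ^ p) * k * M := by gcongr
    _ = 2 ^ (p - 1) * L ^ p * (‖a - b‖ₑ ^ p * k * M +
          ‖b‖ₑ ^ p * M * ((min 1 (‖x - y‖ₑ / ‖y‖ₑ)) ^ p * k)) := by ring
    _ ≤ _ := by
        gcongr

/-- The radial increment `A` is bounded by the kernel reduction. In the angular increment `B` the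
variable x is integrated first, which leaves a radial integral in y for the Hardy inequality. -/
theorem lintegral_angular_gagliardo_le (hn : 1 ≤ n) {p σ : ℝ} (hp : 1 ≤ p) (hσ : 0 < σ)
    (hσ1 : σ < 1) :
    ∃ C : ℝ≥0∞, C ≠ ∞ ∧ ∀ {V : Type*} [NormedAddCommGroup V] [NormedSpace ℝ V]
      (Q : EuclideanSpace ℝ (Fin n) → V) (L : ℝ≥0∞) (F : ℝ → ℝ), (∀ x, ‖Q x‖ₑ ≤ L) →
      (∀ x y, x ≠ 0 → y ≠ 0 → ‖Q x - Q y‖ₑ ≤ L * min 1 (‖x - y‖ₑ / ‖y‖ₑ)) →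
      Measurable F → (∀ r ≤ 0, F r = 0) →
      ∫⁻ x : EuclideanSpace ℝ (Fin n), ∫⁻ y : EuclideanSpace ℝ (Fin n),
        ‖F ‖x‖ • Q x - F ‖y‖ • Q y‖ₑ ^ p * ‖x - y‖ₑ ^ (-((n : ℝ) + σ * p)) *
          max ‖x‖ₑ ‖y‖ₑ ^ (1 - (n : ℝ)) ≤
      C * L ^ p * ∫⁻ r, ∫⁻ ρ, ‖F r - F ρ‖ₑ ^ p * ‖r - ρ‖ₑ ^ (-(1 + σ * p)) := by
  have hne : Nontrivial (EuclideanSpace ℝ (Fin n)) := by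
    apply Module.nontrivial_of_finrank_pos (R := ℝ); simp; omega
  have hp0 : 0 < p := by linarith
  have ha : 0 < σ * p := by positivity
  obtain ⟨C₁, hC₁, h₁⟩ := lintegral_lintegral_radial_kernel_le hn ha
  obtain ⟨C₂, hC₂, h₂⟩ := lintegral_min_kernel_le hn hp hσ hσ1
  have h2p : (2 : ℝ≥0∞) ^ (p - 1) ≠ ∞ := by
    apply ENNReal.rpow_ne_top_of_nonneg <;> [linarith; simp]
  refine ⟨2 ^ (p - 1) * (C₁ + C₂ * (sphereMeasure n univ * ENNReal.ofReal (σ * p))), by finiteness,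
    fun {V} _ _ Q L F hQ1 hQ2 hF hF0 => ?_⟩
  set I := ∫⁻ r, ∫⁻ ρ, ‖F r - F ρ‖ₑ ^ p * ‖r - ρ‖ₑ ^ (-(1 + σ * p))
  have hae : ∀ᵐ x : EuclideanSpace ℝ (Fin n), x ≠ 0 := compl_mem_ae_iff.2 (measure_singleton _)
  let A : EuclideanSpace ℝ (Fin n) → EuclideanSpace ℝ (Fin n) → ℝ≥0∞ := fun x y =>
    ‖F ‖x‖ - F ‖y‖‖ₑ ^ p * ‖x - y‖ₑ ^ (-((n : ℝ) + σ * p)) * ‖x‖ₑ ^ (1 - (n : ℝ))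
  let B : EuclideanSpace ℝ (Fin n) → EuclideanSpace ℝ (Fin n) → ℝ≥0∞ := fun x y =>
    ‖F ‖y‖‖ₑ ^ p * ‖y‖ₑ ^ (1 - (n : ℝ)) *
      ((min 1 (‖x - y‖ₑ / ‖y‖ₑ)) ^ p * ‖x - y‖ₑ ^ (-((n : ℝ) + σ * p)))
  have hAm : Measurable (Function.uncurry A) := by
    simp only [A, Function.uncurry_def]; fun_prop
  have hBm : Measurable (Function.uncurry B) := by
    simp only [B, Function.uncurry_def]; fun_prop
  have hA : ∫⁻ x, ∫⁻ y, A x y ≤ C₁ * I := by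
    refine h₁ (fun r ρ => ‖F r - F ρ‖ₑ ^ p) ?_
    simp only [Function.uncurry_def]; fun_prop
  have hB : ∫⁻ x, ∫⁻ y, B x y ≤ C₂ * (sphereMeasure n univ * ENNReal.ofReal (σ * p)) * I := by
    rw [lintegral_lintegral_swap hBm.aemeasurable]
    calc ∫⁻ y, ∫⁻ x, B x y ≤ ∫⁻ y : EuclideanSpace ℝ (Fin n), C₂ * (‖F ‖y‖‖ₑ ^ p *
            ‖‖y‖‖ₑ ^ (1 - (n : ℝ)) * ‖‖y‖‖ₑ ^ (-(σ * p))) := by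
          refine lintegral_mono_ae ?_
          filter_upwards [hae] with y hy
          simp only [B]
          rw [lintegral_const_mul _ (by fun_prop), enorm_norm]
          calc _ ≤ ‖F ‖y‖‖ₑ ^ p * ‖y‖ₑ ^ (1 - (n : ℝ)) * (C₂ * ‖y‖ₑ ^ (-(σ * p))) := by
                gcongr; exact h₂ y hy
            _ = _ := by ring
      _ = C₂ * (sphereMeasure n univ * ∫⁻ r in Ioi (0 : ℝ), ‖F r‖ₑ ^ p * ‖r‖ₑ ^ (-(σ * p))) := by
          rw [lintegral_const_mul' _ _ hC₂, lintegral_fun_norm hn (h := fun r => ‖F r‖ₑ ^ p *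
            ‖r‖ₑ ^ (1 - (n : ℝ)) * ‖r‖ₑ ^ (-(σ * p))) (by fun_prop)]
          congr 2
          refine setLIntegral_congr_fun measurableSet_Ioi fun r (hr : 0 < r) => ?_
          have hr0 : ‖r‖ₑ ≠ 0 := by simpa using hr.ne'
          calc _ = ‖F r‖ₑ ^ p * (‖r‖ₑ ^ ((n : ℝ) - 1) * ‖r‖ₑ ^ (1 - (n : ℝ))) * ‖r‖ₑ ^ (-(σ * p)) := by
                ring
            _ = _ := by
                rw [← ENNReal.rpow_add _ _ hr0 (by simp)]; simp
      _ ≤ C₂ * (sphereMeasure n univ * (ENNReal.ofReal (σ * p) * I)) := by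
          gcongr
          exact lintegral_hardy_le hp hσ hF0
      _ = _ := by ring
  calc _ ≤ ∫⁻ x, ∫⁻ y, 2 ^ (p - 1) * L ^ p * (A x y + B x y) := by
        refine lintegral_mono_ae ?_
        filter_upwards [hae] with x hx
        refine lintegral_mono_ae ?_
        filter_upwards [hae] with y hy
        exact enorm_smul_sub_smul_rpow_le hp hn (hQ1 x) (hQ2 x y hx hy) (F ‖x‖) (F ‖y‖) _
    _ = 2 ^ (p - 1) * L ^ p * ((∫⁻ x, ∫⁻ y, A x y) + ∫⁻ x, ∫⁻ y, B x y) := by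
        have hAx : ∀ x, Measurable (A x) := fun x => hAm.of_uncurry_left
        have hBx : ∀ x, Measurable (B x) := fun x => hBm.of_uncurry_left
        have : ∀ x, ∫⁻ y, 2 ^ (p - 1) * L ^ p * (A x y + B x y) =
            2 ^ (p - 1) * L ^ p * ((∫⁻ y, A x y) + ∫⁻ y, B x y) := fun x => by
          rw [lintegral_const_mul _ (by fun_prop : Measurable fun y => A x y + B x y),
            lintegral_add_left (hAx x)]
        simp_rw [this]
        have hA' : Measurable fun x => ∫⁻ y, A x y := hAm.lintegral_prod_right'
        have hB' : Measurable fun x => ∫⁻ y, B x y := hBm.lintegral_prod_right'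
        have hAB : Measurable fun x => (∫⁻ y, A x y) + ∫⁻ y, B x y := hA'.add hB'
        rw [lintegral_const_mul _ hAB, lintegral_add_left hA']
    _ ≤ 2 ^ (p - 1) * L ^ p * (C₁ * I + C₂ * (sphereMeasure n univ * ENNReal.ofReal (σ * p)) * I) := by
        gcongr
    _ = _ := by ring

end Kernel


/-! ### Averages of dilates: change of variables and Jensen -/

section Scaling

/-- A probability measure on `(0,1]` whose truncated moments of order `-n` are controlled;
averages of dilates over it are bounded on radial functions in dimension `n`. -/
structure IsDilationMeasure (n : ℕ) (ν : Measure ℝ) : Prop where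
  isProbabilityMeasure : IsProbabilityMeasure ν
  ae_mem : ∀ᵐ t ∂ν, t ∈ Ioc (0 : ℝ) 1
  lintegral_le : ∀ a : ℝ, 0 < a → ∫⁻ t in Ioi a, ‖t‖ₑ ^ (-(n : ℝ)) ∂ν ≤ ‖a‖ₑ ^ (1 - (n : ℝ))

theorem lintegral_comp_smul {X : Type*} [NormedAddCommGroup X] [NormedSpace ℝ X]
    [FiniteDimensional ℝ X] [MeasurableSpace X] [BorelSpace X] (μ : Measure X) [μ.IsAddHaarMeasure]
    {t : ℝ} (ht : 0 < t) {H : X → ℝ≥0∞} (hH : Measurable H) :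
    ∫⁻ x, H (t • x) ∂μ = ‖t‖ₑ ^ (-(Module.finrank ℝ X : ℝ)) * ∫⁻ x, H x ∂μ := by
  rw [← lintegral_map hH (measurable_const_smul t), Measure.map_addHaar_smul μ ht.ne',
    lintegral_smul_measure, smul_eq_mul, abs_of_pos (by positivity),
    ENNReal.ofReal_inv_of_pos (by positivity), ENNReal.ofReal_pow ht.le, ENNReal.rpow_neg,
    ENNReal.rpow_natCast, Real.enorm_eq_ofReal ht.le]

/-- Substituting tx for x costs t^(-dim X) and confines the new variable to |x|/R < t. Integrating
in t first, with x fixed, leaves the truncated moment of ν. The space X is general because both ℝⁿ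
and ℝⁿ × ℝⁿ are needed. -/
theorem lintegral_ball_dilation_le {n : ℕ} {ν : Measure ℝ} (hν : IsDilationMeasure n ν)
    {X : Type*} [NormedAddCommGroup X] [NormedSpace ℝ X]
    [FiniteDimensional ℝ X] [MeasurableSpace X] [BorelSpace X] (μ : Measure X) [μ.IsAddHaarMeasure]
    [Nontrivial X]
    {H : X → ℝ≥0∞} (hH : Measurable H) {e R : ℝ} (he : -(n : ℝ) ≤ e - Module.finrank ℝ X)
    (hR : 0 < R) :
    ∫⁻ x in Metric.ball 0 R, (∫⁻ t, ‖t‖ₑ ^ e * H (t • x) ∂ν) ∂μ ≤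
      ∫⁻ x, H x * ‖‖x‖ / R‖ₑ ^ (1 - (n : ℝ)) ∂μ := by
  have := hν.isProbabilityMeasure
  have hm1 : Measurable fun z : X × ℝ => ‖z.2‖ₑ ^ e * H (z.2 • z.1) := by fun_prop
  have hset : MeasurableSet {z : X × ℝ | ‖z.1‖ / R < z.2} :=
    measurableSet_lt (by fun_prop) measurable_snd
  have hm2 : Measurable fun z : X × ℝ => (Ioi (‖z.1‖ / R)).indicator
      (fun t => ‖t‖ₑ ^ (-(n : ℝ)) * H z.1) z.2 := by
    exact (by fun_prop : Measurable fun z : X × ℝ => ‖z.2‖ₑ ^ (-(n : ℝ)) * H z.1).indicator hset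
  calc _ = ∫⁻ t, (∫⁻ x in Metric.ball 0 R, ‖t‖ₑ ^ e * H (t • x) ∂μ) ∂ν := by
        rw [lintegral_lintegral_swap hm1.aemeasurable]
    _ ≤ ∫⁻ t, (∫⁻ x, (Ioi (‖x‖ / R)).indicator (fun t => ‖t‖ₑ ^ (-(n : ℝ)) * H x) t ∂μ) ∂ν := by
        refine lintegral_mono_ae ?_
        filter_upwards [hν.ae_mem] with t ht
        have ht0 : ‖t‖ₑ ≠ 0 := by simpa using ht.1.ne'
        have ht1 : ‖t‖ₑ ≤ 1 := by
          rw [Real.enorm_eq_ofReal ht.1.le]; simpa using ht.2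
        rw [lintegral_const_mul _ (by fun_prop), ← lintegral_indicator measurableSet_ball]
        have h1 : ∀ x : X, (Metric.ball 0 R).indicator (fun x => H (t • x)) x =
            (Metric.ball (0 : X) (t * R)).indicator H (t • x) := by
          intro x
          have : x ∈ Metric.ball (0 : X) R ↔ t • x ∈ Metric.ball (0 : X) (t * R) := by
            simp only [mem_ball_zero_iff, norm_smul, Real.norm_of_nonneg ht.1.le]
            exact (mul_lt_mul_iff_right₀ ht.1).symm
          by_cases hx : x ∈ Metric.ball (0 : X) R
          · rw [indicator_of_mem hx, indicator_of_mem (this.1 hx)]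
          · rw [indicator_of_notMem hx, indicator_of_notMem (fun h => hx (this.2 h))]
        simp_rw [h1]
        rw [lintegral_comp_smul μ ht.1 (hH.indicator measurableSet_ball), ← mul_assoc,
          ← ENNReal.rpow_add _ _ ht0 (by simp),
          ← lintegral_const_mul _ (hH.indicator measurableSet_ball)]
        refine lintegral_mono fun x => ?_
        by_cases hx : x ∈ Metric.ball (0 : X) (t * R)
        · have hx' : t ∈ Ioi (‖x‖ / R) := by
            rw [mem_Ioi, div_lt_iff₀ hR]; simpa using hx
          rw [indicator_of_mem hx, indicator_of_mem hx']
          gcongr ?_ * _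
          -- As t ≤ 1, the exponent e - dim X may be lowered to -n.
          exact ENNReal.rpow_le_rpow_of_exponent_ge ht1 (by linarith)
        · rw [indicator_of_notMem hx]; simp
    _ = ∫⁻ x, (∫⁻ t, (Ioi (‖x‖ / R)).indicator (fun t => ‖t‖ₑ ^ (-(n : ℝ)) * H x) t ∂ν) ∂μ := by
        rw [lintegral_lintegral_swap]
        exact (hm2.comp measurable_swap).aemeasurable
    _ ≤ _ := by
        have hae : ∀ᵐ x ∂μ, x ≠ 0 := compl_mem_ae_iff.2 (measure_singleton _)
        refine lintegral_mono_ae ?_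
        filter_upwards [hae] with x hx
        rw [lintegral_indicator measurableSet_Ioi, lintegral_mul_const _ (by fun_prop), mul_comm]
        gcongr
        exact hν.lintegral_le _ (by positivity)

/-- Jensen's inequality, in the form that L^1-norms are below L^p-norms for a probability measure.
-/
theorem enorm_integral_rpow_le {ν : Measure ℝ} [IsProbabilityMeasure ν] {p : ℝ} (hp : 1 ≤ p)
    {V : Type*} [NormedAddCommGroup V] [NormedSpace ℝ V] {w : ℝ → ℝ} (hw1 : ∀ t, |w t| ≤ 1)
    {g : ℝ → V} (hg : AEStronglyMeasurable g ν) :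
    ‖∫ t, w t • g t ∂ν‖ₑ ^ p ≤ ∫⁻ t, ‖g t‖ₑ ^ p ∂ν := by
  have hp0 : 0 < p := by linarith
  have h1 : ‖∫ t, w t • g t ∂ν‖ₑ ≤ ∫⁻ t, ‖g t‖ₑ ∂ν := by
    refine (enorm_integral_le_lintegral_enorm _).trans (lintegral_mono fun t => ?_)
    rw [enorm_smul]
    calc _ ≤ 1 * ‖g t‖ₑ := by
          gcongr
          rw [← Real.enorm_abs, Real.enorm_eq_ofReal (abs_nonneg _)]
          simpa using hw1 t
      _ = _ := one_mul _
  have h2 := eLpNorm_le_eLpNorm_of_exponent_le (μ := ν) (p := 1) (q := ENNReal.ofReal p)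
    (by simpa using ENNReal.ofReal_le_ofReal hp) hg
  rw [eLpNorm_one_eq_lintegral_enorm, eLpNorm_eq_lintegral_rpow_enorm_toReal (by simpa using hp0)
    (by simp), ENNReal.toReal_ofReal hp0.le] at h2
  calc _ ≤ ((∫⁻ t, ‖g t‖ₑ ^ p ∂ν) ^ (1 / p)) ^ p := by
        gcongr
        exact h1.trans h2
    _ = _ := by rw [← ENNReal.rpow_mul, one_div_mul_cancel hp0.ne', ENNReal.rpow_one]

end Scaling

/-! ### L^p and Gagliardo bounds for averages of dilates -/

section Average

variable {n : ℕ}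

theorem lintegral_far_kernel_lt_top (hn : 1 ≤ n) {α : ℝ} (hα : 0 < α) :
    ∫⁻ z : EuclideanSpace ℝ (Fin n),
      (Ioi (1 : ℝ)).indicator (fun r => ‖r‖ₑ ^ (-((n : ℝ) + α))) ‖z‖ < ∞ := by
  rw [lintegral_fun_norm hn (Measurable.indicator (by fun_prop) measurableSet_Ioi)]
  have h : ∀ r ∈ Ioi (0 : ℝ), ‖r‖ₑ ^ ((n : ℝ) - 1) *
      (Ioi (1 : ℝ)).indicator (fun r => ‖r‖ₑ ^ (-((n : ℝ) + α))) r =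
      (Ioi (1 : ℝ)).indicator (fun r => ‖r‖ₑ ^ (-α - 1)) r := by
    intro r (hr : 0 < r)
    by_cases h1 : r ∈ Ioi (1 : ℝ)
    · rw [indicator_of_mem h1, indicator_of_mem h1,
        ← ENNReal.rpow_add _ _ (by simpa using hr.ne') (by simp)]
      congr 1; ring
    · rw [indicator_of_notMem h1, indicator_of_notMem h1, mul_zero]
  rw [setLIntegral_congr_fun measurableSet_Ioi h, lintegral_indicator measurableSet_Ioi,
    Measure.restrict_restrict measurableSet_Ioi,
    inter_eq_self_of_subset_left (Ioi_subset_Ioi zero_le_one), lintegral_Ioi_enorm_rpow one_pos hα,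
    enorm_one, ENNReal.one_rpow]
  have : ENNReal.ofReal α ≠ 0 := by simpa using hα
  finiteness

/-- The kernel is integrable on |z| > 1, so cancellation in H(x) - H(y) is not needed and the two
terms are estimated separately. -/
theorem lintegral_gagliardo_far_le (hn : 1 ≤ n) {p α : ℝ} (hp : 1 ≤ p) (hα : 0 < α) :
    ∃ C : ℝ≥0∞, C ≠ ∞ ∧ ∀ {V : Type*} [NormedAddCommGroup V]
      (H : EuclideanSpace ℝ (Fin n) → V), Continuous H →
      ∫⁻ x : EuclideanSpace ℝ (Fin n), ∫⁻ y : EuclideanSpace ℝ (Fin n),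
        ‖H x - H y‖ₑ ^ p * (Ioi (1 : ℝ)).indicator (fun r => ‖r‖ₑ ^ (-((n : ℝ) + α))) ‖x - y‖ ≤
      C * ∫⁻ x, ‖H x‖ₑ ^ p := by
  have hp0 : 0 < p := by linarith
  have h2p : (2 : ℝ≥0∞) ^ (p - 1) ≠ ∞ := by
    apply ENNReal.rpow_ne_top_of_nonneg <;> [linarith; simp]
  set k : EuclideanSpace ℝ (Fin n) → ℝ≥0∞ :=
    fun z => (Ioi (1 : ℝ)).indicator (fun r => ‖r‖ₑ ^ (-((n : ℝ) + α))) ‖z‖ with hk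
  have hkm : Measurable k :=
    (Measurable.indicator (by fun_prop) measurableSet_Ioi : Measurable
      ((Ioi (1 : ℝ)).indicator (fun r => ‖r‖ₑ ^ (-((n : ℝ) + α))))).comp measurable_norm
  have hkt : ∫⁻ z, k z ≠ ∞ := (lintegral_far_kernel_lt_top hn hα).ne
  refine ⟨2 ^ (p - 1) * (2 * ∫⁻ z, k z), by finiteness, fun {V} _ H hH => ?_⟩
  have hHm : Measurable fun x => ‖H x‖ₑ ^ p :=
    (ENNReal.continuous_rpow_const.comp (continuous_enorm.comp hH)).measurable
  have hm1 : Measurable fun z : EuclideanSpace ℝ (Fin n) × EuclideanSpace ℝ (Fin n) =>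
      ‖H z.1‖ₑ ^ p * k (z.1 - z.2) :=
    (hHm.comp measurable_fst).mul (hkm.comp (by fun_prop))
  have hm2 : Measurable fun z : EuclideanSpace ℝ (Fin n) × EuclideanSpace ℝ (Fin n) =>
      ‖H z.2‖ₑ ^ p * k (z.1 - z.2) :=
    (hHm.comp measurable_snd).mul (hkm.comp (by fun_prop))
  have e1 : ∫⁻ x, ∫⁻ y, ‖H x‖ₑ ^ p * k (x - y) = (∫⁻ x, ‖H x‖ₑ ^ p) * ∫⁻ z, k z := by
    have : ∀ x, ∫⁻ y, ‖H x‖ₑ ^ p * k (x - y) = ‖H x‖ₑ ^ p * ∫⁻ z, k z := fun x => by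
      rw [lintegral_const_mul _ (by fun_prop), lintegral_sub_left_eq_self]
    simp_rw [this]
    rw [lintegral_mul_const _ hHm]
  have e2 : ∫⁻ x, ∫⁻ y, ‖H y‖ₑ ^ p * k (x - y) = (∫⁻ x, ‖H x‖ₑ ^ p) * ∫⁻ z, k z := by
    rw [lintegral_lintegral_swap hm2.aemeasurable]
    have : ∀ y, ∫⁻ x, ‖H y‖ₑ ^ p * k (x - y) = ‖H y‖ₑ ^ p * ∫⁻ z, k z := fun x => by
      rw [lintegral_const_mul _ (by fun_prop), lintegral_sub_right_eq_self]
    simp_rw [this]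
    rw [lintegral_mul_const _ hHm]
  calc _ ≤ ∫⁻ x, ∫⁻ y, 2 ^ (p - 1) * (‖H x‖ₑ ^ p * k (x - y) + ‖H y‖ₑ ^ p * k (x - y)) := by
        refine lintegral_mono fun x => lintegral_mono fun y => ?_
        calc _ ≤ (‖H x‖ₑ + ‖H y‖ₑ) ^ p * k (x - y) := by
              gcongr
              exact enorm_sub_le
          _ ≤ (2 ^ (p - 1) * (‖H x‖ₑ ^ p + ‖H y‖ₑ ^ p)) * k (x - y) := by
              gcongr
              exact ENNReal.rpow_add_le_mul_rpow_add_rpow _ _ hp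
          _ = _ := by ring
    _ = 2 ^ (p - 1) * ((∫⁻ x, ∫⁻ y, ‖H x‖ₑ ^ p * k (x - y)) +
          ∫⁻ x, ∫⁻ y, ‖H y‖ₑ ^ p * k (x - y)) := by
        have h1 : ∀ x, Measurable fun y => ‖H x‖ₑ ^ p * k (x - y) := fun x =>
          hm1.comp measurable_prodMk_left
        have h2 : ∀ x, Measurable fun y => ‖H y‖ₑ ^ p * k (x - y) := fun x =>
          hm2.comp measurable_prodMk_left
        simp_rw [fun x => lintegral_const_mul' (2 ^ (p - 1))
          (fun y => ‖H x‖ₑ ^ p * k (x - y) + ‖H y‖ₑ ^ p * k (x - y)) (μ := volume) h2p,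
          fun x => lintegral_add_left (h1 x) (μ := volume) (fun y => ‖H y‖ₑ ^ p * k (x - y))]
        rw [lintegral_const_mul' _ _ h2p, lintegral_add_left hm1.lintegral_prod_right']
    _ = _ := by rw [e1, e2]; ring

theorem integrable_dilation {ν : Measure ℝ} (hν : IsDilationMeasure n ν)
    {V : Type*} [NormedAddCommGroup V] [NormedSpace ℝ V] {G : EuclideanSpace ℝ (Fin n) → V}
    (hG : Continuous G) {w : ℝ → ℝ} (hw : Measurable w) (hw1 : ∀ t, |w t| ≤ 1)
    (x : EuclideanSpace ℝ (Fin n)) : Integrable (fun t => w t • G (t • x)) ν := by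
  have := hν.isProbabilityMeasure
  have hGx : Continuous fun t : ℝ => G (t • x) := by fun_prop
  obtain ⟨B, hB⟩ := (isCompact_Icc (a := (0 : ℝ)) (b := 1)).exists_bound_of_continuousOn
    hGx.continuousOn
  refine Integrable.of_bound (hw.aestronglyMeasurable.smul hGx.aestronglyMeasurable) B ?_
  filter_upwards [hν.ae_mem] with t ht
  rw [norm_smul]
  calc _ ≤ 1 * ‖G (t • x)‖ := by gcongr; exact hw1 t
    _ ≤ B := by rw [one_mul]; exact hB t ⟨ht.1.le, ht.2⟩

/-- H lives in the unit ball, so `lintegral_ball_dilation_le` applies with e = 0 and R = 1; its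
weight |x|^(1-n) cancels the polar Jacobian. -/
theorem lintegral_average_le (hn : 1 ≤ n) {p : ℝ} (hp : 1 ≤ p) :
    ∃ C : ℝ≥0∞, C ≠ ∞ ∧ ∀ {ν : Measure ℝ}, IsDilationMeasure n ν →
      ∀ {V : Type*} [NormedAddCommGroup V] [NormedSpace ℝ V]
      (Q H : EuclideanSpace ℝ (Fin n) → V) (L : ℝ≥0∞) (F w : ℝ → ℝ), (∀ x, ‖Q x‖ₑ ≤ L) →
      Continuous (fun x => F ‖x‖ • Q x) → Measurable F → (∀ t, |w t| ≤ 1) →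
      (∀ x, H x = ∫ t, w t • F ‖t • x‖ • Q (t • x) ∂ν) → (∀ x, 1 ≤ ‖x‖ → H x = 0) →
      ∫⁻ x, ‖H x‖ₑ ^ p ≤ C * L ^ p * ∫⁻ r, ‖F r‖ₑ ^ p := by
  have hne : Nontrivial (EuclideanSpace ℝ (Fin n)) := by
    apply Module.nontrivial_of_finrank_pos (R := ℝ); simp; omega
  have hp0 : 0 < p := by linarith
  refine ⟨sphereMeasure n univ, by finiteness,
    fun {ν} hν {V} _ _ Q H L F w hQ hG hF hw1 hH hH0 => ?_⟩
  have := hν.isProbabilityMeasure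
  set G : EuclideanSpace ℝ (Fin n) → V := fun x => F ‖x‖ • Q x with hGdef
  have hGm : Measurable fun x => ‖G x‖ₑ ^ p :=
    (ENNReal.continuous_rpow_const.comp (continuous_enorm.comp hG)).measurable
  calc ∫⁻ x, ‖H x‖ₑ ^ p = ∫⁻ x in Metric.ball 0 1, ‖H x‖ₑ ^ p := by
        rw [← lintegral_indicator measurableSet_ball]
        refine lintegral_congr fun x => ?_
        by_cases hx : x ∈ Metric.ball (0 : EuclideanSpace ℝ (Fin n)) 1
        · rw [indicator_of_mem hx]
        · rw [indicator_of_notMem hx, hH0 x (by simpa using hx)]; simp [hp0]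
    _ ≤ ∫⁻ x in Metric.ball 0 1, (∫⁻ t, ‖t‖ₑ ^ (0 : ℝ) * ‖G (t • x)‖ₑ ^ p ∂ν) := by
        refine lintegral_mono fun x => ?_
        simp only [ENNReal.rpow_zero, one_mul]
        rw [hH x]
        exact enorm_integral_rpow_le hp hw1 (g := fun t => G (t • x))
          (by fun_prop : Continuous fun t : ℝ => G (t • x)).aestronglyMeasurable
    _ ≤ ∫⁻ x, ‖G x‖ₑ ^ p * ‖‖x‖ / 1‖ₑ ^ (1 - (n : ℝ)) :=
        lintegral_ball_dilation_le hν volume hGm (by simp) one_pos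
    _ ≤ ∫⁻ x : EuclideanSpace ℝ (Fin n), L ^ p * (‖F ‖x‖‖ₑ ^ p * ‖‖x‖‖ₑ ^ (1 - (n : ℝ))) := by
        refine lintegral_mono fun x => ?_
        rw [div_one, ← mul_assoc]
        gcongr
        rw [← ENNReal.mul_rpow_of_nonneg _ _ hp0.le, mul_comm]
        gcongr
        simp only [hGdef, enorm_smul]
        gcongr
        exact hQ x
    _ = L ^ p * (sphereMeasure n univ * ∫⁻ r in Ioi (0 : ℝ), ‖F r‖ₑ ^ p) := by
        rw [lintegral_const_mul _ (by fun_prop), lintegral_fun_norm hn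
          (h := fun r => ‖F r‖ₑ ^ p * ‖r‖ₑ ^ (1 - (n : ℝ))) (by fun_prop)]
        congr 2
        refine setLIntegral_congr_fun measurableSet_Ioi fun r (hr : 0 < r) => ?_
        have hr0 : ‖r‖ₑ ≠ 0 := by simpa using hr.ne'
        calc _ = ‖F r‖ₑ ^ p * (‖r‖ₑ ^ ((n : ℝ) - 1) * ‖r‖ₑ ^ (1 - (n : ℝ))) := by ring
          _ = _ := by rw [← ENNReal.rpow_add _ _ hr0 (by simp)]; simp
    _ ≤ L ^ p * (sphereMeasure n univ * ∫⁻ r, ‖F r‖ₑ ^ p) := by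
        gcongr
        exact Measure.restrict_le_self
    _ = _ := by ring

/-- Pairs (x, y) are dilated jointly: |x - y|^(-β) is homogeneous, whence e = β = n + σp, and e - 2n
≥ -n. The product norm is max(|x|,|y|), which explains the weight; the factor 2^(n-1) comes from R =
2. -/
theorem lintegral_gagliardo_near_le {ν : Measure ℝ} (hν : IsDilationMeasure n ν) (hn : 1 ≤ n)
    {p σ : ℝ} (hp : 1 ≤ p) (hσ : 0 < σ)
    {V : Type*} [NormedAddCommGroup V] [NormedSpace ℝ V]
    {G H : EuclideanSpace ℝ (Fin n) → V} {w : ℝ → ℝ} (hG : Continuous G)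
    (hw : Measurable w) (hw1 : ∀ t, |w t| ≤ 1) (hHG : ∀ x, H x = ∫ t, w t • G (t • x) ∂ν) :
    ∫⁻ z in Metric.ball (0 : EuclideanSpace ℝ (Fin n) × EuclideanSpace ℝ (Fin n)) 2,
      ‖H z.1 - H z.2‖ₑ ^ p * ‖z.1 - z.2‖ₑ ^ (-((n : ℝ) + σ * p)) ≤
    2 ^ ((n : ℝ) - 1) * ∫⁻ x : EuclideanSpace ℝ (Fin n), ∫⁻ y : EuclideanSpace ℝ (Fin n),
        ‖G x - G y‖ₑ ^ p * ‖x - y‖ₑ ^ (-((n : ℝ) + σ * p)) *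
          max ‖x‖ₑ ‖y‖ₑ ^ (1 - (n : ℝ)) := by
  have hne : Nontrivial (EuclideanSpace ℝ (Fin n)) := by
    apply Module.nontrivial_of_finrank_pos (R := ℝ); simp; omega
  have hp0 : 0 < p := by linarith
  have := hν.isProbabilityMeasure
  set β : ℝ := n + σ * p with hβ
  have hGm : Measurable fun z : EuclideanSpace ℝ (Fin n) × EuclideanSpace ℝ (Fin n) =>
      ‖G z.1 - G z.2‖ₑ ^ p :=
    (ENNReal.continuous_rpow_const.comp (continuous_enorm.comp
      ((hG.comp continuous_fst).sub (hG.comp continuous_snd)))).measurable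
  have hKm : Measurable fun z : EuclideanSpace ℝ (Fin n) × EuclideanSpace ℝ (Fin n) =>
      ‖G z.1 - G z.2‖ₑ ^ p * ‖z.1 - z.2‖ₑ ^ (-β) := hGm.mul (by fun_prop)
  have hmul : ∀ z : EuclideanSpace ℝ (Fin n) × EuclideanSpace ℝ (Fin n),
      ‖‖z‖ / 2‖ₑ ^ (1 - (n : ℝ)) = 2 ^ ((n : ℝ) - 1) * max ‖z.1‖ₑ ‖z.2‖ₑ ^ (1 - (n : ℝ)) := by
    intro z
    have h1 : ‖‖z‖ / 2‖ₑ = max ‖z.1‖ₑ ‖z.2‖ₑ * 2⁻¹ := by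
      rw [Prod.norm_def, div_eq_mul_inv, enorm_mul]
      congr 1
      · rw [Real.enorm_eq_ofReal (by positivity), ENNReal.ofReal_max, ofReal_norm, ofReal_norm]
      · rw [Real.enorm_eq_ofReal (by positivity), ENNReal.ofReal_inv_of_pos two_pos]; simp
    rw [h1, ENNReal.mul_rpow_of_ne_top (by simp) (by simp), ENNReal.inv_rpow, ← ENNReal.rpow_neg,
      neg_sub, mul_comm]
  have hMm : Measurable fun z : EuclideanSpace ℝ (Fin n) × EuclideanSpace ℝ (Fin n) =>
      ‖G z.1 - G z.2‖ₑ ^ p * ‖z.1 - z.2‖ₑ ^ (-β) * max ‖z.1‖ₑ ‖z.2‖ₑ ^ (1 - (n : ℝ)) :=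
    hKm.mul (by fun_prop)
  calc _ ≤ ∫⁻ z in Metric.ball (0 : EuclideanSpace ℝ (Fin n) × EuclideanSpace ℝ (Fin n)) 2,
        ∫⁻ t, ‖t‖ₑ ^ β * (‖G (t • z).1 - G (t • z).2‖ₑ ^ p * ‖(t • z).1 - (t • z).2‖ₑ ^ (-β)) ∂ν := by
        refine lintegral_mono fun z => ?_
        have h1 : ∫⁻ t, ‖t‖ₑ ^ β * (‖G (t • z).1 - G (t • z).2‖ₑ ^ p *
            ‖(t • z).1 - (t • z).2‖ₑ ^ (-β)) ∂ν =
            ∫⁻ t, ‖G (t • z.1) - G (t • z.2)‖ₑ ^ p * ‖z.1 - z.2‖ₑ ^ (-β) ∂ν := by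
          refine lintegral_congr_ae ?_
          filter_upwards [hν.ae_mem] with t ht
          have ht0 : ‖t‖ₑ ≠ 0 := by simpa using ht.1.ne'
          rw [Prod.smul_fst, Prod.smul_snd, ← smul_sub, enorm_smul,
            ENNReal.mul_rpow_of_ne_top (by simp) (by simp)]
          calc _ = (‖t‖ₑ ^ β * ‖t‖ₑ ^ (-β)) *
                (‖G (t • z.1) - G (t • z.2)‖ₑ ^ p * ‖z.1 - z.2‖ₑ ^ (-β)) := by ring
            _ = _ := by rw [← ENNReal.rpow_add _ _ ht0 (by simp)]; simp
        have hGt : Continuous fun t : ℝ => G (t • z.1) - G (t • z.2) := by fun_prop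
        rw [h1, lintegral_mul_const]
        · gcongr
          rw [hHG, hHG, ← integral_sub (integrable_dilation hν hG hw hw1 _)
            (integrable_dilation hν hG hw hw1 _)]
          simp_rw [← smul_sub]
          exact enorm_integral_rpow_le hp hw1 hGt.aestronglyMeasurable
        · exact (ENNReal.continuous_rpow_const.comp (continuous_enorm.comp hGt)).measurable
    _ ≤ ∫⁻ z : EuclideanSpace ℝ (Fin n) × EuclideanSpace ℝ (Fin n),
          ‖G z.1 - G z.2‖ₑ ^ p * ‖z.1 - z.2‖ₑ ^ (-β) * ‖‖z‖ / 2‖ₑ ^ (1 - (n : ℝ)) := by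
        refine lintegral_ball_dilation_le hν (volume.prod volume) hKm ?_ two_pos
        have : 0 < σ * p := by positivity
        simp only [Module.finrank_prod, finrank_euclideanSpace_fin]
        push_cast
        linarith
    _ = 2 ^ ((n : ℝ) - 1) * ∫⁻ z : EuclideanSpace ℝ (Fin n) × EuclideanSpace ℝ (Fin n),
          ‖G z.1 - G z.2‖ₑ ^ p * ‖z.1 - z.2‖ₑ ^ (-β) * max ‖z.1‖ₑ ‖z.2‖ₑ ^ (1 - (n : ℝ)) := by
        rw [← lintegral_const_mul _ hMm]
        refine lintegral_congr fun z => ?_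
        rw [hmul]; ring
    _ = _ := by
        rw [Measure.volume_eq_prod, lintegral_prod _ hMm.aemeasurable]

theorem lintegral_gagliardo_average_le (hn : 1 ≤ n) {p σ : ℝ} (hp : 1 ≤ p) (hσ : 0 < σ)
    (hσ1 : σ < 1) :
    ∃ C : ℝ≥0∞, C ≠ ∞ ∧ ∀ {ν : Measure ℝ}, IsDilationMeasure n ν →
      ∀ {V : Type*} [NormedAddCommGroup V] [NormedSpace ℝ V]
      (Q H : EuclideanSpace ℝ (Fin n) → V) (L : ℝ≥0∞) (F w : ℝ → ℝ), (∀ x, ‖Q x‖ₑ ≤ L) →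
      (∀ x y, x ≠ 0 → y ≠ 0 → ‖Q x - Q y‖ₑ ≤ L * min 1 (‖x - y‖ₑ / ‖y‖ₑ)) →
      Continuous (fun x => F ‖x‖ • Q x) → Continuous H → Measurable F → (∀ r ≤ 0, F r = 0) →
      Measurable w → (∀ t, |w t| ≤ 1) →
      (∀ x, H x = ∫ t, w t • F ‖t • x‖ • Q (t • x) ∂ν) → (∀ x, 1 ≤ ‖x‖ → H x = 0) →
      ∫⁻ x : EuclideanSpace ℝ (Fin n), ∫⁻ y : EuclideanSpace ℝ (Fin n),
        ‖H x - H y‖ₑ ^ p * ‖x - y‖ₑ ^ (-((n : ℝ) + σ * p)) ≤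
      C * L ^ p * ((∫⁻ r, ∫⁻ ρ, ‖F r - F ρ‖ₑ ^ p * ‖r - ρ‖ₑ ^ (-(1 + σ * p))) +
        ∫⁻ r, ‖F r‖ₑ ^ p) := by
  have hp0 : 0 < p := by linarith
  have ha : 0 < σ * p := by positivity
  obtain ⟨C₁, hC₁, h₁⟩ := lintegral_average_le hn hp
  obtain ⟨C₂, hC₂, h₂⟩ := lintegral_gagliardo_far_le hn hp ha
  obtain ⟨C₃, hC₃, h₃⟩ := lintegral_angular_gagliardo_le hn hp hσ hσ1
  have h2n : (2 : ℝ≥0∞) ^ ((n : ℝ) - 1) ≠ ∞ := by simp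
  refine ⟨2 ^ ((n : ℝ) - 1) * C₃ + C₂ * C₁, by finiteness,
    fun {ν} hν {V} _ _ Q H L F w hQ1 hQ2 hG hHc hF hF0 hw hw1 hH hH0 => ?_⟩
  set I := ∫⁻ r, ∫⁻ ρ, ‖F r - F ρ‖ₑ ^ p * ‖r - ρ‖ₑ ^ (-(1 + σ * p))
  set J := ∫⁻ r, ‖F r‖ₑ ^ p
  set β : ℝ := n + σ * p with hβ
  have hHm : Measurable fun z : EuclideanSpace ℝ (Fin n) × EuclideanSpace ℝ (Fin n) =>
      ‖H z.1 - H z.2‖ₑ ^ p :=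
    (ENNReal.continuous_rpow_const.comp (continuous_enorm.comp
      ((hHc.comp continuous_fst).sub (hHc.comp continuous_snd)))).measurable
  have hKm : Measurable fun z : EuclideanSpace ℝ (Fin n) × EuclideanSpace ℝ (Fin n) =>
      ‖H z.1 - H z.2‖ₑ ^ p * ‖z.1 - z.2‖ₑ ^ (-β) := hHm.mul (by fun_prop)
  have hFm : Measurable fun z : EuclideanSpace ℝ (Fin n) × EuclideanSpace ℝ (Fin n) =>
      ‖H z.1 - H z.2‖ₑ ^ p * (Ioi (1 : ℝ)).indicator (fun r => ‖r‖ₑ ^ (-β)) ‖z.1 - z.2‖ :=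
    hHm.mul ((Measurable.indicator (by fun_prop) measurableSet_Ioi : Measurable
      ((Ioi (1 : ℝ)).indicator (fun r => ‖r‖ₑ ^ (-β)))).comp (by fun_prop))
  have hnear := lintegral_gagliardo_near_le hν hn hp hσ hG hw hw1 hH
  have hang := h₃ Q L F hQ1 hQ2 hF hF0
  have hfar := h₂ H hHc
  have hLp := h₁ hν Q H L F w hQ1 hG hF hw1 hH hH0
  rw [← lintegral_prod (fun z : EuclideanSpace ℝ (Fin n) × EuclideanSpace ℝ (Fin n) =>
    ‖H z.1 - H z.2‖ₑ ^ p * ‖z.1 - z.2‖ₑ ^ (-β)) hKm.aemeasurable]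
  rw [← lintegral_prod (fun z : EuclideanSpace ℝ (Fin n) × EuclideanSpace ℝ (Fin n) =>
    ‖H z.1 - H z.2‖ₑ ^ p * (Ioi (1 : ℝ)).indicator (fun r => ‖r‖ₑ ^ (-β)) ‖z.1 - z.2‖)
    hFm.aemeasurable] at hfar
  rw [← Measure.volume_eq_prod] at hfar ⊢
  calc _ ≤ ∫⁻ z : EuclideanSpace ℝ (Fin n) × EuclideanSpace ℝ (Fin n),
        ((Metric.ball (0 : EuclideanSpace ℝ (Fin n) × EuclideanSpace ℝ (Fin n)) 2).indicator
          (fun z => ‖H z.1 - H z.2‖ₑ ^ p * ‖z.1 - z.2‖ₑ ^ (-β)) z +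
        ‖H z.1 - H z.2‖ₑ ^ p * (Ioi (1 : ℝ)).indicator (fun r => ‖r‖ₑ ^ (-β)) ‖z.1 - z.2‖) := by
        refine lintegral_mono fun z => ?_
        -- Outside the ball one of |x|, |y| is at least 2. If moreover |x - y| ≤ 1, then both are at
        -- least 1 and H vanishes at both points.
        by_cases hz : z ∈ Metric.ball (0 : EuclideanSpace ℝ (Fin n) × EuclideanSpace ℝ (Fin n)) 2
        · rw [indicator_of_mem hz]; exact le_self_add
        by_cases hz1 : 1 < ‖z.1 - z.2‖
        · rw [indicator_of_mem (show ‖z.1 - z.2‖ ∈ Ioi (1 : ℝ) from hz1), enorm_norm]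
          exact le_add_self
        · have h1 : 1 ≤ ‖z.1‖ ∧ 1 ≤ ‖z.2‖ := by
            rw [mem_ball_zero_iff, Prod.norm_def, max_lt_iff, not_and_or, not_lt, not_lt] at hz
            have t1 := norm_sub_norm_le z.1 z.2
            have t2 := norm_sub_norm_le z.2 z.1
            rw [norm_sub_rev] at t2
            constructor <;> rcases hz with hz | hz <;> linarith
          rw [hH0 _ h1.1, hH0 _ h1.2]
          simp [hp0]
    _ = (∫⁻ z in Metric.ball (0 : EuclideanSpace ℝ (Fin n) × EuclideanSpace ℝ (Fin n)) 2,
          ‖H z.1 - H z.2‖ₑ ^ p * ‖z.1 - z.2‖ₑ ^ (-β)) + _ := by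
        rw [lintegral_add_right _ hFm, lintegral_indicator measurableSet_ball]
    _ ≤ 2 ^ ((n : ℝ) - 1) * (C₃ * L ^ p * I) + C₂ * (C₁ * L ^ p * J) := by
        refine add_le_add (hnear.trans ?_) (hfar.trans ?_)
        · gcongr
        · gcongr
    _ ≤ 2 ^ ((n : ℝ) - 1) * (C₃ * L ^ p * (I + J)) + C₂ * (C₁ * L ^ p * (I + J)) := by
        gcongr
        · exact le_self_add
        · exact le_add_self
    _ = _ := by ring

end Average


/-! ### Angular functions -/

section Angular

open scoped ContDiff

variable {E V W : Type*} [NormedAddCommGroup E] [InnerProductSpace ℝ E]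
  [NormedAddCommGroup V] [NormedSpace ℝ V] [NormedAddCommGroup W] [NormedSpace ℝ W]

/-- Functions smooth away from the origin and positively homogeneous of degree zero. -/
structure IsAngular (Q : E → V) : Prop where
  contDiffOn : ContDiffOn ℝ ∞ Q {0}ᶜ
  smul_eq : ∀ t : ℝ, 0 < t → ∀ x, Q (t • x) = Q x

theorem isAngular_const (v : V) : IsAngular (fun _ : E => v) :=
  ⟨contDiffOn_const, fun _ _ _ => rfl⟩

theorem contDiffOn_norm_compl : ContDiffOn ℝ ∞ (fun x : E => ‖x‖) {0}ᶜ :=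
  contDiffOn_id.norm ℝ fun _ hx => hx

theorem isAngular_direction : IsAngular (fun x : E => ‖x‖⁻¹ • x) := by
  refine ⟨(contDiffOn_norm_compl.inv fun x (hx : x ≠ 0) => norm_ne_zero_iff.2 hx).smul contDiffOn_id,
    fun t ht x => ?_⟩
  rw [norm_smul, Real.norm_of_nonneg ht.le, mul_inv, smul_smul, mul_right_comm,
    inv_mul_cancel₀ ht.ne', one_mul]

theorem IsAngular.clm_comp {Q : E → V} (hQ : IsAngular Q) (A : V →L[ℝ] W) :
    IsAngular (fun x => A (Q x)) :=
  ⟨A.contDiff.comp_contDiffOn hQ.contDiffOn, fun t ht x => by rw [hQ.smul_eq t ht]⟩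

theorem IsAngular.add {Q R : E → V} (hQ : IsAngular Q) (hR : IsAngular R) :
    IsAngular (fun x => Q x + R x) :=
  ⟨hQ.contDiffOn.add hR.contDiffOn, fun t ht x => by rw [hQ.smul_eq t ht, hR.smul_eq t ht]⟩

theorem IsAngular.const_smul {Q : E → V} (hQ : IsAngular Q) (c : ℝ) :
    IsAngular (fun x => c • Q x) :=
  ⟨hQ.contDiffOn.const_smul c, fun t ht x => by rw [hQ.smul_eq t ht]⟩

/-- The tensor product of the differential of the norm with an angular function. -/
theorem IsAngular.direction_smulRight {Q : E → V} (hQ : IsAngular Q) :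
    IsAngular (fun x => (innerSL ℝ (‖x‖⁻¹ • x)).smulRight (Q x)) := by
  refine ⟨?_, fun t ht x => by rw [hQ.smul_eq t ht, isAngular_direction.smul_eq t ht]⟩
  exact (((innerSL ℝ (E := E)).contDiff).comp_contDiffOn
    isAngular_direction.contDiffOn).smulRight hQ.contDiffOn

/-- Differentiation lowers the degree of homogeneity to -1; the factor |x| restores degree 0. -/
theorem IsAngular.norm_smul_fderiv {Q : E → V} (hQ : IsAngular Q) :
    IsAngular (fun x => ‖x‖ • fderiv ℝ Q x) := by
  refine ⟨contDiffOn_norm_compl.smul (hQ.contDiffOn.fderiv_of_isOpen isOpen_compl_singleton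
    (by simp)), fun t ht x => ?_⟩
  have h : fderiv ℝ Q x = t • fderiv ℝ Q (t • x) := by
    rw [← fderiv_comp_smul]
    congr 1
    ext y
    exact (hQ.smul_eq t ht y).symm
  rw [h, norm_smul, Real.norm_of_nonneg ht.le, smul_smul, mul_comm]

theorem IsAngular.differentiableAt {Q : E → V} (hQ : IsAngular Q) {x : E} (hx : x ≠ 0) :
    DifferentiableAt ℝ Q x :=
  (hQ.contDiffOn.contDiffAt (isOpen_compl_singleton.mem_nhds hx)).differentiableAt (by simp)

theorem hasFDerivAt_norm {x : E} (hx : x ≠ 0) :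
    HasFDerivAt (fun y : E => ‖y‖) (innerSL ℝ (‖x‖⁻¹ • x)) x := by
  have h := (hasStrictFDerivAt_norm_sq x).hasFDerivAt.sqrt (pow_ne_zero 2 (norm_ne_zero_iff.2 hx))
  simp only [Real.sqrt_sq (norm_nonneg _)] at h
  convert! h using 1
  ext y
  simp
  field_simp

/-- The product rule arranged so that radial times angular is reproduced: the missing power |x|^(-1)
is moved to the radial factor. -/
theorem IsAngular.hasFDerivAt_radial_smul {Q : E → V} (hQ : IsAngular Q) {x : E} (hx : x ≠ 0)
    {g : ℝ → ℝ} {g' : ℝ} (hg : HasDerivAt g g' ‖x‖) :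
    HasFDerivAt (fun y => g ‖y‖ • Q y)
      (g' • (innerSL ℝ (‖x‖⁻¹ • x)).smulRight (Q x) +
        (g ‖x‖ * ‖x‖⁻¹) • (‖x‖ • fderiv ℝ Q x)) x := by
  have h := (hg.comp_hasFDerivAt x (hasFDerivAt_norm hx)).smul
    (hQ.differentiableAt hx).hasFDerivAt
  convert! h using 1
  ext y
  have : ‖x‖ ≠ 0 := norm_ne_zero_iff.2 hx
  simp [smul_smul, this]
  rw [add_comm, mul_assoc]

theorem IsAngular.contDiff_radial_smul {Q : E → V} (hQ : IsAngular Q) {m : ℕ∞} {g : ℝ → ℝ}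
    (hg : ContDiffOn ℝ m g (Ioi 0)) {δ : ℝ} (hδ : 0 < δ) (hg0 : ∀ r < δ, g r = 0) :
    ContDiff ℝ m (fun x => g ‖x‖ • Q x) := by
  rw [contDiff_iff_contDiffAt]
  intro x
  by_cases hx : x = 0
  · subst hx
    have : (fun x => g ‖x‖ • Q x) =ᶠ[nhds 0] fun _ => (0 : V) := by
      filter_upwards [Metric.ball_mem_nhds (0 : E) hδ] with y hy
      rw [hg0 _ (by simpa using hy), zero_smul]
    exact contDiffAt_const.congr_of_eventuallyEq this
  · have h1 : ContDiffAt ℝ m g ‖x‖ := hg.contDiffAt (Ioi_mem_nhds (norm_pos_iff.2 hx))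
    exact (h1.comp x (contDiffAt_norm ℝ hx)).smul
      ((hQ.contDiffOn.contDiffAt (isOpen_compl_singleton.mem_nhds hx)).of_le
        (by exact_mod_cast le_top))

theorem norm_direction_sub_le {x y : E} (hx : x ≠ 0) (hy : y ≠ 0) :
    ‖‖x‖⁻¹ • x - ‖y‖⁻¹ • y‖ ≤ 2 * (‖x - y‖ / ‖y‖) := by
  have hx' : 0 < ‖x‖ := norm_pos_iff.2 hx
  have hy' : 0 < ‖y‖ := norm_pos_iff.2 hy
  have h : ‖x‖⁻¹ • x - ‖y‖⁻¹ • y = ((‖y‖ - ‖x‖) * ‖y‖⁻¹ * ‖x‖⁻¹) • x + ‖y‖⁻¹ • (x - y) := by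
    rw [smul_sub, ← add_sub_assoc, ← add_smul]
    congr 2
    field_simp
    ring
  rw [h]
  refine (norm_add_le _ _).trans ?_
  rw [norm_smul, norm_smul, norm_mul, norm_mul, norm_inv, norm_inv, norm_norm, norm_norm, mul_assoc,
    inv_mul_cancel₀ hx'.ne', mul_one, Real.norm_eq_abs]
  have := abs_norm_sub_norm_le y x
  rw [norm_sub_rev] at this
  calc _ ≤ ‖x - y‖ * ‖y‖⁻¹ + ‖y‖⁻¹ * ‖x - y‖ := by gcongr
    _ = _ := by ring

/-- Cut off to an annulus around the unit sphere, Q becomes smooth with compact support, hence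
bounded and Lipschitz. By homogeneity Q(x) is the value at x/|x|, and passing to directions is
Lipschitz with constant 2/|y|. -/
theorem IsAngular.exists_bound [FiniteDimensional ℝ E] {Q : E → V} (hQ : IsAngular Q) :
    ∃ L : ℝ≥0∞, L ≠ ⊤ ∧ (∀ x, ‖Q x‖ₑ ≤ L) ∧
      ∀ x y, x ≠ 0 → y ≠ 0 → ‖Q x - Q y‖ₑ ≤ L * min 1 (‖x - y‖ₑ / ‖y‖ₑ) := by
  let ψ : ContDiffBump (1 : ℝ) := ⟨1 / 4, 1 / 2, by norm_num, by norm_num⟩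
  have hψ0 : ∀ r : ℝ, 1 / 2 ≤ |r - 1| → ψ r = 0 := fun r hr =>
    ψ.zero_of_le_dist (by rw [Real.dist_eq]; exact hr)
  have hψ1 : ψ 1 = 1 := ψ.one_of_mem_closedBall (by simp [ψ])
  set R : E → V := fun x => ψ ‖x‖ • Q x with hR
  have hRc : ContDiff ℝ ∞ R := hQ.contDiff_radial_smul (m := ⊤) ψ.contDiff.contDiffOn
    (δ := 1 / 2) (by norm_num) fun r hr => hψ0 r (by rw [abs_of_neg] <;> linarith)
  have hRs : HasCompactSupport R := by
    refine HasCompactSupport.intro (isCompact_closedBall (0 : E) 2) fun x hx => ?_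
    have : 2 < ‖x‖ := by simpa using hx
    simp only [hR]
    rw [hψ0, zero_smul]
    rw [abs_of_pos] <;> linarith
  obtain ⟨K, hK⟩ := ContDiff.lipschitzWith_of_hasCompactSupport hRs hRc (by simp)
  obtain ⟨B, hB⟩ := hRc.continuous.bounded_above_of_compact_support hRs
  have hdir : ∀ x, x ≠ 0 → R (‖x‖⁻¹ • x) = Q x := fun x hx => by
    have hx' : 0 < ‖x‖ := norm_pos_iff.2 hx
    simp only [hR]
    rw [norm_smul, norm_inv, norm_norm, inv_mul_cancel₀ hx'.ne', hψ1, one_smul,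
      hQ.smul_eq _ (inv_pos.2 hx')]
  have hQB : ∀ x, x ≠ 0 → ‖Q x‖ₑ ≤ ENNReal.ofReal B := fun x hx => by
    rw [← hdir x hx, ← ofReal_norm]
    exact ENNReal.ofReal_le_ofReal (hB _)
  -- 2B is the trivial bound for a difference, 2K the Lipschitz bound, and the last term is present
  -- because Q is unconstrained at the origin.
  refine ⟨2 * ENNReal.ofReal B + 2 * K + ‖Q 0‖ₑ, by finiteness, fun x => ?_, fun x y hx hy => ?_⟩
  · by_cases hx : x = 0
    · rw [hx]; exact le_add_self
    · calc _ ≤ ENNReal.ofReal B := hQB x hx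
        _ ≤ 2 * ENNReal.ofReal B := by rw [two_mul]; exact le_self_add
        _ ≤ _ := by rw [add_assoc]; exact le_self_add
  · have h1 : ‖Q x - Q y‖ₑ ≤ 2 * ENNReal.ofReal B := by
      rw [two_mul]
      exact enorm_sub_le.trans (add_le_add (hQB x hx) (hQB y hy))
    have h2 : ‖Q x - Q y‖ₑ ≤ 2 * K * (‖x - y‖ₑ / ‖y‖ₑ) := by
      have := hK.dist_le_mul (‖x‖⁻¹ • x) (‖y‖⁻¹ • y)
      rw [hdir x hx, hdir y hy, dist_eq_norm, dist_eq_norm] at this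
      have h3 : ‖Q x - Q y‖ ≤ 2 * K * (‖x - y‖ / ‖y‖) := by
        calc _ ≤ K * (2 * (‖x - y‖ / ‖y‖)) := this.trans (by
              gcongr; exact norm_direction_sub_le hx hy)
          _ = _ := by ring
      rw [← ofReal_norm, ← ofReal_norm, ← ofReal_norm,
        ← ENNReal.ofReal_div_of_pos (norm_pos_iff.2 hy)]
      calc _ ≤ ENNReal.ofReal (2 * K * (‖x - y‖ / ‖y‖)) := ENNReal.ofReal_le_ofReal h3
        _ = _ := by
          rw [ENNReal.ofReal_mul (by positivity), ENNReal.ofReal_mul (by norm_num)]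
          simp
    rcases le_total 1 (‖x - y‖ₑ / ‖y‖ₑ) with h | h
    · rw [min_eq_left h, mul_one]
      refine h1.trans ?_
      rw [add_assoc]; exact le_self_add
    · rw [min_eq_right h]
      refine h2.trans ?_
      gcongr
      rw [add_right_comm]; exact le_add_self

end Angular

/-! ### The structure of the differentials of f(|x|) P(x) -/

section IteratedDeriv

open scoped ContDiff

variable {E V : Type*} [NormedAddCommGroup E] [InnerProductSpace ℝ E]
  [NormedAddCommGroup V] [NormedSpace ℝ V]

theorem exists_eq_zero_of_testFunction (f : 𝓓(interval01, ℝ)) :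
    ∃ δ : ℝ, 0 < δ ∧ δ < 1 ∧ ∀ i r, (r < δ ∨ 1 - δ < r) → iteratedDeriv i f r = 0 := by
  have hsub : tsupport f ⊆ Ioo 0 1 := f.tsupport_subset
  have hzero : ∀ i r, r ∉ tsupport f → iteratedDeriv i f r = 0 := fun i r hr => by
    rw [← norm_eq_zero, ← norm_iteratedFDeriv_eq_norm_iteratedDeriv, norm_eq_zero]
    by_contra h
    exact hr (support_iteratedFDeriv_subset i h)
  rcases (tsupport f).eq_empty_or_nonempty with he | hne
  · exact ⟨1 / 2, by norm_num, by norm_num, fun i r _ => hzero i r (by simp [he])⟩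
  obtain ⟨a, ha, hamin⟩ := f.hasCompactSupport.isCompact.exists_isMinOn hne continuousOn_id
  obtain ⟨b, hb, hbmax⟩ := f.hasCompactSupport.isCompact.exists_isMaxOn hne continuousOn_id
  have ha' := hsub ha
  have hb' := hsub hb
  refine ⟨min a (1 - b), lt_min ha'.1 (by linarith [hb'.2]),
    (min_le_left _ _).trans_lt ha'.2, fun i r hr => hzero i r fun hmem => ?_⟩
  have h1 : a ≤ r := hamin hmem
  have h2 : r ≤ b := hbmax hmem
  rcases hr with hr | hr
  · linarith [min_le_left a (1 - b)]
  · linarith [min_le_right a (1 - b)]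

theorem contDiff_iteratedDeriv_testFunction (f : 𝓓(interval01, ℝ)) (i : ℕ) :
    ContDiff ℝ ∞ (iteratedDeriv i f) := by
  rw [iteratedDeriv_eq_iterate]
  exact f.contDiff.iterate_deriv i

theorem iteratedFDeriv_radial_smul {P : E → V} (hP : IsAngular P) (k : ℕ) :
    ∃ Q : ℕ → E → E [×k]→L[ℝ] V, (∀ i, IsAngular (Q i)) ∧ ∀ (f : 𝓓(interval01, ℝ)) (x : E),
      iteratedFDeriv ℝ k (fun x => f ‖x‖ • P x) x =
        ∑ i ∈ Finset.range (k + 1), (iteratedDeriv i f ‖x‖ * (‖x‖⁻¹) ^ (k - i)) • Q i x := by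
  -- The origin is treated apart, since angular functions need not be differentiable there; both
  -- sides of the formula vanish.
  have hzero : ∀ (k : ℕ) (f : 𝓓(interval01, ℝ)),
      iteratedFDeriv ℝ k (fun x => f ‖x‖ • P x) 0 = 0 := by
    intro k f
    obtain ⟨δ, hδ, -, h0⟩ := exists_eq_zero_of_testFunction f
    have : (fun x => f ‖x‖ • P x) =ᶠ[nhds 0] fun _ => (0 : V) := by
      filter_upwards [Metric.ball_mem_nhds (0 : E) hδ] with y hy
      have := h0 0 ‖y‖ (Or.inl (by simpa using hy))
      rw [iteratedDeriv_zero] at this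
      rw [this, zero_smul]
    rw [(this.iteratedFDeriv ℝ k).eq_of_nhds]
    simp [iteratedFDeriv_fun_zero]
  induction k with
  | zero =>
    refine ⟨fun _ x => (continuousMultilinearCurryFin0 ℝ E V).symm (P x),
      fun _ => hP.clm_comp
        (continuousMultilinearCurryFin0 ℝ E V).symm.toContinuousLinearEquiv.toContinuousLinearMap,
      fun f x => ?_⟩
    rw [iteratedFDeriv_zero_eq_comp]
    simp
  | succ k ih =>
    obtain ⟨Q, hQ, hform⟩ := ih
    -- Differentiating f^(i) raises i and keeps the power of 1/|x|, producing `A`; differentiating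
    -- the power or Q_i keeps i and raises the power, producing `B`. `D` collects both by the new
    -- index, and `B` is cut off at i = k + 1, where the old sum has no term.
    let A : ℕ → E → E →L[ℝ] E [×k]→L[ℝ] V := fun i x => (innerSL ℝ (‖x‖⁻¹ • x)).smulRight (Q i x)
    let B : ℕ → E → E →L[ℝ] E [×k]→L[ℝ] V := fun i x =>
      if i < k + 1 then (-((k - i : ℕ) : ℝ)) • A i x + ‖x‖ • fderiv ℝ (Q i) x else 0
    let D : ℕ → E → E →L[ℝ] E [×k]→L[ℝ] V := fun i x =>
      (if i = 0 then 0 else A (i - 1) x) + B i x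
    have hA : ∀ i, IsAngular (A i) := fun i => (hQ i).direction_smulRight
    have hB : ∀ i, IsAngular (B i) := fun i => by
      by_cases hi : i < k + 1
      · simp only [B, hi, if_true]
        exact ((hA i).const_smul _).add (hQ i).norm_smul_fderiv
      · simp only [B, hi, if_false]
        exact isAngular_const _
    have hD : ∀ i, IsAngular (D i) := fun i => by
      by_cases hi : i = 0
      · simp only [D, hi, if_true]
        exact (isAngular_const _).add (hB 0)
      · simp only [D, hi, if_false]
        exact (hA _).add (hB i)
    obtain ⟨C, hC⟩ : ∃ C : (E →L[ℝ] E [×k]→L[ℝ] V) →L[ℝ] (E [×(k + 1)]→L[ℝ] V),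
        ∀ (u : E → V) x, iteratedFDeriv ℝ (k + 1) u x = C (fderiv ℝ (iteratedFDeriv ℝ k u) x) :=
      ⟨(continuousMultilinearCurryLeftEquiv ℝ
        (fun _ : Fin (k + 1) => E) V).symm.toContinuousLinearEquiv.toContinuousLinearMap, fun u x => by
        rw [iteratedFDeriv_succ_eq_comp_left]; rfl⟩
    refine ⟨fun i x => C (D i x), fun i => (hD i).clm_comp C, fun f x => ?_⟩
    by_cases hx : x = 0
    · subst hx
      rw [hzero]
      obtain ⟨δ, hδ, -, h0⟩ := exists_eq_zero_of_testFunction f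
      refine (Finset.sum_eq_zero fun i _ => ?_).symm
      rw [norm_zero, h0 i 0 (Or.inl hδ), zero_mul, zero_smul]
    have hx' : ‖x‖ ≠ 0 := norm_ne_zero_iff.2 hx
    have hfd : fderiv ℝ (iteratedFDeriv ℝ k (fun x => f ‖x‖ • P x)) x =
        ∑ i ∈ Finset.range (k + 1), ((iteratedDeriv (i + 1) f ‖x‖ * (‖x‖⁻¹) ^ (k - i)) • A i x +
          (iteratedDeriv i f ‖x‖ * (‖x‖⁻¹) ^ (k + 1 - i)) • B i x) := by
      rw [funext (hform f)]
      refine HasFDerivAt.fderiv ?_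
      refine HasFDerivAt.fun_sum fun i hi => ?_
      have hik : i < k + 1 := Finset.mem_range.1 hi
      have hd1 : HasDerivAt (iteratedDeriv i f) (iteratedDeriv (i + 1) f ‖x‖) ‖x‖ := by
        rw [iteratedDeriv_succ]
        exact ((contDiff_iteratedDeriv_testFunction f i).differentiable (by simp) _).hasDerivAt
      have hd2 : HasDerivAt (fun r : ℝ => (r⁻¹) ^ (k - i))
          (-((k - i : ℕ) : ℝ) * (‖x‖⁻¹) ^ (k - i + 1)) ‖x‖ := by
        have := (hasDerivAt_inv hx').pow (k - i)
        convert! this using 1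
        rcases Nat.eq_zero_or_pos (k - i) with h | h
        · simp [h]
        · obtain ⟨m, hm⟩ := Nat.exists_eq_succ_of_ne_zero h.ne'
          rw [hm]
          simp only [Nat.succ_eq_add_one, Nat.add_sub_cancel]
          rw [inv_pow, inv_pow]
          field_simp
          ring
      have := (hQ i).hasFDerivAt_radial_smul hx (hd1.mul hd2)
      convert! this using 1
      simp only [B, hik, if_true, A]
      rw [show k + 1 - i = k - i + 1 by omega, smul_add, smul_smul, ← add_assoc, Pi.mul_apply,
        ← add_smul _ _ (_ : E →L[ℝ] E [×k]→L[ℝ] V)]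
      congr 2
      · ring
      · ring
    rw [hC, hfd]
    simp_rw [← map_smul]
    rw [← map_sum]
    congr 1
    rw [Finset.sum_add_distrib]
    have hsplit : ∀ i, (iteratedDeriv i f ‖x‖ * (‖x‖⁻¹) ^ (k + 1 - i)) • D i x =
        (iteratedDeriv i f ‖x‖ * (‖x‖⁻¹) ^ (k + 1 - i)) • (if i = 0 then 0 else A (i - 1) x) +
        (iteratedDeriv i f ‖x‖ * (‖x‖⁻¹) ^ (k + 1 - i)) • B i x := fun i => smul_add _ _ _
    simp_rw [hsplit]
    rw [Finset.sum_add_distrib]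
    congr 1
    · rw [Finset.sum_range_succ' _ (k + 1)]
      simp only [Nat.add_sub_add_right, Nat.add_sub_cancel, Nat.succ_ne_zero, if_false, if_true]
      exact (add_eq_left.2 (smul_zero _)).symm
    · have hBk : B (k + 1) x = 0 := by simp [B]
      rw [Finset.sum_range_succ _ (k + 1), hBk]
      exact (add_eq_left.2 (smul_zero _)).symm

end IteratedDeriv


/-! ### The Gagliardo seminorm as an L^p-norm on the product -/

section DiffQuotient

variable {E F : Type*} [NormedAddCommGroup E] [NormedSpace ℝ E] [NormedAddCommGroup F]
  [NormedSpace ℝ F]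

/-- The weighted difference whose `L^p`-norm on `E × E` is the Gagliardo seminorm. -/
noncomputable def diffQuotient (σ p : ℝ) (g : E → F) (z : E × E) : F :=
  (‖z.1 - z.2‖ ^ (-(((Module.finrank ℝ E : ℝ) + σ * p) / p))) • (g z.1 - g z.2)

theorem enorm_diffQuotient_rpow {σ p : ℝ} (hp : 0 < p) (g : E → F) (z : E × E) :
    ‖diffQuotient σ p g z‖ₑ ^ p =
      ‖g z.1 - g z.2‖ₑ ^ p * ‖z.1 - z.2‖ₑ ^ (-((Module.finrank ℝ E : ℝ) + σ * p)) := by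
  by_cases hz : z.1 = z.2
  · simp [diffQuotient, hz, hp]
  · have hpos : 0 < ‖z.1 - z.2‖ := norm_pos_iff.2 (sub_ne_zero.2 hz)
    rw [diffQuotient, enorm_smul, ENNReal.mul_rpow_of_nonneg _ _ hp.le, mul_comm,
      Real.enorm_eq_ofReal (by positivity), ← ENNReal.ofReal_rpow_of_pos hpos, ofReal_norm,
      ← ENNReal.rpow_mul]
    congr 2
    field_simp

theorem aestronglyMeasurable_diffQuotient [MeasureSpace E] [BorelSpace E]
    [SecondCountableTopology E] [SFinite (volume : Measure E)] {σ p : ℝ} {g : E → F}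
    (hg : AEStronglyMeasurable g volume) :
    AEStronglyMeasurable (diffQuotient σ p g) (volume.prod volume) := by
  refine AEStronglyMeasurable.smul ?_ (hg.comp_fst.sub hg.comp_snd)
  exact (by fun_prop : Measurable fun z : E × E =>
    ‖z.1 - z.2‖ ^ (-(((Module.finrank ℝ E : ℝ) + σ * p) / p))).aestronglyMeasurable

theorem gagliardoSeminorm_eq_lintegral {E F : Type*} [NormedAddCommGroup E] [NormedSpace ℝ E]
    [NormedAddCommGroup F] [MeasureSpace E] {σ p : ℝ} (g : E → F) :
    gagliardoSeminorm σ p g = (∫⁻ x, ∫⁻ y, ‖g x - g y‖ₑ ^ p *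
      ‖x - y‖ₑ ^ (-((Module.finrank ℝ E : ℝ) + σ * p))) ^ (1 / p) := by
  simp_rw [gagliardoSeminorm, div_eq_mul_inv, ENNReal.rpow_neg]

/-- Makes Minkowski's inequality and Fatou's lemma for L^p-norms available for the seminorm. -/
theorem gagliardoSeminorm_eq_eLpNorm [MeasureSpace E] [BorelSpace E]
    [SecondCountableTopology E] [SFinite (volume : Measure E)] {σ p : ℝ} (hp : 0 < p) {g : E → F}
    (hg : AEStronglyMeasurable g volume) :
    gagliardoSeminorm σ p g =
      eLpNorm (diffQuotient σ p g) (ENNReal.ofReal p) (volume.prod volume) := by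
  rw [gagliardoSeminorm_eq_lintegral, eLpNorm_eq_lintegral_rpow_enorm_toReal (by simpa using hp)
    (by simp), ENNReal.toReal_ofReal hp.le, lintegral_prod]
  · simp_rw [enorm_diffQuotient_rpow hp]
  · exact (aestronglyMeasurable_diffQuotient hg).enorm.pow_const _

theorem gagliardoSeminorm_sum_le [MeasureSpace E] [BorelSpace E]
    [SecondCountableTopology E] [SFinite (volume : Measure E)] {σ p : ℝ} (hp : 1 ≤ p)
    {ι : Type*} (s : Finset ι) {g : ι → E → F}
    (hg : ∀ i ∈ s, AEStronglyMeasurable (g i) volume) :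
    gagliardoSeminorm σ p (fun x => ∑ i ∈ s, g i x) ≤ ∑ i ∈ s, gagliardoSeminorm σ p (g i) := by
  have hp0 : 0 < p := by linarith
  rw [gagliardoSeminorm_eq_eLpNorm hp0 (Finset.aestronglyMeasurable_fun_sum s hg),
    Finset.sum_congr rfl fun i hi => gagliardoSeminorm_eq_eLpNorm hp0 (hg i hi)]
  have : diffQuotient σ p (fun x => ∑ i ∈ s, g i x) = ∑ i ∈ s, diffQuotient σ p (g i) := by
    ext z
    simp only [diffQuotient, Finset.sum_apply, ← Finset.smul_sum, Finset.sum_sub_distrib]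
  rw [this]
  exact eLpNorm_sum_le (fun i hi => aestronglyMeasurable_diffQuotient (hg i hi))
    (by simpa using ENNReal.ofReal_le_ofReal hp)

end DiffQuotient

/-! ### Taylor's formula and the representation by dilates -/

section DilationMeasures

theorem isDilationMeasure_dirac {n : ℕ} (hn : 1 ≤ n) :
    IsDilationMeasure n (Measure.dirac (1 : ℝ)) := by
  refine ⟨inferInstance, by rw [ae_dirac_eq]; exact ⟨zero_lt_one, le_rfl⟩, fun a ha => ?_⟩
  rw [← lintegral_indicator measurableSet_Ioi, lintegral_dirac]
  by_cases h : (1 : ℝ) ∈ Ioi a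
  · rw [indicator_of_mem h]
    have h1 : ‖a‖ₑ ≤ 1 := by rw [Real.enorm_eq_ofReal ha.le]; simpa using (le_of_lt h)
    have hn' : 1 - (n : ℝ) ≤ 0 := by
      have : (1 : ℝ) ≤ n := by exact_mod_cast hn
      linarith
    simpa using ENNReal.rpow_le_rpow_of_exponent_ge h1 hn'
  · rw [indicator_of_notMem h]; exact zero_le

/-- This is where n ≥ 2 enters: the moment over t > a is at most a^(1-n) / (n - 1). -/
theorem isDilationMeasure_volume {n : ℕ} (hn : 2 ≤ n) :
    IsDilationMeasure n ((volume : Measure ℝ).restrict (Ioc 0 1)) := by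
  have hn' : 1 ≤ (n : ℝ) - 1 := by
    have : (2 : ℝ) ≤ n := by exact_mod_cast hn
    linarith
  refine ⟨⟨by simp⟩, ae_restrict_mem measurableSet_Ioc, fun a ha => ?_⟩
  calc _ ≤ ∫⁻ t in Ioi a, ‖t‖ₑ ^ (-((n : ℝ) - 1) - 1) := by
        rw [show -((n : ℝ) - 1) - 1 = -(n : ℝ) by ring]
        exact lintegral_mono' (Measure.restrict_mono_measure Measure.restrict_le_self _) le_rfl
    _ = ‖a‖ₑ ^ (-((n : ℝ) - 1)) / ENNReal.ofReal ((n : ℝ) - 1) :=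
        lintegral_Ioi_enorm_rpow ha (by linarith)
    _ ≤ ‖a‖ₑ ^ (-((n : ℝ) - 1)) / 1 := by
        gcongr
        simpa using ENNReal.ofReal_le_ofReal hn'
    _ = _ := by rw [div_one, neg_sub]

/-- Taylor's formula at 0 with integral remainder: f vanishes near 0, so the polynomial part is
zero, and the remainder is rescaled from [0, r] to [0, 1]. -/
theorem iteratedDeriv_testFunction_eq_integral (f : 𝓓(interval01, ℝ)) (i m : ℕ) {r : ℝ}
    (hr : 0 < r) :
    iteratedDeriv i f r * (r⁻¹) ^ (m + 1) =
      ∫ t in Ioc (0 : ℝ) 1, ((1 - t) ^ m / m.factorial) * iteratedDeriv (i + (m + 1)) f (t * r) := by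
  obtain ⟨δ, hδ, -, h0⟩ := exists_eq_zero_of_testFunction f
  set g := iteratedDeriv i f with hg
  have hgc := contDiff_iteratedDeriv_testFunction f i
  have hgi : ∀ j, iteratedDeriv j g = iteratedDeriv (i + j) f := fun j => by
    rw [hg, iteratedDeriv_eq_iterate, iteratedDeriv_eq_iterate, iteratedDeriv_eq_iterate,
      ← Function.iterate_add_apply, add_comm]
  have hw : ∀ j, ∀ t ∈ uIcc 0 r, iteratedDerivWithin j g (uIcc 0 r) t = iteratedDeriv (i + j) f t := by
    intro j t ht
    rw [iteratedDerivWithin_eq_iteratedDeriv _ (hgc.contDiffAt.of_le (by exact_mod_cast le_top)) ht,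
      hgi]
    rw [uIcc_of_le hr.le]; exact uniqueDiffOn_Icc hr
  have hT := taylor_integral_remainder (f := g) (x := r) (x₀ := 0) (n := m)
    (hgc.contDiffOn.of_le (by exact_mod_cast le_top))
  have hpoly : taylorWithinEval g m (uIcc 0 r) 0 r = 0 := by
    rw [taylor_within_apply]
    refine Finset.sum_eq_zero fun j _ => ?_
    rw [hw j 0 left_mem_uIcc, h0 _ 0 (Or.inl hδ), smul_zero]
  have hint : ∫ t in (0 : ℝ)..r, ((r - t) ^ m / m.factorial) •
      iteratedDerivWithin (m + 1) g (uIcc 0 r) t =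
      ∫ t in (0 : ℝ)..r, ((r - t) ^ m / m.factorial) * iteratedDeriv (i + (m + 1)) f t :=
    intervalIntegral.integral_congr fun t ht => by simp only [hw (m + 1) t ht, smul_eq_mul]
  rw [hpoly, sub_zero, hint] at hT
  have hsub := intervalIntegral.integral_comp_mul_right (a := 0) (b := 1)
    (fun t => ((r - t) ^ m / m.factorial) * iteratedDeriv (i + (m + 1)) f t) hr.ne'
  rw [zero_mul, one_mul, ← hT, smul_eq_mul] at hsub
  rw [← intervalIntegral.integral_of_le zero_le_one]
  have hscale : ∀ t : ℝ, (r - t * r) ^ m / m.factorial * iteratedDeriv (i + (m + 1)) f (t * r) =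
      r ^ m * ((1 - t) ^ m / m.factorial * iteratedDeriv (i + (m + 1)) f (t * r)) := fun t => by
    rw [show r - t * r = r * (1 - t) by ring, mul_pow]; ring
  simp_rw [hscale] at hsub
  rw [intervalIntegral.integral_const_mul] at hsub
  have hrm : r ^ m ≠ 0 := pow_ne_zero _ hr.ne'
  calc g r * (r⁻¹) ^ (m + 1) = (r ^ m)⁻¹ * (r⁻¹ * g r) := by rw [pow_succ, inv_pow]; ring
    _ = _ := by rw [← hsub, inv_mul_cancel_left₀ hrm]

/-- For i = k the measure is the point mass at 1; otherwise it is Lebesgue measure with the Taylor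
weight. Since Q(tx) = Q(x), the angular factor goes under the integral. Neither measure nor weight
depends on f. -/
theorem exists_dilation_representation {n : ℕ} (hn : 2 ≤ n) {i k : ℕ} (hik : i ≤ k)
    {V : Type*} [NormedAddCommGroup V] [NormedSpace ℝ V] [CompleteSpace V]
    {Q : EuclideanSpace ℝ (Fin n) → V} (hQ : IsAngular Q) :
    ∃ (ν : Measure ℝ) (w : ℝ → ℝ), IsDilationMeasure n ν ∧ Measurable w ∧ (∀ t, |w t| ≤ 1) ∧
      ∀ (f : 𝓓(interval01, ℝ)) (x : EuclideanSpace ℝ (Fin n)),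
        (iteratedDeriv i f ‖x‖ * (‖x‖⁻¹) ^ (k - i)) • Q x =
          ∫ t, w t • iteratedDeriv k f ‖t • x‖ • Q (t • x) ∂ν := by
  rcases hik.eq_or_lt with rfl | hlt
  · refine ⟨_, fun _ => 1, isDilationMeasure_dirac (by omega), measurable_const, by simp,
      fun f x => ?_⟩
    rw [integral_dirac]
    simp
  · obtain ⟨m, rfl⟩ : ∃ m, k = i + (m + 1) := ⟨k - i - 1, by omega⟩
    -- The indicator makes the weight bounded by 1 for every real t, not only on (0,1].
    refine ⟨_, (Ioc (0 : ℝ) 1).indicator fun t => (1 - t) ^ m / m.factorial,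
      isDilationMeasure_volume hn, Measurable.indicator (by fun_prop) measurableSet_Ioc,
      fun t => ?_, fun f x => ?_⟩
    · by_cases ht : t ∈ Ioc (0 : ℝ) 1
      · rw [indicator_of_mem ht, abs_div, abs_pow, abs_of_nonneg (by linarith [ht.2] : 0 ≤ 1 - t),
          Nat.abs_cast]
        refine div_le_one_of_le₀ ?_ (by positivity)
        calc (1 - t) ^ m ≤ 1 := pow_le_one₀ (by linarith [ht.2]) (by linarith [ht.1])
          _ ≤ _ := by exact_mod_cast Nat.one_le_iff_ne_zero.2 (Nat.factorial_ne_zero m)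
      · rw [indicator_of_notMem ht]; simp
    · obtain ⟨δ, hδ, -, h0⟩ := exists_eq_zero_of_testFunction f
      by_cases hx : x = 0
      · simp [hx, h0 _ 0 (Or.inl hδ)]
      · have h1 : ∀ t ∈ Ioc (0 : ℝ) 1, (Ioc (0 : ℝ) 1).indicator
            (fun t => (1 - t) ^ m / m.factorial) t •
            iteratedDeriv (i + (m + 1)) f ‖t • x‖ • Q (t • x) =
            ((1 - t) ^ m / m.factorial * iteratedDeriv (i + (m + 1)) f (t * ‖x‖)) • Q x := by
          intro t ht
          rw [indicator_of_mem ht, hQ.smul_eq t ht.1, norm_smul, Real.norm_of_nonneg ht.1.le,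
            smul_smul]
        rw [setIntegral_congr_fun measurableSet_Ioc h1, integral_smul_const,
          ← iteratedDeriv_testFunction_eq_integral f i m (norm_pos_iff.2 hx), Nat.add_sub_cancel_left]

end DilationMeasures

/-! ### Bounds for each differential of a radial expression -/

section SmoothEstimates

variable {n : ℕ} {V : Type*} [NormedAddCommGroup V] [NormedSpace ℝ V]

theorem continuous_radial_term {Q : EuclideanSpace ℝ (Fin n) → V} (hQ : IsAngular Q)
    (f : 𝓓(interval01, ℝ)) (i l : ℕ) :
    Continuous fun x => (iteratedDeriv i f ‖x‖ * (‖x‖⁻¹) ^ l) • Q x := by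
  obtain ⟨δ, hδ, -, h0⟩ := exists_eq_zero_of_testFunction f
  refine (hQ.contDiff_radial_smul (m := 0) (g := fun r => iteratedDeriv i f r * (r⁻¹) ^ l)
    (contDiffOn_zero.2 ?_) hδ fun r hr => ?_).continuous
  · refine (contDiff_iteratedDeriv_testFunction f i).continuous.continuousOn.mul ?_
    exact (continuousOn_inv₀.mono fun r (hr : 0 < r) => hr.ne').pow l
  · rw [h0 i r (Or.inl hr), zero_mul]

theorem enorm_iteratedFDeriv_sub (f : 𝓓(interval01, ℝ)) (k : ℕ) (r ρ : ℝ) :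
    ‖iteratedFDeriv ℝ k f r - iteratedFDeriv ℝ k f ρ‖ₑ =
      ‖iteratedDeriv k f r - iteratedDeriv k f ρ‖ₑ := by
  rw [iteratedFDeriv_eq_equiv_comp]
  simp only [Function.comp_apply, ← map_sub]
  rw [← ofReal_norm, LinearIsometryEquiv.norm_map, ofReal_norm]

theorem eLpNorm_iteratedFDeriv_real {p : ℝ} (hp : 0 < p) (f : 𝓓(interval01, ℝ)) (k : ℕ) :
    eLpNorm (iteratedFDeriv ℝ k f) (ENNReal.ofReal p) volume =
      (∫⁻ r, ‖iteratedDeriv k f r‖ₑ ^ p) ^ (1 / p) := by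
  rw [eLpNorm_eq_lintegral_rpow_enorm_toReal (by simpa using hp) (by simp),
    ENNReal.toReal_ofReal hp.le]
  congr 1
  refine lintegral_congr fun r => ?_
  rw [← ofReal_norm, norm_iteratedFDeriv_eq_norm_iteratedDeriv, ofReal_norm]

theorem gagliardoSeminorm_iteratedFDeriv_real {σ p : ℝ} (f : 𝓓(interval01, ℝ)) (k : ℕ) :
    gagliardoSeminorm σ p (iteratedFDeriv ℝ k f) =
      (∫⁻ r, ∫⁻ ρ, ‖iteratedDeriv k f r - iteratedDeriv k f ρ‖ₑ ^ p *
        ‖r - ρ‖ₑ ^ (-(1 + σ * p))) ^ (1 / p) := by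
  rw [gagliardoSeminorm_eq_lintegral]
  simp_rw [enorm_iteratedFDeriv_sub]
  simp

theorem exists_eLpNorm_radial_term_le [CompleteSpace V] (hn : 2 ≤ n)
    {p : ℝ} (hp : 1 ≤ p) {i k : ℕ} (hik : i ≤ k)
    {Q : EuclideanSpace ℝ (Fin n) → V} (hQ : IsAngular Q) :
    ∃ C : ℝ≥0∞, C ≠ ∞ ∧ ∀ f : 𝓓(interval01, ℝ),
      eLpNorm (fun x => (iteratedDeriv i f ‖x‖ * (‖x‖⁻¹) ^ (k - i)) • Q x) (ENNReal.ofReal p) volume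
        ≤ C * eLpNorm (iteratedFDeriv ℝ k f) (ENNReal.ofReal p) volume := by
  have hp0 : 0 < p := by linarith
  have hn1 : 1 ≤ n := by omega
  obtain ⟨ν, w, hν, hw, hw1, hrep⟩ := exists_dilation_representation hn hik hQ
  obtain ⟨L, hL, hQ1, -⟩ := hQ.exists_bound
  obtain ⟨C, hC, h⟩ := lintegral_average_le hn1 hp
  refine ⟨(C * L ^ p) ^ (1 / p), by finiteness, fun f => ?_⟩
  obtain ⟨δ, hδ, hδ1, h0⟩ := exists_eq_zero_of_testFunction f
  have hFc := (contDiff_iteratedDeriv_testFunction f k).continuous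
  have hGc : Continuous fun x : EuclideanSpace ℝ (Fin n) => iteratedDeriv k f ‖x‖ • Q x := by
    simpa using continuous_radial_term hQ f k 0
  have key := h hν Q _ L (iteratedDeriv k f) w hQ1 hGc hFc.measurable hw1 (hrep f) (fun x hx => by
    rw [h0 i _ (Or.inr (by linarith)), zero_mul, zero_smul])
  rw [eLpNorm_iteratedFDeriv_real hp0, eLpNorm_eq_lintegral_rpow_enorm_toReal (by simpa using hp0)
    (by simp), ENNReal.toReal_ofReal hp0.le, ← ENNReal.mul_rpow_of_nonneg _ _ (by positivity)]
  gcongr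

theorem exists_gagliardoSeminorm_radial_term_le [CompleteSpace V] (hn : 2 ≤ n)
    {p σ : ℝ} (hp : 1 ≤ p) (hσ : 0 < σ)
    (hσ1 : σ < 1) {i k : ℕ} (hik : i ≤ k)
    {Q : EuclideanSpace ℝ (Fin n) → V} (hQ : IsAngular Q) :
    ∃ C : ℝ≥0∞, C ≠ ∞ ∧ ∀ f : 𝓓(interval01, ℝ),
      gagliardoSeminorm σ p (fun x => (iteratedDeriv i f ‖x‖ * (‖x‖⁻¹) ^ (k - i)) • Q x)
        ≤ C * (gagliardoSeminorm σ p (iteratedFDeriv ℝ k f) +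
          eLpNorm (iteratedFDeriv ℝ k f) (ENNReal.ofReal p) volume) := by
  have hp0 : 0 < p := by linarith
  have hn1 : 1 ≤ n := by omega
  obtain ⟨ν, w, hν, hw, hw1, hrep⟩ := exists_dilation_representation hn hik hQ
  obtain ⟨L, hL, hQ1, hQ2⟩ := hQ.exists_bound
  obtain ⟨C, hC, h⟩ := lintegral_gagliardo_average_le hn1 hp hσ hσ1
  refine ⟨(C * L ^ p) ^ (1 / p), by finiteness, fun f => ?_⟩
  obtain ⟨δ, hδ, hδ1, h0⟩ := exists_eq_zero_of_testFunction f
  have hFc := (contDiff_iteratedDeriv_testFunction f k).continuous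
  have hGc : Continuous fun x : EuclideanSpace ℝ (Fin n) => iteratedDeriv k f ‖x‖ • Q x := by
    simpa using continuous_radial_term hQ f k 0
  have key := h hν Q _ L (iteratedDeriv k f) w hQ1 hQ2 hGc (continuous_radial_term hQ f i (k - i))
    hFc.measurable (fun r hr => h0 k r (Or.inl (by linarith))) hw hw1 (hrep f) (fun x hx => by
    rw [h0 i _ (Or.inr (by linarith)), zero_mul, zero_smul])
  rw [eLpNorm_iteratedFDeriv_real hp0, gagliardoSeminorm_iteratedFDeriv_real,
    gagliardoSeminorm_eq_lintegral]
  simp only [finrank_euclideanSpace_fin]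
  calc _ ≤ (C * L ^ p * _) ^ (1 / p) := ENNReal.rpow_le_rpow key (by positivity)
    _ = (C * L ^ p) ^ (1 / p) * _ := ENNReal.mul_rpow_of_nonneg _ _ (by positivity)
    _ ≤ _ := by
      gcongr
      -- The power 1/p ≤ 1 is subadditive.
      exact ENNReal.rpow_add_le_add_rpow _ _ (by positivity) (by
        rw [div_le_one hp0]; exact hp)

theorem exists_eLpNorm_iteratedFDeriv_radial_le [CompleteSpace V] (hn : 2 ≤ n) {p : ℝ} (hp : 1 ≤ p)
    {P : EuclideanSpace ℝ (Fin n) → V} (hP : IsAngular P) (k : ℕ) :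
    ∃ C : ℝ≥0∞, C ≠ ∞ ∧ ∀ f : 𝓓(interval01, ℝ),
      eLpNorm (iteratedFDeriv ℝ k fun x => f ‖x‖ • P x) (ENNReal.ofReal p) volume
        ≤ C * eLpNorm (iteratedFDeriv ℝ k f) (ENNReal.ofReal p) volume := by
  obtain ⟨Q, hQ, hform⟩ := iteratedFDeriv_radial_smul hP k
  -- The membership condition sits inside the existential so that `choose` gives constants indexed
  -- by all of ℕ.
  have hi : ∀ i : ℕ, ∃ C : ℝ≥0∞, C ≠ ∞ ∧ (i ∈ Finset.range (k + 1) → ∀ f : 𝓓(interval01, ℝ),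
      eLpNorm (fun x => (iteratedDeriv i f ‖x‖ * (‖x‖⁻¹) ^ (k - i)) • Q i x) (ENNReal.ofReal p)
        volume ≤ C * eLpNorm (iteratedFDeriv ℝ k f) (ENNReal.ofReal p) volume) := by
    intro i
    by_cases h : i ∈ Finset.range (k + 1)
    · obtain ⟨C, hC, h'⟩ := exists_eLpNorm_radial_term_le hn hp
        (Nat.lt_succ_iff.1 (Finset.mem_range.1 h)) (hQ i)
      exact ⟨C, hC, fun _ => h'⟩
    · exact ⟨0, by simp, fun h' => absurd h' h⟩
  choose C hC hle using hi
  refine ⟨∑ i ∈ Finset.range (k + 1), C i, ENNReal.sum_ne_top.2 fun i _ => hC i, fun f => ?_⟩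
  rw [funext (hform f), Finset.sum_mul]
  refine le_trans ?_ (Finset.sum_le_sum fun i hi => hle i hi f)
  have := eLpNorm_sum_le (μ := volume) (p := ENNReal.ofReal p) (s := Finset.range (k + 1))
    (f := fun i x => (iteratedDeriv i f ‖x‖ * (‖x‖⁻¹) ^ (k - i)) • Q i x)
    (fun i _ => (continuous_radial_term (hQ i) f i (k - i)).aestronglyMeasurable)
    (by simpa using ENNReal.ofReal_le_ofReal hp)
  convert! this using 2
  ext1 x
  rw [Finset.sum_apply]

theorem exists_gagliardoSeminorm_iteratedFDeriv_radial_le [CompleteSpace V] (hn : 2 ≤ n)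
    {p σ : ℝ} (hp : 1 ≤ p)
    (hσ : 0 < σ) (hσ1 : σ < 1)
    {P : EuclideanSpace ℝ (Fin n) → V} (hP : IsAngular P) (k : ℕ) :
    ∃ C : ℝ≥0∞, C ≠ ∞ ∧ ∀ f : 𝓓(interval01, ℝ),
      gagliardoSeminorm σ p (iteratedFDeriv ℝ k fun x => f ‖x‖ • P x)
        ≤ C * (gagliardoSeminorm σ p (iteratedFDeriv ℝ k f) +
          eLpNorm (iteratedFDeriv ℝ k f) (ENNReal.ofReal p) volume) := by
  obtain ⟨Q, hQ, hform⟩ := iteratedFDeriv_radial_smul hP k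
  have hi : ∀ i : ℕ, ∃ C : ℝ≥0∞, C ≠ ∞ ∧ (i ∈ Finset.range (k + 1) → ∀ f : 𝓓(interval01, ℝ),
      gagliardoSeminorm σ p (fun x => (iteratedDeriv i f ‖x‖ * (‖x‖⁻¹) ^ (k - i)) • Q i x)
        ≤ C * (gagliardoSeminorm σ p (iteratedFDeriv ℝ k f) +
          eLpNorm (iteratedFDeriv ℝ k f) (ENNReal.ofReal p) volume)) := by
    intro i
    by_cases h : i ∈ Finset.range (k + 1)
    · obtain ⟨C, hC, h'⟩ := exists_gagliardoSeminorm_radial_term_le hn hp hσ hσ1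
        (Nat.lt_succ_iff.1 (Finset.mem_range.1 h)) (hQ i)
      exact ⟨C, hC, fun _ => h'⟩
    · exact ⟨0, by simp, fun h' => absurd h' h⟩
  choose C hC hle using hi
  refine ⟨∑ i ∈ Finset.range (k + 1), C i, ENNReal.sum_ne_top.2 fun i _ => hC i, fun f => ?_⟩
  rw [funext (hform f), Finset.sum_mul]
  refine le_trans ?_ (Finset.sum_le_sum fun i hi => hle i hi f)
  exact gagliardoSeminorm_sum_le hp _
    (fun i _ => (continuous_radial_term (hQ i) f i (k - i)).aestronglyMeasurable)

end SmoothEstimates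


/-! ### The operators on test functions -/

section RadialTestFunction

variable {n : ℕ} {V : Type*} [NormedAddCommGroup V] [NormedSpace ℝ V]

theorem exists_testFunction_eq_radial {P : EuclideanSpace ℝ (Fin n) → V} (hP : IsAngular P)
    (f : 𝓓(interval01, ℝ)) :
    ∃ g : 𝓓(unitBall n, V), (g : EuclideanSpace ℝ (Fin n) → V) = fun x => f ‖x‖ • P x := by
  obtain ⟨δ, hδ, hδ1, h0⟩ := exists_eq_zero_of_testFunction f
  have hcd : ContDiff ℝ (⊤ : ℕ∞) fun x => f ‖x‖ • P x :=
    hP.contDiff_radial_smul f.contDiff.contDiffOn hδ fun r hr => by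
      simpa using h0 0 r (Or.inl hr)
  have hsub : tsupport (fun x => f ‖x‖ • P x) ⊆
      Metric.closedBall (0 : EuclideanSpace ℝ (Fin n)) (1 - δ) := by
    refine closure_minimal (fun x hx => ?_) Metric.isClosed_closedBall
    by_contra hx'
    refine hx ?_
    have := h0 0 ‖x‖ (Or.inr (by simpa using hx'))
    rw [iteratedDeriv_zero] at this
    simp [this]
  refine ⟨⟨fun x => f ‖x‖ • P x, hcd,
    (isCompact_closedBall _ _).of_isClosed_subset (isClosed_tsupport _) hsub,
    hsub.trans (Metric.closedBall_subset_ball (by linarith))⟩, rfl⟩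

theorem exists_smoothNorm_radial_le [CompleteSpace V] (hn : 2 ≤ n) (s : ℝ) {p : ℝ} (hp : 1 ≤ p)
    {P : EuclideanSpace ℝ (Fin n) → V} (hP : IsAngular P) :
    ∃ C : ℝ≥0, 0 < C ∧ ∀ f : 𝓓(interval01, ℝ),
      smoothNorm s p (fun x => f ‖x‖ • P x) ≤ C * smoothNorm s p (f : ℝ → ℝ) := by
  choose A hA hAle using fun k => exists_eLpNorm_iteratedFDeriv_radial_le hn hp hP k
  obtain ⟨B, hB, hBle⟩ : ∃ B : ℝ≥0∞, B ≠ ∞ ∧ ∀ f : 𝓓(interval01, ℝ), (if Int.fract s = 0 then 0 else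
      gagliardoSeminorm (Int.fract s) p (iteratedFDeriv ℝ ⌊s⌋₊ fun x => f ‖x‖ • P x)) ≤
        B * smoothNorm s p (f : ℝ → ℝ) := by
    by_cases h : Int.fract s = 0
    · exact ⟨0, by simp, fun f => by simp [h]⟩
    · obtain ⟨B, hB, hBle⟩ := exists_gagliardoSeminorm_iteratedFDeriv_radial_le hn hp
        ((Int.fract_nonneg s).lt_of_ne' h) (Int.fract_lt_one s) hP ⌊s⌋₊
      refine ⟨B, hB, fun f => ?_⟩
      rw [if_neg h, smoothNorm, normOfDerivs, if_neg h, Finset.sum_range_succ]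
      refine (hBle f).trans ?_
      rw [add_comm (gagliardoSeminorm _ _ _)]
      gcongr
      exact le_add_self
  -- The summand 1 makes the constant positive, which is later used to move it through an infimum.
  have hfin : (∑ j ∈ Finset.range (⌊s⌋₊ + 1), A j) + B + 1 ≠ ∞ := by
    simp [ENNReal.sum_eq_top, hA, hB]
  refine ⟨((∑ j ∈ Finset.range (⌊s⌋₊ + 1), A j) + B + 1).toNNReal,
    ENNReal.toNNReal_pos (by simp) hfin, fun f => ?_⟩
  rw [ENNReal.coe_toNNReal hfin]
  have h1 : (∑ j ∈ Finset.range (⌊s⌋₊ + 1),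
      eLpNorm (iteratedFDeriv ℝ j fun x => f ‖x‖ • P x) (ENNReal.ofReal p) volume) ≤
      (∑ j ∈ Finset.range (⌊s⌋₊ + 1), A j) * smoothNorm s p (f : ℝ → ℝ) := by
    rw [Finset.sum_mul]
    refine Finset.sum_le_sum fun j hj => (hAle j f).trans ?_
    gcongr
    refine le_trans ?_ le_self_add
    exact Finset.single_le_sum
      (f := fun j => eLpNorm (iteratedFDeriv ℝ j f) (ENNReal.ofReal p) volume)
      (fun _ _ => zero_le) hj
  calc smoothNorm s p (fun x => f ‖x‖ • P x)
      ≤ (∑ j ∈ Finset.range (⌊s⌋₊ + 1), A j) * smoothNorm s p (f : ℝ → ℝ) +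
        B * smoothNorm s p (f : ℝ → ℝ) := add_le_add h1 (hBle f)
    _ ≤ _ := by
      rw [← add_mul]
      exact mul_le_mul_left le_self_add _

end RadialTestFunction


/-! ### Integration by parts for iterated differentials -/

section SmoothWeak

open scoped ContDiff

variable {E F : Type*} [NormedAddCommGroup E] [NormedSpace ℝ E]
  [NormedAddCommGroup F] [NormedSpace ℝ F]

theorem contDiff_fderiv_apply {f : E → F} (hf : ContDiff ℝ ∞ f) (w : E) :
    ContDiff ℝ ∞ fun y => fderiv ℝ f y w :=
  (hf.fderiv_right (m := ∞) (by simp)).clm_apply contDiff_const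

theorem contDiff_iteratedFDeriv_apply {f : E → F} (hf : ContDiff ℝ ∞ f) (j : ℕ) (u : Fin j → E) :
    ContDiff ℝ ∞ fun y => iteratedFDeriv ℝ j f y u :=
  (ContinuousMultilinearMap.apply ℝ (fun _ : Fin j => E) F u).contDiff.comp
    (hf.iteratedFDeriv_right (m := ∞) (i := j) (by exact_mod_cast le_top))

theorem iteratedFDeriv_succ_apply_eq_fderiv {f : E → F} (hf : ContDiff ℝ ∞ f) (j : ℕ)
    (u : Fin (j + 1) → E) (x : E) : iteratedFDeriv ℝ (j + 1) f x u =
      fderiv ℝ (fun y => iteratedFDeriv ℝ j f y (Fin.tail u)) x (u 0) := by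
  rw [iteratedFDeriv_succ_apply_left]
  have hd : DifferentiableAt ℝ (iteratedFDeriv ℝ j f) x :=
    ((hf.iteratedFDeriv_right (m := ∞) (i := j) (by exact_mod_cast le_top)).differentiable
      (by simp)) x
  have := ((ContinuousMultilinearMap.apply ℝ (fun _ : Fin j => E) F (Fin.tail u)).hasFDerivAt.comp
    x hd.hasFDerivAt).fderiv
  have h2 := congrArg (fun A => A (u 0)) this
  exact h2.symm

/-- Directional derivatives commute with the iterated differential. -/
theorem fderiv_iteratedFDeriv_apply {f : E → F} (hf : ContDiff ℝ ∞ f) (j : ℕ) (u : Fin j → E)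
    (w x : E) : fderiv ℝ (fun y => iteratedFDeriv ℝ j f y u) x w =
      iteratedFDeriv ℝ j (fun y => fderiv ℝ f y w) x u := by
  induction j generalizing x with
  | zero => simp
  | succ j ih =>
    rw [iteratedFDeriv_succ_apply_eq_fderiv (contDiff_fderiv_apply hf w)]
    simp_rw [iteratedFDeriv_succ_apply_eq_fderiv hf, ← ih]
    have hh := contDiff_iteratedFDeriv_apply hf j (Fin.tail u)
    set h := fun y => iteratedFDeriv ℝ j f y (Fin.tail u)
    -- What remains are the two second directional derivatives of `h` taken in opposite orders.
    have hsym : IsSymmSndFDerivAt ℝ h x :=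
      hh.contDiffAt.isSymmSndFDerivAt (by simpa using WithTop.coe_le_coe.2 (le_top : (2 : ℕ∞) ≤ ⊤))
    have hd : DifferentiableAt ℝ (fderiv ℝ h) x :=
      ((hh.fderiv_right (m := ∞) (by simp)).differentiable (by simp)) x
    have e : ∀ a b : E, fderiv ℝ (fun y => fderiv ℝ h y a) x b = fderiv ℝ (fderiv ℝ h) x b a := by
      intro a b
      rw [fderiv_clm_apply hd (differentiableAt_const a)]
      simp
    rw [e, e, hsym]

variable [MeasureSpace E] [BorelSpace E] [FiniteDimensional ℝ E]
  [(volume : Measure E).IsAddHaarMeasure]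

/-- One direction is moved at a time. The outermost derivative of φ lands innermost on f, so the
induction runs over all f and `fderiv_iteratedFDeriv_apply` restores the order. -/
theorem integral_iteratedFDeriv_smul {φ : E → ℝ} (hφ : ContDiff ℝ ∞ φ)
    (hφc : HasCompactSupport φ) {f : E → F} (hf : ContDiff ℝ ∞ f) (j : ℕ) (v : Fin j → E) :
    ∫ x, iteratedFDeriv ℝ j φ x v • f x = (-1 : ℝ) ^ j • ∫ x, φ x • iteratedFDeriv ℝ j f x v := by
  induction j generalizing f with
  | zero => simp
  | succ j ih =>
    have hψ := contDiff_iteratedFDeriv_apply hφ j (Fin.tail v)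
    have hψc : HasCompactSupport fun y => iteratedFDeriv ℝ j φ y (Fin.tail v) :=
      (hφc.iteratedFDeriv j).comp_left (g := fun A : E [×j]→L[ℝ] ℝ => A (Fin.tail v)) rfl
    have hDf := contDiff_fderiv_apply hf (v 0)
    have key := integral_smul_fderiv_eq_neg_fderiv_smul_of_integrable (μ := (volume : Measure E))
      (f := fun y => iteratedFDeriv ℝ j φ y (Fin.tail v)) (g := f) (v := v 0)
      (((contDiff_fderiv_apply hψ (v 0)).continuous.smul
        hf.continuous).integrable_of_hasCompactSupport
        (HasCompactSupport.smul_right ((hψc.fderiv ℝ).comp_left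
          (g := fun A : E →L[ℝ] ℝ => A (v 0)) rfl)))
      ((hψ.continuous.smul hDf.continuous).integrable_of_hasCompactSupport
        (HasCompactSupport.smul_right hψc))
      ((hψ.continuous.smul hf.continuous).integrable_of_hasCompactSupport
        (HasCompactSupport.smul_right hψc))
      (fun x _ => hψ.differentiable (by simp) x)
      (fun x _ => hf.differentiable (by simp) x)
    simp_rw [iteratedFDeriv_succ_apply_eq_fderiv hφ, iteratedFDeriv_succ_apply_eq_fderiv hf,
      fderiv_iteratedFDeriv_apply hf]
    rw [← neg_eq_iff_eq_neg] at key
    rw [← key, ih hDf, pow_succ]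
    simp

end SmoothWeak


/-- Lets Fatou's lemma, applied to each summand of the Sobolev norm, give a bound for the sum. -/
theorem liminf_add_liminf_le (a b : ℕ → ℝ≥0∞) :
    Filter.liminf a Filter.atTop + Filter.liminf b Filter.atTop ≤
      Filter.liminf (fun m => a m + b m) Filter.atTop := by
  simp only [Filter.liminf_eq_iSup_iInf_of_nat]
  rw [ENNReal.iSup_add_iSup_of_monotone]
  · exact iSup_mono fun m => le_iInf₂ fun i hi => add_le_add (iInf₂_le i hi) (iInf₂_le i hi)
  all_goals exact fun m l hml => le_iInf₂ fun i hi => iInf₂_le i (hml.trans hi)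

/-! ### Weak differentials -/

section WeakDeriv

variable {E F : Type*} [NormedAddCommGroup E] [NormedSpace ℝ E] [MeasureSpace E]
  [NormedAddCommGroup F] [NormedSpace ℝ F] {j : ℕ} {f f' : E → F} {g g' : E → E [×j]→L[ℝ] F}

theorem IsWeakDeriv.congr_ae (h : IsWeakDeriv j f g) (hf : f =ᵐ[volume] f') :
    IsWeakDeriv j f' g where
  locallyIntegrable := h.locallyIntegrable.congr hf
  locallyIntegrable_deriv := h.locallyIntegrable_deriv
  integral_eq φ v := by
    rw [← h.integral_eq φ v]
    refine integral_congr_ae ?_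
    filter_upwards [hf] with x hx
    rw [hx]

theorem locallyIntegrable_apply [BorelSpace E] (hg : LocallyIntegrable g volume)
    (v : Fin j → E) : LocallyIntegrable (fun x => g x v) volume := by
  intro x
  obtain ⟨U, hU, hi⟩ := hg x
  exact ⟨U, hU, (ContinuousMultilinearMap.apply ℝ (fun _ : Fin j => E) F v).integrable_comp hi⟩

theorem integrable_testFunction_smul [BorelSpace E] (φ : 𝓓((⊤ : Opens E), ℝ))
    (hf : LocallyIntegrable f volume) : Integrable (fun x => φ x • f x) volume :=
  hf.integrable_smul_left_of_hasCompactSupport φ.continuous φ.hasCompactSupport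

theorem integrable_iteratedFDeriv_smul [BorelSpace E] (φ : 𝓓((⊤ : Opens E), ℝ)) (v : Fin j → E)
    (hf : LocallyIntegrable f volume) :
    Integrable (fun x => iteratedFDeriv ℝ j φ x v • f x) volume :=
  hf.integrable_smul_left_of_hasCompactSupport
    (contDiff_iteratedFDeriv_apply φ.contDiff j v).continuous
    ((φ.hasCompactSupport.iteratedFDeriv j).comp_left (g := fun A : E [×j]→L[ℝ] ℝ => A v) rfl)

theorem IsWeakDeriv.sub [BorelSpace E] (h : IsWeakDeriv j f g) (h' : IsWeakDeriv j f' g') :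
    IsWeakDeriv j (fun x => f x - f' x) (fun x => g x - g' x) where
  locallyIntegrable := h.locallyIntegrable.sub h'.locallyIntegrable
  locallyIntegrable_deriv := h.locallyIntegrable_deriv.sub h'.locallyIntegrable_deriv
  integral_eq φ v := by
    simp only [smul_sub, sub_apply]
    rw [integral_sub (integrable_iteratedFDeriv_smul φ v h.locallyIntegrable)
      (integrable_iteratedFDeriv_smul φ v h'.locallyIntegrable),
      integral_sub (integrable_testFunction_smul φ
        (locallyIntegrable_apply h.locallyIntegrable_deriv v))
      (integrable_testFunction_smul φ (locallyIntegrable_apply h'.locallyIntegrable_deriv v)),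
      h.integral_eq, h'.integral_eq, smul_sub]

variable [BorelSpace E] [FiniteDimensional ℝ E]

theorem ae_eq_zero_of_forall_testFunction [CompleteSpace F] (hf : LocallyIntegrable f volume)
    (h : ∀ φ : 𝓓((⊤ : Opens E), ℝ), ∫ x, φ x • f x = 0) : ∀ᵐ x, f x = 0 :=
  ae_eq_zero_of_integral_contDiff_smul_eq_zero hf fun g hg hgc => h ⟨g, hg, hgc, subset_univ _⟩

/-- Weak differentials are unique up to null sets. -/
theorem IsWeakDeriv.ae_eq [CompleteSpace F] (h : IsWeakDeriv j f g) (h' : IsWeakDeriv j f g') :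
    g =ᵐ[volume] g' := by
  have key : ∀ v : Fin j → E, ∀ᵐ x, g x v - g' x v = 0 := fun v => by
    have hg := locallyIntegrable_apply h.locallyIntegrable_deriv v
    have hg' := locallyIntegrable_apply h'.locallyIntegrable_deriv v
    refine ae_eq_zero_of_forall_testFunction (hg.sub hg') fun φ => ?_
    simp only [smul_sub]
    rw [integral_sub (integrable_testFunction_smul φ hg) (integrable_testFunction_smul φ hg'),
      sub_eq_zero]
    have := (h.integral_eq φ v).symm.trans (h'.integral_eq φ v)
    exact smul_right_injective F (pow_ne_zero j (by norm_num : (-1 : ℝ) ≠ 0)) this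
  -- The exceptional null set depends on the directions; a countable dense family of them suffices
  -- by continuity.
  have hall : ∀ᵐ x, ∀ m, g x (denseSeq (Fin j → E) m) - g' x (denseSeq (Fin j → E) m) = 0 :=
    ae_all_iff.2 fun m => key _
  filter_upwards [hall] with x hx
  refine DFunLike.coe_injective ((denseRange_denseSeq (Fin j → E)).equalizer (g x).cont (g' x).cont
    (funext fun m => sub_eq_zero.1 (hx m)))

/-- The zeroth weak differential is the function itself. -/
theorem IsWeakDeriv.enorm_zero_ae [CompleteSpace F] {g : E → E [×0]→L[ℝ] F}
    (h : IsWeakDeriv 0 f g) : ∀ᵐ x, ‖g x‖ₑ = ‖f x‖ₑ := by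
  have hg := locallyIntegrable_apply h.locallyIntegrable_deriv 0
  have : ∀ᵐ x, g x 0 - f x = 0 := by
    refine ae_eq_zero_of_forall_testFunction (hg.sub h.locallyIntegrable) fun φ => ?_
    simp only [smul_sub]
    rw [integral_sub (integrable_testFunction_smul φ hg)
      (integrable_testFunction_smul φ h.locallyIntegrable), sub_eq_zero]
    simpa using (h.integral_eq φ 0).symm
  filter_upwards [this] with x hx
  rw [← sub_eq_zero.1 hx, ← ofReal_norm, ← ofReal_norm, ← ContinuousMultilinearMap.fin0_apply_norm]

variable [(volume : Measure E).IsAddHaarMeasure]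

theorem isWeakDeriv_iteratedFDeriv {Ω : Opens E} (u : 𝓓(Ω, F)) (j : ℕ) :
    IsWeakDeriv j u (iteratedFDeriv ℝ j u) where
  locallyIntegrable := u.continuous.locallyIntegrable
  locallyIntegrable_deriv := (u.contDiff.continuous_iteratedFDeriv
    (by exact_mod_cast le_top)).locallyIntegrable
  integral_eq φ v := integral_iteratedFDeriv_smul φ.contDiff φ.hasCompactSupport u.contDiff j v

end WeakDeriv

/-! ### Minkowski and Fatou for the Sobolev norm -/

section Norm

variable {E F : Type*} [NormedAddCommGroup E] [NormedSpace ℝ E] [MeasureSpace E]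
  [NormedAddCommGroup F] [NormedSpace ℝ F] {s p : ℝ} {G H : (j : ℕ) → E → E [×j]→L[ℝ] F}

theorem gagliardoSeminorm_congr_ae {E F : Type*} [NormedAddCommGroup E] [NormedSpace ℝ E]
    [MeasureSpace E] [NormedAddCommGroup F] {p : ℝ} {g h : E → F} {σ : ℝ} (hgh : g =ᵐ[volume] h) :
    gagliardoSeminorm σ p g = gagliardoSeminorm σ p h := by
  unfold gagliardoSeminorm
  congr 1
  refine lintegral_congr_ae ?_
  filter_upwards [hgh] with x hx
  refine lintegral_congr_ae ?_
  filter_upwards [hgh] with y hy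
  rw [hx, hy]

theorem normOfDerivs_congr_ae (h : ∀ j ≤ ⌊s⌋₊, G j =ᵐ[volume] H j) :
    normOfDerivs s p G = normOfDerivs s p H := by
  unfold normOfDerivs
  congr 1
  · exact Finset.sum_congr rfl fun j hj =>
      eLpNorm_congr_ae (h j (Nat.lt_succ_iff.1 (Finset.mem_range.1 hj)))
  · rw [gagliardoSeminorm_congr_ae (h _ le_rfl)]

theorem eLpNorm_le_normOfDerivs {j : ℕ} (hj : j ≤ ⌊s⌋₊) :
    eLpNorm (G j) (ENNReal.ofReal p) volume ≤ normOfDerivs s p G :=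
  (Finset.single_le_sum (f := fun j => eLpNorm (G j) (ENNReal.ofReal p) volume)
    (fun _ _ => zero_le) (Finset.mem_range.2 (Nat.lt_succ_iff.2 hj))).trans le_self_add

variable [BorelSpace E] [SecondCountableTopology E] [SFinite (volume : Measure E)]

theorem normOfDerivs_sub_le (hp : 1 ≤ p) (hG : ∀ j ≤ ⌊s⌋₊, AEStronglyMeasurable (G j) volume)
    (hH : ∀ j ≤ ⌊s⌋₊, AEStronglyMeasurable (H j) volume) :
    normOfDerivs s p (fun j x => G j x - H j x) ≤ normOfDerivs s p G + normOfDerivs s p H := by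
  have hp0 : 0 < p := by linarith
  have hp1 : 1 ≤ ENNReal.ofReal p := by simpa using ENNReal.ofReal_le_ofReal hp
  unfold normOfDerivs
  rw [add_add_add_comm, ← Finset.sum_add_distrib]
  refine add_le_add (Finset.sum_le_sum fun j hj => ?_) ?_
  · have hj := Nat.lt_succ_iff.1 (Finset.mem_range.1 hj)
    exact eLpNorm_sub_le (hG j hj) (hH j hj) hp1
  · split_ifs
    · simp
    change gagliardoSeminorm _ p (G ⌊s⌋₊ - H ⌊s⌋₊) ≤ _
    rw [gagliardoSeminorm_eq_eLpNorm hp0 (hG _ le_rfl),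
      gagliardoSeminorm_eq_eLpNorm hp0 (hH _ le_rfl),
      gagliardoSeminorm_eq_eLpNorm hp0 ((hG _ le_rfl).sub (hH _ le_rfl))]
    convert! eLpNorm_sub_le (aestronglyMeasurable_diffQuotient (hG _ le_rfl))
      (aestronglyMeasurable_diffQuotient (hH _ le_rfl)) hp1 using 2
    ext1 z
    simp only [diffQuotient, Pi.sub_apply, ← smul_sub]
    congr 1
    abel

/-- Lower semicontinuity of the Sobolev norm under pointwise convergence of the derivatives. -/
theorem normOfDerivs_le_of_tendsto_ae (hp : 0 < p) {D : ℕ → (j : ℕ) → E → E [×j]→L[ℝ] F}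
    (hD : ∀ m, ∀ j ≤ ⌊s⌋₊, AEStronglyMeasurable (D m j) volume)
    (hlim : ∀ j ≤ ⌊s⌋₊, ∀ᵐ x, Filter.Tendsto (fun m => D m j x) Filter.atTop (nhds (G j x))) :
    normOfDerivs s p G ≤ Filter.liminf (fun m => normOfDerivs s p (D m)) Filter.atTop := by
  have hsum : ∀ S ⊆ Finset.range (⌊s⌋₊ + 1),
      ∑ j ∈ S, eLpNorm (G j) (ENNReal.ofReal p) volume ≤ Filter.liminf
        (fun m => ∑ j ∈ S, eLpNorm (D m j) (ENNReal.ofReal p) volume) Filter.atTop := by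
    intro S
    induction S using Finset.induction_on with
    | empty => simp
    | insert j S hj ih =>
      intro hS
      simp only [Finset.sum_insert hj]
      have hj' := Nat.lt_succ_iff.1 (Finset.mem_range.1 (hS (Finset.mem_insert_self j S)))
      refine (add_le_add (Lp.eLpNorm_lim_le_liminf_eLpNorm (fun m => hD m j hj') _ (hlim j hj'))
        (ih ((Finset.subset_insert _ _).trans hS))).trans ?_
      exact liminf_add_liminf_le _ _
  unfold normOfDerivs
  by_cases h : Int.fract s = 0
  · simpa [h] using hsum _ subset_rfl
  simp only [h, if_false]
  refine (add_le_add (hsum _ subset_rfl) ?_).trans (liminf_add_liminf_le _ _)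
  have hG : AEStronglyMeasurable (G ⌊s⌋₊) volume :=
    aestronglyMeasurable_of_tendsto_ae _ (fun m => hD m _ le_rfl) (hlim _ le_rfl)
  rw [gagliardoSeminorm_eq_eLpNorm hp hG]
  simp_rw [fun m => gagliardoSeminorm_eq_eLpNorm (σ := Int.fract s) hp (hD m _ le_rfl)]
  refine Lp.eLpNorm_lim_le_liminf_eLpNorm
    (fun m => aestronglyMeasurable_diffQuotient (hD m _ le_rfl)) _ ?_
  have h1 := (Measure.quasiMeasurePreserving_fst (μ := (volume : Measure E))
    (ν := (volume : Measure E))).ae (hlim _ le_rfl)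
  have h2 := (Measure.quasiMeasurePreserving_snd (μ := (volume : Measure E))
    (ν := (volume : Measure E))).ae (hlim _ le_rfl)
  filter_upwards [h1, h2] with z hz1 hz2
  exact (hz1.sub hz2).const_smul _

end Norm


/-! ### Limits in L^q and of weak differentials -/

section Limits

open Filter Topology

variable {α : Type*} [MeasurableSpace α] {μ : Measure α} {F : Type*} [NormedAddCommGroup F]

/-- The summable rate gives almost everywhere convergence of the whole sequence, so one sequence
serves all orders of differentiation. -/
theorem exists_memLp_limit_of_cauchy [CompleteSpace F] {q : ℝ≥0∞} (hq : 1 ≤ q) {u : ℕ → α → F}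
    (hu : ∀ m, MemLp (u m) q μ) {B : ℕ → ℝ≥0∞} (hB : ∑' i, B i ≠ ∞)
    (hcau : ∀ N m l : ℕ, N ≤ m → N ≤ l → eLpNorm (u m - u l) q μ < B N) :
    ∃ w : α → F, MemLp w q μ ∧ Tendsto (fun m => eLpNorm (u m - w) q μ) atTop (𝓝 0) ∧
      ∀ᵐ x ∂μ, Tendsto (fun m => u m x) atTop (𝓝 (w x)) := by
  obtain ⟨w, hw, hlim⟩ := exists_stronglyMeasurable_limit_of_tendsto_ae (fun m => (hu m).1)
    (Lp.ae_tendsto_of_cauchy_eLpNorm (fun m => (hu m).1) hq hB hcau)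
  have ht := Lp.cauchy_tendsto_of_tendsto (fun m => (hu m).1) w hB hcau hlim
  exact ⟨w, Lp.memLp_of_cauchy_tendsto hq hu w hw.aestronglyMeasurable ht, ht, hlim⟩

variable {E : Type*} [NormedAddCommGroup E] [MeasureSpace E] [BorelSpace E]
  [IsFiniteMeasureOnCompacts (volume : Measure E)] [NormedSpace ℝ F]

/-- Hölder with the conjugate exponent (1 - 1/q)^(-1), which is ∞ when q = 1. -/
theorem tendsto_integral_smul_of_tendsto_eLpNorm {q : ℝ≥0∞} (hq : 1 ≤ q) {h : E → ℝ}
    (hh : Continuous h) (hhc : HasCompactSupport h) {u : ℕ → E → F} {w : E → F}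
    (hu : ∀ m, MemLp (u m) q volume) (hw : MemLp w q volume)
    (hlim : Tendsto (fun m => eLpNorm (u m - w) q volume) atTop (𝓝 0)) :
    Tendsto (fun m => ∫ x, h x • u m x) atTop (𝓝 (∫ x, h x • w x)) := by
  have hqc := (ENNReal.HolderConjugate.inv_one_sub_inv' hq).symm
  have hhq : MemLp h (1 - q⁻¹)⁻¹ (volume : Measure E) := hh.memLp_of_hasCompactSupport hhc
  refine tendsto_integral_of_L1' _ (hhq.1.smul hw.1)
    (Eventually.of_forall fun m => memLp_one_iff_integrable.1 ((hu m).smul hhq)) ?_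
  have hle : ∀ m, eLpNorm ((fun x => h x • u m x) - fun x => h x • w x) 1 volume ≤
      eLpNorm h (1 - q⁻¹)⁻¹ volume * eLpNorm (u m - w) q volume := fun m => by
    have := eLpNorm_smul_le_mul_eLpNorm (r := 1) ((hu m).1.sub hw.1) hhq.1 (q := q)
      (p := (1 - q⁻¹)⁻¹)
    convert! this using 2
    ext1 x
    simp [smul_sub]
  refine tendsto_of_tendsto_of_tendsto_of_le_of_le tendsto_const_nhds ?_ (fun _ => zero_le) hle
  simpa using ENNReal.Tendsto.const_mul hlim (Or.inr hhq.2.ne)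

end Limits

section WeakLimit

open Filter Topology

variable {E F : Type*} [NormedAddCommGroup E] [NormedSpace ℝ E] [MeasureSpace E] [BorelSpace E]
  [IsFiniteMeasureOnCompacts (volume : Measure E)] [IsLocallyFiniteMeasure (volume : Measure E)]
  [NormedAddCommGroup F] [NormedSpace ℝ F] [CompleteSpace F]

/-- Weak differentials pass to `L^q`-limits. -/
theorem isWeakDeriv_of_tendsto {q : ℝ≥0∞} (hq : 1 ≤ q) {j : ℕ} {u : ℕ → E → F} {w : E → F}
    {D : ℕ → E → E [×j]→L[ℝ] F} {G : E → E [×j]→L[ℝ] F} (h : ∀ m, IsWeakDeriv j (u m) (D m))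
    (hu : ∀ m, MemLp (u m) q volume) (hw : MemLp w q volume) (hD : ∀ m, MemLp (D m) q volume)
    (hG : MemLp G q volume) (hulim : Tendsto (fun m => eLpNorm (u m - w) q volume) atTop (𝓝 0))
    (hDlim : Tendsto (fun m => eLpNorm (D m - G) q volume) atTop (𝓝 0)) : IsWeakDeriv j w G where
  locallyIntegrable := hw.locallyIntegrable hq
  locallyIntegrable_deriv := hG.locallyIntegrable hq
  integral_eq φ v := by
    have h1 := tendsto_integral_smul_of_tendsto_eLpNorm hq
      (contDiff_iteratedFDeriv_apply φ.contDiff j v).continuous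
      ((φ.hasCompactSupport.iteratedFDeriv j).comp_left (g := fun A : E [×j]→L[ℝ] ℝ => A v) rfl)
      hu hw hulim
    have h2 := tendsto_integral_smul_of_tendsto_eLpNorm hq φ.continuous φ.hasCompactSupport
      hD hG hDlim
    have happ : ∀ {A : E → E [×j]→L[ℝ] F}, MemLp A q volume →
        (∫ x, φ x • A x) v = ∫ x, φ x • A x v := fun {A} hA =>
      ((ContinuousMultilinearMap.apply ℝ (fun _ : Fin j => E) F v).integral_comp_comm
        ((hA.locallyIntegrable hq).integrable_smul_left_of_hasCompactSupport φ.continuous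
          φ.hasCompactSupport)).symm
    have h3 := (((ContinuousMultilinearMap.apply ℝ (fun _ : Fin j => E) F v).continuous.tendsto
      _).comp h2).const_smul ((-1 : ℝ) ^ j)
    refine (tendsto_nhds_unique h1 (h3.congr fun m => ?_)).trans ?_
    · rw [(h m).integral_eq φ v, ← happ (hD m)]
      rfl
    · rw [← happ hG]
      rfl

end WeakLimit


/-! ### Approximation by test functions -/

section Density

open Filter Topology

variable {E F : Type*} [NormedAddCommGroup E] [NormedSpace ℝ E] [MeasureSpace E]
  [NormedAddCommGroup F] [NormedSpace ℝ F] {s p : ℝ} {Ω : Opens E}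

theorem exists_isWeakDeriv_of_sobolevNorm_lt {f : E → F} {ε : ℝ≥0∞} (h : sobolevNorm s p f < ε) :
    ∃ G : (j : ℕ) → E → E [×j]→L[ℝ] F, (∀ j ≤ ⌊s⌋₊, IsWeakDeriv j f (G j)) ∧
      normOfDerivs s p G < ε := by
  simpa only [sobolevNorm, iInf_lt_iff, exists_prop] using h

theorem MemSobolevZero.sub_testFunction {f : E → F} (hf : MemSobolevZero s p Ω f) (φ : 𝓓(Ω, F))
    (hφ : sobolevNorm s p (fun x => f x - φ x) < ∞) :
    MemSobolevZero s p Ω fun x => f x - φ x := by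
  refine ⟨hφ, fun ε hε => ?_⟩
  obtain ⟨ψ, hψ⟩ := hf.2 ε hε
  refine ⟨ψ - φ, ?_⟩
  convert hψ using 2
  ext1 x
  simp

variable [BorelSpace E] [(volume : Measure E).IsAddHaarMeasure]

theorem memLp_iteratedFDeriv (φ : 𝓓(Ω, F)) (j : ℕ) (q : ℝ≥0∞) :
    MemLp (iteratedFDeriv ℝ j φ) q volume :=
  (φ.contDiff.continuous_iteratedFDeriv (by exact_mod_cast le_top)).memLp_of_hasCompactSupport
    (φ.hasCompactSupport.iteratedFDeriv j)

theorem smoothNorm_eq_normOfDerivs [FiniteDimensional ℝ E] [CompleteSpace F] (φ : 𝓓(Ω, F))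
    {G : (j : ℕ) → E → E [×j]→L[ℝ] F}
    (hG : ∀ j ≤ ⌊s⌋₊, IsWeakDeriv j φ (G j)) :
    smoothNorm s p (φ : E → F) = normOfDerivs s p G :=
  normOfDerivs_congr_ae fun j hj => (isWeakDeriv_iteratedFDeriv φ j).ae_eq (hG j hj)

end Density

/-! ### Extension of the operators to the closure -/

section RadialOperator

open Filter Topology

variable {n : ℕ} {V : Type*} [NormedAddCommGroup V] [NormedSpace ℝ V] [CompleteSpace V]

/-- Approximate f by test functions at rate 2^(-m). Their images are Cauchy by the smooth bound, and
the limits of their differentials turn out to be the weak differentials of the image of f. Only L^p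
and pointwise limits are needed: Fatou supplies the Gagliardo term and keeps the constant C. -/
theorem sobolevNorm_radial_le (hn : 1 ≤ n) {s p : ℝ} (hp : 1 ≤ p)
    {P : EuclideanSpace ℝ (Fin n) → V} (hP : IsAngular P) {C : ℝ≥0} (hC0 : 0 < C)
    (hC : ∀ f : 𝓓(interval01, ℝ),
      smoothNorm s p (fun x => f ‖x‖ • P x) ≤ C * smoothNorm s p (f : ℝ → ℝ))
    {f : ℝ → ℝ} (hf : MemSobolevZero s p interval01 f) :
    sobolevNorm s p (fun x => f ‖x‖ • P x) ≤ C * sobolevNorm s p f := by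
  have hp0 : 0 < p := by linarith
  have hp1 : 1 ≤ ENNReal.ofReal p := by simpa using ENNReal.ofReal_le_ofReal hp
  have hC0' : (C : ℝ≥0∞) ≠ 0 := by simpa using hC0.ne'
  have hr : ∀ m : ℕ, (0 : ℝ≥0∞) < 2⁻¹ ^ m := fun m => ENNReal.pow_pos (by simp) m
  have hr0 : Tendsto (fun m : ℕ => (2⁻¹ : ℝ≥0∞) ^ m) atTop (𝓝 0) :=
    ENNReal.tendsto_pow_atTop_nhds_zero_of_lt_one (by simp [ENNReal.inv_lt_one])
  rw [sobolevNorm.eq_def s p f, ENNReal.mul_iInf_of_ne hC0' ENNReal.coe_ne_top]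
  refine le_iInf fun G => ?_
  rw [ENNReal.mul_iInf_of_ne hC0' ENNReal.coe_ne_top]
  refine le_iInf fun hG => ?_
  choose φ hφ using fun m : ℕ => hf.2 (2⁻¹ ^ m) (hr m)
  choose H hH hHlt using fun m => exists_isWeakDeriv_of_sobolevNorm_lt (hφ m)
  have hGm : ∀ j ≤ ⌊s⌋₊, AEStronglyMeasurable (G j) volume := fun j hj =>
    (hG j hj).locallyIntegrable_deriv.aestronglyMeasurable
  have hHm : ∀ m, ∀ j ≤ ⌊s⌋₊, AEStronglyMeasurable (H m j) volume := fun m j hj =>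
    (hH m j hj).locallyIntegrable_deriv.aestronglyMeasurable
  -- Since φ_m = f - (f - φ_m), its weak differentials are `G` minus `H m`.
  have hφG : ∀ m, smoothNorm s p (φ m : ℝ → ℝ) ≤ normOfDerivs s p G + 2⁻¹ ^ m := fun m => by
    rw [smoothNorm_eq_normOfDerivs (G := fun j x => G j x - H m j x) (φ m) fun j hj => by
      simpa using (hG j hj).sub (hH m j hj)]
    exact (normOfDerivs_sub_le hp hGm (hHm m)).trans (by gcongr; exact (hHlt m).le)
  have hφsub : ∀ N m l : ℕ, N ≤ m → N ≤ l →
      smoothNorm s p ((φ m - φ l : 𝓓(interval01, ℝ)) : ℝ → ℝ) < 2 * 2⁻¹ ^ N := fun N m l hm hl => by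
    rw [smoothNorm_eq_normOfDerivs (G := fun j x => H l j x - H m j x) (φ m - φ l) fun j hj => by
      refine ((hH l j hj).sub (hH m j hj)).congr_ae (Eventually.of_forall fun x => ?_)
      simp]
    refine (normOfDerivs_sub_le hp (hHm l) (hHm m)).trans_lt ?_
    rw [two_mul]
    exact ENNReal.add_lt_add ((hHlt l).trans_le (pow_le_pow_of_le_one zero_le (by simp) hl))
      ((hHlt m).trans_le (pow_le_pow_of_le_one zero_le (by simp) hm))
  choose u hu using fun m => exists_testFunction_eq_radial hP (φ m)
  have husub : ∀ m l, (fun x => (φ m - φ l : 𝓓(interval01, ℝ)) ‖x‖ • P x) =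
      (u m - u l : 𝓓(unitBall n, V)) := fun m l => by
    ext1 x
    simp [hu, sub_smul]
  have hcau : ∀ j ≤ ⌊s⌋₊, ∀ N m l : ℕ, N ≤ m → N ≤ l →
      eLpNorm (iteratedFDeriv ℝ j (u m) - iteratedFDeriv ℝ j (u l)) (ENNReal.ofReal p) volume <
        C * (2 * 2⁻¹ ^ N) := fun j hj N m l hm hl => by
    have h1 := hC (φ m - φ l)
    rw [husub] at h1
    have h2 : iteratedFDeriv ℝ j (u m) - iteratedFDeriv ℝ j (u l) =
        iteratedFDeriv ℝ j (u m - u l : 𝓓(unitBall n, V)) := by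
      have h3 : ((u m - u l : 𝓓(unitBall n, V)) : EuclideanSpace ℝ (Fin n) → V) =
          ⇑(u m) - ⇑(u l) := by
        ext1 x
        simp
      rw [h3, iteratedFDeriv_sub ((u m).contDiff.of_le (by exact_mod_cast le_top))
        ((u l).contDiff.of_le (by exact_mod_cast le_top))]
    rw [h2]
    refine ((eLpNorm_le_normOfDerivs hj).trans h1).trans_lt ?_
    exact ENNReal.mul_lt_mul_right hC0' ENNReal.coe_ne_top (hφsub N m l hm hl)
  have hB : ∑' N : ℕ, (C : ℝ≥0∞) * (2 * 2⁻¹ ^ N) ≠ ∞ := by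
    rw [ENNReal.tsum_mul_left, ENNReal.tsum_mul_left, ENNReal.tsum_geometric]
    simp [ENNReal.mul_eq_top]
  have hL : ∀ j, ∃ L : EuclideanSpace ℝ (Fin n) → EuclideanSpace ℝ (Fin n) [×j]→L[ℝ] V, j ≤ ⌊s⌋₊ →
      MemLp L (ENNReal.ofReal p) volume ∧
      Tendsto (fun m => eLpNorm (iteratedFDeriv ℝ j (u m) - L) (ENNReal.ofReal p) volume)
        atTop (𝓝 0) ∧
      ∀ᵐ x, Tendsto (fun m => iteratedFDeriv ℝ j (u m) x) atTop (𝓝 (L x)) := fun j => by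
    by_cases hj : j ≤ ⌊s⌋₊
    · obtain ⟨L, h⟩ := exists_memLp_limit_of_cauchy hp1 (fun m => memLp_iteratedFDeriv (u m) j _) hB
        (hcau j hj)
      exact ⟨L, fun _ => h⟩
    · exact ⟨0, fun h => absurd h hj⟩
  choose L hL using hL
  obtain ⟨hL0, hL0lim, hL0ae⟩ := hL 0 (Nat.zero_le _)
  -- A subsequence of φ_m converges to f almost everywhere on the line, hence along |x| for almost
  -- every x; this identifies the limit of order zero.
  have hTf : (fun x => L 0 x 0) =ᵐ[volume] fun x => f ‖x‖ • P x := by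
    have hφf : Tendsto (fun m => eLpNorm (⇑(φ m) - f) (ENNReal.ofReal p) volume) atTop (𝓝 0) := by
      refine tendsto_of_tendsto_of_tendsto_of_le_of_le tendsto_const_nhds hr0 (fun _ => zero_le)
        fun m => ?_
      rw [eLpNorm_sub_comm]
      refine le_trans (le_of_eq ?_)
        ((eLpNorm_le_normOfDerivs (G := H m) (Nat.zero_le _)).trans (hHlt m).le)
      refine (eLpNorm_congr_enorm_ae (hH m 0 (Nat.zero_le _)).enorm_zero_ae).symm
    obtain ⟨ns, hns, hae⟩ := (tendstoInMeasure_of_tendsto_eLpNorm (by simpa using hp0)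
      (fun m => (φ m).continuous.aestronglyMeasurable)
      (hG 0 (Nat.zero_le _)).locallyIntegrable.aestronglyMeasurable hφf).exists_seq_tendsto_ae
    filter_upwards [(quasiMeasurePreserving_norm hn).ae hae, hL0ae] with x hx1 hx2
    refine tendsto_nhds_unique ((((ContinuousMultilinearMap.apply ℝ
      (fun _ : Fin 0 => EuclideanSpace ℝ (Fin n)) V 0).continuous.tendsto _).comp hx2).comp
        hns.tendsto_atTop) ((hx1.smul_const (P x)).congr fun i => ?_)
    simp [hu]
  have hweak : ∀ j ≤ ⌊s⌋₊, IsWeakDeriv j (fun x => f ‖x‖ • P x) (L j) := fun j hj => by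
    obtain ⟨hLj, hLjlim, -⟩ := hL j hj
    have hnorm : ∀ A : EuclideanSpace ℝ (Fin n) → EuclideanSpace ℝ (Fin n) [×0]→L[ℝ] V,
        eLpNorm (fun x => A x 0) (ENNReal.ofReal p) volume =
          eLpNorm A (ENNReal.ofReal p) volume := fun A =>
      eLpNorm_congr_norm_ae (Eventually.of_forall fun x =>
        (ContinuousMultilinearMap.fin0_apply_norm (A x)))
    refine (isWeakDeriv_of_tendsto hp1 (u := fun m => u m) (w := fun x => L 0 x 0)
      (fun m => isWeakDeriv_iteratedFDeriv (u m) j)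
      (fun m => (u m).continuous.memLp_of_hasCompactSupport (u m).hasCompactSupport) ⟨?_, ?_⟩
      (fun m => memLp_iteratedFDeriv (u m) j _) hLj ?_ hLjlim).congr_ae hTf
    · exact (ContinuousMultilinearMap.apply ℝ
        (fun _ : Fin 0 => EuclideanSpace ℝ (Fin n)) V 0).continuous.comp_aestronglyMeasurable hL0.1
    · rw [hnorm]
      exact hL0.2
    · refine hL0lim.congr fun m => ?_
      rw [← hnorm]
      congr 1
  refine (iInf₂_le L hweak).trans ((normOfDerivs_le_of_tendsto_ae hp0
    (D := fun m j => iteratedFDeriv ℝ j (u m)) (fun m j _ => (memLp_iteratedFDeriv (u m) j 1).1)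
    fun j hj => (hL j hj).2.2).trans ?_)
  have hlim : Tendsto (fun m : ℕ => (C : ℝ≥0∞) * (normOfDerivs s p G + 2⁻¹ ^ m)) atTop
      (𝓝 (C * normOfDerivs s p G)) := by
    simpa using ENNReal.Tendsto.const_mul (tendsto_const_nhds.add hr0) (Or.inr ENNReal.coe_ne_top)
  rw [← hlim.liminf_eq]
  refine liminf_le_liminf (Eventually.of_forall fun m => ?_)
  calc normOfDerivs s p (fun j => iteratedFDeriv ℝ j (u m))
      = smoothNorm s p (fun x => φ m ‖x‖ • P x) := by
        rw [← hu]; rfl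
    _ ≤ C * smoothNorm s p (φ m : ℝ → ℝ) := hC _
    _ ≤ _ := by gcongr; exact hφG m

theorem memSobolevZero_radial (hn : 1 ≤ n) {s p : ℝ} (hp : 1 ≤ p)
    {P : EuclideanSpace ℝ (Fin n) → V} (hP : IsAngular P) {C : ℝ≥0} (hC0 : 0 < C)
    (hC : ∀ f : 𝓓(interval01, ℝ),
      smoothNorm s p (fun x => f ‖x‖ • P x) ≤ C * smoothNorm s p (f : ℝ → ℝ))
    {f : ℝ → ℝ} (hf : MemSobolevZero s p interval01 f) :
    MemSobolevZero s p (unitBall n) fun x => f ‖x‖ • P x := by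
  refine ⟨(sobolevNorm_radial_le hn hp hP hC0 hC hf).trans_lt
    (ENNReal.mul_lt_top ENNReal.coe_lt_top hf.1), fun ε hε => ?_⟩
  have hC0' : (C : ℝ≥0∞) ≠ 0 := by simpa using hC0.ne'
  -- The bound ε/C serves the estimate; the bound 1 keeps the norm of f - φ finite even if ε = ∞.
  obtain ⟨φ, hφ⟩ := hf.2 (min (ε / C) 1)
    (lt_min (ENNReal.div_pos hε.ne' ENNReal.coe_ne_top) one_pos)
  obtain ⟨g, hg⟩ := exists_testFunction_eq_radial hP φ
  refine ⟨g, ?_⟩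
  have := sobolevNorm_radial_le hn hp hP hC0 hC (hf.sub_testFunction φ
    (hφ.trans_le ((min_le_right _ _).trans ENNReal.one_lt_top.le)))
  simp only [sub_smul] at this
  rw [hg]
  refine this.trans_lt ?_
  rw [mul_comm]
  exact (ENNReal.lt_div_iff_mul_lt (Or.inl hC0') (Or.inl ENNReal.coe_ne_top)).1
    (hφ.trans_le (min_le_left _ _))

end RadialOperator

end RadialSobolev

theorem mainTheorem11 (n : ℕ) (hn : 1 < n) (s p : ℝ) (hs : 0 ≤ s) (hp : 1 ≤ p) :
    (∃ C : ℝ≥0, 0 < C ∧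
      (∀ f : 𝓓(RadialSobolev.interval01, ℝ),
        (∃ g : 𝓓(RadialSobolev.unitBall n, ℝ), (g : EuclideanSpace ℝ (Fin n) → ℝ) =
          RadialSobolev.radialFunction n f) ∧
        RadialSobolev.smoothNorm s p (RadialSobolev.radialFunction n f) ≤
          C * RadialSobolev.smoothNorm s p (f : ℝ → ℝ)) ∧
      (∀ f : ℝ → ℝ, RadialSobolev.MemSobolevZero s p RadialSobolev.interval01 f →
        RadialSobolev.MemSobolevZero s p (RadialSobolev.unitBall n)
          (RadialSobolev.radialFunction n f) ∧
        RadialSobolev.sobolevNorm s p (RadialSobolev.radialFunction n f) ≤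
          C * RadialSobolev.sobolevNorm s p f)) ∧
    (∃ C : ℝ≥0, 0 < C ∧
      (∀ f : 𝓓(RadialSobolev.interval01, ℝ),
        (∃ g : 𝓓(RadialSobolev.unitBall n, EuclideanSpace ℝ (Fin n)),
          (g : EuclideanSpace ℝ (Fin n) → EuclideanSpace ℝ (Fin n)) =
            RadialSobolev.radialField n f) ∧
        RadialSobolev.smoothNorm s p (RadialSobolev.radialField n f) ≤
          C * RadialSobolev.smoothNorm s p (f : ℝ → ℝ)) ∧
      (∀ f : ℝ → ℝ, RadialSobolev.MemSobolevZero s p RadialSobolev.interval01 f →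
        RadialSobolev.MemSobolevZero s p (RadialSobolev.unitBall n)
          (RadialSobolev.radialField n f) ∧
        RadialSobolev.sobolevNorm s p (RadialSobolev.radialField n f) ≤
          C * RadialSobolev.sobolevNorm s p f)) := by
  obtain ⟨C, hC0, hC⟩ := RadialSobolev.exists_smoothNorm_radial_le (n := n) hn s hp
    (RadialSobolev.isAngular_const (1 : ℝ))
  obtain ⟨D, hD0, hD⟩ := RadialSobolev.exists_smoothNorm_radial_le (n := n) hn s hp
    RadialSobolev.isAngular_direction
  -- Only T needs rewriting into the form f(|x|) P(x); T̃ has it by definition.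
  have hT : ∀ f : ℝ → ℝ, RadialSobolev.radialFunction n f = fun x => f ‖x‖ • (1 : ℝ) := fun f => by
    ext1 x
    simp [RadialSobolev.radialFunction]
  simp only [hT]
  refine ⟨⟨C, hC0, fun f => ⟨?_, hC f⟩, fun f hf => ⟨?_, ?_⟩⟩,
    ⟨D, hD0, fun f => ⟨?_, hD f⟩, fun f hf => ⟨?_, ?_⟩⟩⟩
  · exact RadialSobolev.exists_testFunction_eq_radial (RadialSobolev.isAngular_const 1) f
  · exact RadialSobolev.memSobolevZero_radial hn.le hp (RadialSobolev.isAngular_const 1) hC0 hC hf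
  · exact RadialSobolev.sobolevNorm_radial_le hn.le hp (RadialSobolev.isAngular_const 1) hC0 hC hf
  · exact RadialSobolev.exists_testFunction_eq_radial RadialSobolev.isAngular_direction f
  · exact RadialSobolev.memSobolevZero_radial hn.le hp RadialSobolev.isAngular_direction hD0 hD hf
  · exact RadialSobolev.sobolevNorm_radial_le hn.le hp RadialSobolev.isAngular_direction hD0 hD hf
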